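/- **Setting.** Let $d\ge 1$. Let $\nu\ne 0$ be a measure on $\mathbb R_0=\mathbb R\setminus\{0\}$ with $m_2=\int z^2\nu(dz)<\infty$, and let $N$ be a Poisson random measure on $\mathbb R^d\times\mathbb R_0$ of intensity $\mathfrak m(dx,dz)=dx\,\nu(dz)$, defined on a probability space $(\Omega,\mathcal F,\mathbb P)$. Put $\widehat N=N-\mathfrak m$, and for $\varphi\in L^2(\mathbb R^d)$ let $L(\varphi)=\int\varphi(x)z\,\widehat N(dx,dz)$, where the integral with respect to $\widehat N$ is the bounded linear extension of $1_B\mapsto \widehat N(B)$, $\mathfrak m(B)<\infty$, to a map $L^2(\mathfrak m)\to L^2(\Omega)$. Write $\mathcal F\varphi(\xi)=\int e^{-i\xi\cdot x}\varphi(x)dx$, with $(\mathcal F T,\psi)=(T,\mathcal F\psi)$ for tempered distributions. A function $u$ is *tempered* if it is measurable and $\int|u(x)|(1+|x|^2)^{-k}dx<\infty$ for some $k$. Let $\kappa:\mathbb R^d\to[0,\infty]$ be a tempered function such that $h=\mathcal F\kappa$ and $|h|^2$ are tempered functions and $|h|^2=\mathcal F f$ for some tempered $f\ge 0$. Put $\mu(d\xi)=(2\pi)^{-d}|h(\xi)|^2d\xi$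 and $X(\varphi)=L(\varphi*\kappa)$ for $\varphi\in\mathcal S(\mathbb R^d)$. If $S$ is a real tempered distribution whose Fourier transform is a function in $L^2(\mu)$, then $X(S)=\int S(x)X(dx)$ is the $L^2(\Omega)$-limit of $X(\varphi_n)$ for $\varphi_n\in\mathcal D(\mathbb R^d)$ with $\int|\mathcal F\varphi_n-\mathcal FS|^2d\mu\to0$. Let $(G_t)_{t>0}$ be real tempered distributions on $\mathbb R^d$ (the fundamental solution of an operator $\mathcal L$ in the equation $\mathcal Lv=\dot X$). Consider the hypotheses: * **(A)** for every $t>0$, $G_t\in\mathcal O_C'(\mathbb R^d)$, i.e. $(1+|x|^2)^{k/2}G_t$ is a bounded distribution for every $k\in\mathbb N$ (then $\mathcal FG_t$ is a continuous function); * **(F)** $t\mapsto\mathcal FG_t(\xi)$ is continuous on $(0,\infty)$ for every $\xi$, and $|\mathcal FG_t(\xi)|\le C_t$ for all $t>0$ and $\xi$, with $C_t$ nondecreasing in $t$. For $t>0$ and $\phi\in\mathcal D(\mathbb R^d)$ the *distribution solution* is $v^{(t)}(\phi)=\int_0^t\widetilde Y(s)ds$ a.s., where $\widetilde Y$ is a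 jointly measurable process, a.s. integrable on $[0,t]$, with $\widetilde Y(s)=X(\phi*\widetilde G_{t-s})$ a.s. for every $s\in[0,t)$; here $(\phi*\widetilde G_{r})(y)=(G_{r},\phi(\cdot+y))$. A *random field solution* is a process $\{v(t,x);t\ge0,x\in\mathbb R^d\}$ such that $v(t,x)=\int_0^t\widetilde Y(s)ds$ a.s., where $\widetilde Y$ is a jointly measurable process, a.s. integrable on $[0,t]$, with $\widetilde Y(s)=X(G_{t-s}(x-\cdot))$ a.s. for every $s\in[0,t)$ (in particular, all these integrals $X(\cdot)$ are defined). It has the *Fubini representation* if, for all $t,x$, $$v(t,x)=\int_{\mathbb R^d}\Big(\int_0^t\big(G_{t-s}(x-\cdot)*\kappa\big)(y)\,ds\Big)L(dy)\quad\text{a.s.},$$ where, for almost every $s\in(0,t)$, $G_{t-s}(x-\cdot)*\kappa$ is a function in $L^2(\mathbb R^d)$, $(s,y)\mapsto(G_{t-s}(x-\cdot)*\kappa)(y)$ has a jointly measurable version that is integrable on $[0,t]\times K$ for every compact $K$, and the inner integral, as a function of $y$, is in $L^2(\mathbb R^d)$. Let $H_t(\xi)=\int_0^t\mathcal FG_{t-s}(\xi)ds$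 for $t\ge 0$. **Theorem.** (1) Suppose that (A) and (F) hold. Then a distribution solution $v^{(t)}(\phi)$ exists, and for any such solution the following are equivalent: (a) there is a jointly measurable process $V=\{V(t,x);t\ge0,x\in\mathbb R^d\}$ which is locally mean-square bounded ($\sup_{t\le T,x\in K}\mathbb E|V(t,x)|^2<\infty$ for all $T$ and all compact $K$) and continuous in mean square in $(t,x)$, such that for all $t>0$ and $\phi\in\mathcal D(\mathbb R^d)$ $$v^{(t)}(\phi)=\int_{\mathbb R^d}V(t,x)\phi(x)dx\quad\text{a.s.};$$ (b) $\sup_{t\in[0,T]}\int|H_t|^2d\mu<\infty$ for every $T>0$, and $\lim_{t\to s}\int|H_t-H_s|^2d\mu=0$ for every $s\ge0$ (the limit over $t\geq 0$). Moreover, if $V$ is as in (a) and $v$ is a random field solution with the Fubini representation, then $V$ is a modification of $v$: $V(t,x)=v(t,x)$ a.s. for all $t\ge 0$ and $x\in\mathbb R^d$. (2) Suppose that $\int(1+|\xi|^2)^{-1}\mu(d\xi)<\infty$, and that $G_t$ is the fundamental solution of the heat operator $\partial_t-\frac12\Delta$, $G_t(x)=(2\pi t)^{-d/2}e^{-|x|^2/(2t)}$,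 or of the wave operator $\partial_t^2-\Delta$, with $\mathcal FG_t(\xi)=\sin(t|\xi|)/|\xi|$. Then (A), (F) and both conditions in (b) hold. Hence for every distribution solution a process $V$ as in (a) exists, and every such $V$ is a modification of every random field solution $v$. -/

import Mathlib

open MeasureTheory ProbabilityTheory Filter Topology Set
open scoped ENNReal NNReal SchwartzMap FourierTransform

noncomputable section

namespace LevySPDE

/-- The Euclidean space `ℝ^d`. -/
abbrev Eu (d : ℕ) : Type := EuclideanSpace ℝ (Fin d)

/-- Real tempered distributions on `ℝ^d`. -/
abbrev RealDist (d : ℕ) : Type := 𝓢(Eu d, ℝ) →L[ℝ] ℝ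

section Fourier

variable {d : ℕ}

/-- The dilation `ξ ↦ (2π)⁻¹ ξ`. -/
def dilation (d : ℕ) : Eu d ≃L[ℝ] Eu d :=
  ContinuousLinearEquiv.smulLeft
    (Units.mk0 ((2 * Real.pi)⁻¹ : ℝ) (inv_ne_zero (by positivity)))

/-- The Fourier transform `𝓕ψ(ξ) = ∫ exp(-i ξ·x) ψ(x) dx` on complex Schwartz functions. -/
def fourierS (ψ : 𝓢(Eu d, ℂ)) : 𝓢(Eu d, ℂ) :=
  SchwartzMap.compCLMOfContinuousLinearEquiv ℂ (dilation d) (𝓕 ψ)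

theorem fourierS_apply (ψ : 𝓢(Eu d, ℂ)) (ξ : Eu d) :
    fourierS ψ ξ = ∫ x, Complex.exp (-Complex.I * (inner ℝ ξ x : ℝ)) * ψ x := by
  have h1 : fourierS ψ ξ = (𝓕 (ψ : Eu d → ℂ)) ((2 * Real.pi)⁻¹ • ξ) := by
    rw [← SchwartzMap.fourier_coe]
    rfl
  rw [h1, Real.fourier_eq']
  refine integral_congr_ae (Eventually.of_forall fun x => ?_)
  simp only [smul_eq_mul]
  congr 2
  rw [real_inner_smul_right, real_inner_comm]
  have hpi : (Real.pi : ℂ) ≠ 0 := by exact_mod_cast Real.pi_ne_zero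
  push_cast
  field_simp

/-- The complexification of a real distribution, `T(Re ψ) + i T(Im ψ)`. -/
def complexPairing (T : RealDist d) (ψ : 𝓢(Eu d, ℂ)) : ℂ :=
  (T (SchwartzMap.postcompCLM Complex.reCLM ψ) : ℂ)
    + Complex.I * (T (SchwartzMap.postcompCLM Complex.imCLM ψ) : ℂ)

/-- The distributional Fourier transform of `T`, `(𝓕T, ψ) = (T, 𝓕ψ)`, is the function `g`. -/
def HasFourier (T : RealDist d) (g : Eu d → ℂ) : Prop :=
  LocallyIntegrable g ∧
    ∀ ψ : 𝓢(Eu d, ℂ), HasCompactSupport ψ →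
      complexPairing T (fourierS ψ) = ∫ ξ, g ξ * ψ ξ

open Classical in
/-- The Fourier transform of `T` as a function: its (unique) continuous version, when the
distributional Fourier transform is a continuous function, as it is for every distribution
with rapid decrease. -/
def fourierFun (T : RealDist d) : Eu d → ℂ :=
  if H : ∃ g : Eu d → ℂ, Continuous g ∧ HasFourier T g then H.choose else 0

/-- `T` is a bounded distribution: it extends continuously from test functions to
`𝓓_{L¹}` (smooth functions with all derivatives integrable, with the seminorms
`∑_{i ≤ m} ‖Dⁱφ‖_{L¹}`). -/
def IsBoundedDist (T : RealDist d) : Prop :=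
  ∃ (m : ℕ) (C : ℝ), ∀ φ : 𝓢(Eu d, ℝ), HasCompactSupport φ →
    |T φ| ≤ C * ∑ i ∈ Finset.range (m + 1), ∫ x, ‖iteratedFDeriv ℝ i φ x‖

/-- The space `𝓞_C'` of distributions with rapid decrease:
`(1 + |x|²)^{k/2} T` is a bounded distribution for every `k`. -/
def IsRapidlyDecreasing (T : RealDist d) : Prop :=
  ∀ k : ℕ, IsBoundedDist
    (T ∘L SchwartzMap.smulLeftCLM ℝ (fun x : Eu d => (1 + ‖x‖ ^ 2) ^ ((k : ℝ) / 2)))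

/-- `φ ↦ φ(· + a)`. -/
def translate (a : Eu d) : 𝓢(Eu d, ℝ) →L[ℝ] 𝓢(Eu d, ℝ) :=
  SchwartzMap.compSubConstCLM ℝ (-a)

theorem translate_apply (a : Eu d) (φ : 𝓢(Eu d, ℝ)) (x : Eu d) :
    translate a φ x = φ (x + a) := by
  simp [translate]

/-- `φ ↦ φ(-·)`. -/
def reflect : 𝓢(Eu d, ℝ) →L[ℝ] 𝓢(Eu d, ℝ) :=
  SchwartzMap.compCLMOfContinuousLinearEquiv ℝ (ContinuousLinearEquiv.neg ℝ)

theorem reflect_apply (φ : 𝓢(Eu d, ℝ)) (x : Eu d) : reflect φ x = φ (-x) := rfl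

/-- The distribution `T(x - ·)`, that is `φ ↦ (T, z ↦ φ(x - z))`. -/
def shifted (T : RealDist d) (x : Eu d) : RealDist d :=
  T ∘L reflect ∘L translate x

/-- The function `(φ * T̃)(y) = (T, φ(· + y))`, where `T̃` is the reflection of `T`. -/
def convTilde (T : RealDist d) (φ : 𝓢(Eu d, ℝ)) : Eu d → ℝ :=
  fun y => T (translate y φ)

end Fourier

section Noise

variable {d : ℕ} {Ω : Type*} [MeasurableSpace Ω]

/-- Tempered (nonnegative, extended) functions. -/
def IsTempered (u : Eu d → ℝ≥0∞) : Prop :=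
  Measurable u ∧ ∃ k : ℕ, (∫⁻ x, u x * ENNReal.ofReal (((1 + ‖x‖ ^ 2) ^ k)⁻¹)) < ∞

/-- The standing assumption on the kernel `κ`; the function `h` is its Fourier transform. -/
structure KernelAssumption (κ : Eu d → ℝ≥0∞) (h : Eu d → ℂ) : Prop where
  tempered : IsTempered κ
  measurable_fourier : Measurable h
  tempered_fourier : IsTempered fun ξ => ‖h ξ‖ₑ
  fourier_eq : ∀ ψ : 𝓢(Eu d, ℂ),
    ∫ ξ, h ξ * ψ ξ = ∫ x, ((κ x).toReal : ℂ) * fourierS ψ x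
  tempered_sq : IsTempered fun ξ => ‖h ξ‖ₑ ^ 2
  exists_cov : ∃ f : Eu d → ℝ≥0∞, IsTempered f ∧ ∀ ψ : 𝓢(Eu d, ℂ),
    ∫ ξ, ((‖h ξ‖ ^ 2 : ℝ) : ℂ) * ψ ξ = ∫ x, ((f x).toReal : ℂ) * fourierS ψ x

/-- The spectral measure `μ(dξ) = (2π)^{-d} |h(ξ)|² dξ`. -/
def spectralMeasure (h : Eu d → ℂ) : Measure (Eu d) :=
  ENNReal.ofReal (((2 * Real.pi) ^ d)⁻¹) • volume.withDensity fun ξ => ‖h ξ‖ₑ ^ 2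

/-- A nonzero measure on `ℝ \ {0}` with a finite second moment. -/
structure IsJumpMeasure (ν : Measure ℝ) : Prop where
  zero : ν {0} = 0
  ne_zero : ν ≠ 0
  second_moment : (∫⁻ z, ENNReal.ofReal (z ^ 2) ∂ν) < ∞

/-- `N` is a Poisson random measure of intensity `m`. -/
structure IsPoissonRandomMeasure {S : Type*} [MeasurableSpace S] (N : Ω → Measure S)
    (m : Measure S) (P : Measure Ω) : Prop where
  measurable : Measurable N
  law : ∀ B : Set S, MeasurableSet B → m B ≠ ∞ →
    P.map (fun ω => N ω B) = (poissonMeasure (m B).toNNReal).map (fun n : ℕ => (n : ℝ≥0∞))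
  law_top : ∀ B : Set S, MeasurableSet B → m B = ∞ → ∀ᵐ ω ∂P, N ω B = ∞
  indep : ∀ (n : ℕ) (B : Fin n → Set S), (∀ i, MeasurableSet (B i)) →
    Pairwise (Function.onFun Disjoint B) → iIndepFun (fun i ω => N ω (B i)) P

open Classical in
/-- The integral with respect to the compensated measure `N - m`: the (unique) bounded linear
extension to `L²(m)` of `1_B ↦ N(B) - m(B)`. -/
def compensatedIntegral {S : Type*} [MeasurableSpace S] (N : Ω → Measure S)
    (m : Measure S) (P : Measure Ω) : Lp ℝ 2 m →L[ℝ] Lp ℝ 2 P :=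
  if H : ∃ I : Lp ℝ 2 m →L[ℝ] Lp ℝ 2 P,
      ∀ (B : Set S) (hB : MeasurableSet B) (hfin : m B ≠ ∞),
        I (indicatorConstLp 2 hB hfin (1 : ℝ)) =ᵐ[P] fun ω => (N ω B).toReal - (m B).toReal
  then H.choose else 0

open Classical in
/-- The Lévy white noise integral `L(φ) = ∫ φ(x) z N̂(dx, dz)`, for `φ ∈ L²(ℝ^d)`. -/
def levyInt (ν : Measure ℝ) (N : Ω → Measure (Eu d × ℝ)) (P : Measure Ω)
    (φ : Eu d → ℝ) : Lp ℝ 2 P :=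
  if H : MemLp (fun p : Eu d × ℝ => φ p.1 * p.2) 2 ((volume : Measure (Eu d)).prod ν)
  then compensatedIntegral N ((volume : Measure (Eu d)).prod ν) P (H.toLp _) else 0

/-- The Lévy colored noise `X(φ) = L(φ * κ)`. -/
def noise (κ : Eu d → ℝ≥0∞) (ν : Measure ℝ) (N : Ω → Measure (Eu d × ℝ)) (P : Measure Ω)
    (φ : Eu d → ℝ) : Lp ℝ 2 P :=
  levyInt ν N P fun x => ∫ y, φ y * (κ (x - y)).toReal

/-- `Y = X(S) = ∫ S(x) X(dx)` for a distribution `S` whose Fourier transform is a function in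
`L²(μ)`: `Y` is the `L²(Ω)`-limit of `X(φ_n)` for test functions `φ_n` that converge to `S`
in the sense that `∫ |𝓕φ_n - 𝓕S|² dμ → 0`. -/
def IsNoiseIntegral (κ : Eu d → ℝ≥0∞) (h : Eu d → ℂ) (ν : Measure ℝ)
    (N : Ω → Measure (Eu d × ℝ)) (P : Measure Ω) (S : RealDist d) (Y : Lp ℝ 2 P) : Prop :=
  ∃ g : Eu d → ℂ, HasFourier S g ∧ (∫⁻ ξ, ‖g ξ‖ₑ ^ 2 ∂(spectralMeasure h)) < ∞ ∧
    ∃ φ : ℕ → 𝓢(Eu d, ℝ), (∀ n, HasCompactSupport (φ n)) ∧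
      Tendsto (fun n => ∫⁻ ξ, ‖fourierS (SchwartzMap.postcompCLM Complex.ofRealCLM (φ n)) ξ
        - g ξ‖ₑ ^ 2 ∂(spectralMeasure h)) atTop (𝓝 0) ∧
      Tendsto (fun n => noise κ ν N P (φ n)) atTop (𝓝 Y)

/-- The distribution `S * κ`, `(S * κ, φ) = ∫ κ(y) (φ * S̃)(y) dy`, is the function
`g ∈ L²(ℝ^d)`. -/
def IsConvKernel (κ : Eu d → ℝ≥0∞) (S : RealDist d) (g : Eu d → ℝ) : Prop :=
  MemLp g 2 ∧ ∀ φ : 𝓢(Eu d, ℝ), HasCompactSupport φ →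
    ∫ w, g w * φ w = ∫ y, (κ y).toReal * convTilde S φ y

end Noise

section Equation

variable {d : ℕ} {Ω : Type*} [MeasurableSpace Ω]

/-- For every `t > 0`, `G_t` is a distribution with rapid decrease. -/
def HypA (G : ℝ → RealDist d) : Prop := ∀ t : ℝ, 0 < t → IsRapidlyDecreasing (G t)

/-- Continuity of `t ↦ 𝓕G_t(ξ)` and a bound on `𝓕G_t` that is nondecreasing in `t`. -/
structure HypF (G : ℝ → RealDist d) : Prop where
  continuous : ∀ ξ : Eu d, ContinuousOn (fun t => fourierFun (G t) ξ) (Ioi 0)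
  bound : ∃ C : ℝ → ℝ, MonotoneOn C (Ioi 0) ∧
    ∀ t : ℝ, 0 < t → ∀ ξ : Eu d, ‖fourierFun (G t) ξ‖ ≤ C t

/-- `H_t(ξ) = ∫_0^t 𝓕G_{t-s}(ξ) ds`. -/
def Hfun (G : ℝ → RealDist d) (t : ℝ) (ξ : Eu d) : ℂ :=
  ∫ s in (0 : ℝ)..t, fourierFun (G (t - s)) ξ

/-- `sup_{t ∈ [0,T]} ∫ |H_t|² dμ < ∞` for every `T > 0`. -/
def CondBounded (G : ℝ → RealDist d) (h : Eu d → ℂ) : Prop :=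
  ∀ T : ℝ, 0 < T →
    (⨆ t ∈ Icc (0 : ℝ) T, ∫⁻ ξ, ‖Hfun G t ξ‖ₑ ^ 2 ∂(spectralMeasure h)) < ∞

/-- `∫ |H_t - H_s|² dμ → 0` as `t → s` in `[0,∞)`, for every `s ≥ 0`. -/
def CondContinuous (G : ℝ → RealDist d) (h : Eu d → ℂ) : Prop :=
  ∀ s : ℝ, 0 ≤ s →
    Tendsto (fun t => ∫⁻ ξ, ‖Hfun G t ξ - Hfun G s ξ‖ₑ ^ 2 ∂(spectralMeasure h))
      (𝓝[Ici 0] s) (𝓝 0)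

/-- `v^{(t)}(φ) = ∫_0^t Ỹ(s) ds`, where `Ỹ` is a jointly measurable modification of
`Y(s) = X(φ * G̃_{t-s})`, `s < t`. -/
def IsDistributionSolution (κ : Eu d → ℝ≥0∞) (ν : Measure ℝ) (N : Ω → Measure (Eu d × ℝ))
    (P : Measure Ω) (G : ℝ → RealDist d) (v : ℝ≥0 → 𝓢(Eu d, ℝ) → Ω → ℝ) : Prop :=
  ∀ t : ℝ≥0, 0 < t → ∀ φ : 𝓢(Eu d, ℝ), HasCompactSupport φ →
    ∃ Y : ℝ → Ω → ℝ, Measurable (Function.uncurry Y) ∧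
      (∀ s ∈ Ico (0 : ℝ) t, Y s =ᵐ[P] noise κ ν N P (convTilde (G (t - s)) φ)) ∧
      (∀ᵐ ω ∂P, IntegrableOn (fun s => Y s ω) (Icc (0 : ℝ) t)) ∧
      v t φ =ᵐ[P] fun ω => ∫ s in (0 : ℝ)..t, Y s ω

/-- `v(t,x) = ∫_0^t Ỹ(s) ds`, where `Ỹ` is a jointly measurable modification of
`Y(s) = ∫ G_{t-s}(x-y) X(dy)`, `s < t`. -/
def IsRandomFieldSolution (κ : Eu d → ℝ≥0∞) (h : Eu d → ℂ) (ν : Measure ℝ)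
    (N : Ω → Measure (Eu d × ℝ)) (P : Measure Ω) (G : ℝ → RealDist d)
    (v : ℝ≥0 → Eu d → Ω → ℝ) : Prop :=
  ∀ (t : ℝ≥0) (x : Eu d),
    ∃ Y : ℝ → Ω → ℝ, Measurable (Function.uncurry Y) ∧
      (∀ s ∈ Ico (0 : ℝ) t, ∃ Z : Lp ℝ 2 P,
        IsNoiseIntegral κ h ν N P (shifted (G (t - s)) x) Z ∧ Y s =ᵐ[P] Z) ∧
      (∀ᵐ ω ∂P, IntegrableOn (fun s => Y s ω) (Icc (0 : ℝ) t)) ∧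
      v t x =ᵐ[P] fun ω => ∫ s in (0 : ℝ)..t, Y s ω

/-- The representation `v(t,x) = ∫ (∫_0^t (G_{t-s}(x-·) * κ)(y) ds) L(dy)`. Here `g` is a
jointly measurable version of `(s,y) ↦ (G_{t-s}(x-·) * κ)(y)`, and the local integrability of
`g` is what makes the inner integral meaningful for almost every `y`. -/
def HasFubiniRepresentation (κ : Eu d → ℝ≥0∞) (ν : Measure ℝ) (N : Ω → Measure (Eu d × ℝ))
    (P : Measure Ω) (G : ℝ → RealDist d) (v : ℝ≥0 → Eu d → Ω → ℝ) : Prop :=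
  ∀ (t : ℝ≥0) (x : Eu d),
    ∃ g : ℝ → Eu d → ℝ, Measurable (Function.uncurry g) ∧
      (∀ᵐ s ∂(volume.restrict (Ioo (0 : ℝ) t)),
        IsConvKernel κ (shifted (G (t - s)) x) (g s)) ∧
      (∀ K : Set (Eu d), IsCompact K →
        IntegrableOn (Function.uncurry g) (Icc (0 : ℝ) t ×ˢ K)
          ((volume : Measure ℝ).prod (volume : Measure (Eu d)))) ∧
      MemLp (fun y => ∫ s in (0 : ℝ)..t, g s y) 2 ∧
      v t x =ᵐ[P] levyInt ν N P (fun y => ∫ s in (0 : ℝ)..t, g s y)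

/-- `V` is jointly measurable, locally mean-square bounded, continuous in mean square, and
`v^{(t)}(φ) = ∫ V(t,x) φ(x) dx` almost surely for all `t > 0` and all test functions `φ`. -/
structure IsFieldVersion (P : Measure Ω) (v : ℝ≥0 → 𝓢(Eu d, ℝ) → Ω → ℝ)
    (V : ℝ≥0 → Eu d → Ω → ℝ) : Prop where
  measurable : Measurable fun p : ℝ≥0 × Eu d × Ω => V p.1 p.2.1 p.2.2
  locally_bounded : ∀ (T : ℝ≥0) (K : Set (Eu d)), IsCompact K →
    (⨆ t ∈ Iic T, ⨆ x ∈ K, ∫⁻ ω, ‖V t x ω‖ₑ ^ 2 ∂P) < ∞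
  ms_continuous : ∀ (t : ℝ≥0) (x : Eu d),
    Tendsto (fun q : ℝ≥0 × Eu d => ∫⁻ ω, ‖V q.1 q.2 ω - V t x ω‖ₑ ^ 2 ∂P)
      (𝓝 (t, x)) (𝓝 0)
  representation : ∀ t : ℝ≥0, 0 < t → ∀ φ : 𝓢(Eu d, ℝ), HasCompactSupport φ →
    v t φ =ᵐ[P] fun ω => ∫ x, V t x ω * φ x

/-- Dalang's condition `∫ (1 + |ξ|²)⁻¹ μ(dξ) < ∞`. -/
def DalangCondition (h : Eu d → ℂ) : Prop :=
  (∫⁻ ξ, ENNReal.ofReal ((1 + ‖ξ‖ ^ 2)⁻¹) ∂(spectralMeasure h)) < ∞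

/-- The fundamental solution `(2πt)^{-d/2} exp(-|x|²/(2t))` of `∂_t - ½Δ`. -/
def IsHeatKernel (G : ℝ → RealDist d) : Prop :=
  ∀ t : ℝ, 0 < t → ∀ φ : 𝓢(Eu d, ℝ),
    G t φ = ∫ x, (2 * Real.pi * t) ^ (-(d : ℝ) / 2) * Real.exp (-‖x‖ ^ 2 / (2 * t)) * φ x

/-- The fundamental solution of `∂_t² - Δ`: the tempered distribution with Fourier transform
`sin(t|ξ|)/|ξ|`. -/
def IsWaveKernel (G : ℝ → RealDist d) : Prop :=
  ∀ t : ℝ, 0 < t →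
    HasFourier (G t) fun ξ => ((Real.sin (t * ‖ξ‖) / ‖ξ‖ : ℝ) : ℂ)

end Equation

end LevySPDE

end

/-! Everything here is linear in the noise and can be read on the Fourier side. The compensated
Poisson integral is an isometry on L²(dx ν(dz)), so L multiplies squared norms by m₂ = `jumpVar ν`,
and Plancherel gives E|X(φ)|² = m₂ ∫|𝓕φ|² dμ. Hence X extends to a bounded operator Θ on L²(μ)
(`exists_isSpectralIntegral`), which multiplies squared norms by m₂ on Hermitian symbols, w(-ξ) =
conj w(ξ). These are the transforms of real objects, and 0 < m₂ < ∞ lets norms pass both ways.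

Under (A) and (F), φ * G̃_r is a Schwartz function with transform conj(𝓕G_r) 𝓕φ. A bounded operator
commutes with Bochner integrals, and a Bochner integral in L² is given by the pointwise integrals of
a jointly measurable version (`integral_Lp_two_ae_eq`). This stochastic Fubini theorem yields
v^{(t)}(φ) = Θ(conj(H_t) 𝓕φ). Formally φ = δ_x, so the field must be V(t,x) = Θ(e^{-iξ·x} conj H_t).
Its mean squares are m₂ ∫|H_t|² dμ and those of its time increments m₂ ∫|H_t - H_s|² dμ, which
explains (b).

For (b) ⇒ (a), the symbol is a continuous L²(μ)-valued function of (t,x), its image under Θ has a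
jointly measurable modification, and integration against φ returns conj(H_t) 𝓕φ. For (a) ⇒ (b), test
with an approximate identity at x: the tested solutions converge to V(t,x), Fatou gives H_t ∈ L²(μ),
and dominated convergence identifies V(t,x) with Θ of the symbol (`IsFieldVersion.toLp_eq`). At t =
0, where no v^{(t)} is given, a second use of Fatou gives V(0,x) = 0. A Fubini representation is the
Lévy integral of a function with transform h times the same symbol, so it equals V.

For (2), both kernels satisfy |𝓕G_r(ξ)| ≤ (1 + r + r^{-1/2})(1 + |ξ|²)^{-1/2}. The time factor is
integrable at 0, and Dalang's condition puts the other factor in L²(μ). Dominated convergence gives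
(b), and the symbols of G_{t-s}(x - ·) become Bochner integrable in s, which identifies every random
field solution with no Fubini representation assumed. Hypothesis (A) holds because the symbols are
smooth with polynomially bounded derivatives.

Two facts on 𝓞_C' carry the analysis: the Fourier transform is a continuous function
(`IsRapidlyDecreasing.exists_fourier`, by Hahn–Banach on weighted jets), and φ * T̃ is Schwartz
(`IsRapidlyDecreasing.exists_convTilde`). -/

noncomputable section

namespace LevySPDE

/-! ### Poisson moments and the covariance of the compensated measure. -/

section Poisson

theorem HasSum.of_eq {f g : ℕ → ℝ} {a b : ℝ} (h : HasSum f a) (hf : ∀ n, g n = f n) (hab : a = b) :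
    HasSum g b := by
  subst hab; rwa [funext hf]

/-- The term n = 0 vanishes; after an index shift n/n! cancels and r times the total mass is left.
-/
theorem hasSum_poisson_id (r : ℝ≥0) :
    HasSum (fun n : ℕ => Real.exp (-r) * r ^ n / n.factorial * n) (r : ℝ) := by
  rw [← hasSum_nat_add_iff' 1]
  have h := (hasSum_one_poissonMeasure r).mul_left (r : ℝ)
  refine HasSum.of_eq h (fun n => ?_) (by simp)
  · have : ((n : ℝ) + 1) ≠ 0 := by positivity
    have h2 : (n.factorial : ℝ) ≠ 0 := by positivity
    rw [Nat.factorial_succ]; push_cast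
    field_simp
    ring

theorem hasSum_poisson_sq (r : ℝ≥0) :
    HasSum (fun n : ℕ => Real.exp (-r) * r ^ n / n.factorial * (n : ℝ) ^ 2) ((r : ℝ) ^ 2 + r) := by
  rw [← hasSum_nat_add_iff' 1]
  have h := ((hasSum_poisson_id r).add (hasSum_one_poissonMeasure r)).mul_left (r : ℝ)
  refine HasSum.of_eq h (fun n => ?_) (by simp; ring)
  · have : ((n : ℝ) + 1) ≠ 0 := by positivity
    have h2 : (n.factorial : ℝ) ≠ 0 := by positivity
    rw [Nat.factorial_succ]; push_cast
    field_simp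
    ring

theorem hasSum_poisson_centered (r : ℝ≥0) :
    HasSum (fun n : ℕ => Real.exp (-r) * r ^ n / n.factorial * ((n : ℝ) - r)) 0 := by
  have h := (hasSum_poisson_id r).sub ((hasSum_one_poissonMeasure r).mul_left (r : ℝ))
  exact HasSum.of_eq h (fun n => by ring) (by ring)

theorem hasSum_poisson_variance (r : ℝ≥0) :
    HasSum (fun n : ℕ => Real.exp (-r) * r ^ n / n.factorial * ((n : ℝ) - r) ^ 2) (r : ℝ) := by
  have h := ((hasSum_poisson_sq r).sub ((hasSum_poisson_id r).mul_left (2 * r : ℝ))).add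
    ((hasSum_one_poissonMeasure r).mul_left ((r : ℝ) ^ 2))
  exact HasSum.of_eq h (fun n => by ring) (by ring)

variable {Ω S : Type*} [MeasurableSpace Ω] [MeasurableSpace S] {P : Measure Ω}
  {N : Ω → Measure S} {m : Measure S}

/-- The compensated value `N(B) - m(B)`. -/
def compensated (N : Ω → Measure S) (m : Measure S) (B : Set S) (ω : Ω) : ℝ :=
  (N ω B).toReal - (m B).toReal

theorem IsPoissonRandomMeasure.measurable_apply (hN : IsPoissonRandomMeasure N m P) {B : Set S}
    (hB : MeasurableSet B) : Measurable fun ω => N ω B :=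
  (Measure.measurable_coe hB).comp hN.measurable

theorem IsPoissonRandomMeasure.measurable_compensated (hN : IsPoissonRandomMeasure N m P)
    {B : Set S} (hB : MeasurableSet B) : Measurable (compensated N m B) :=
  ((hN.measurable_apply hB).ennreal_toReal).sub_const _

theorem IsPoissonRandomMeasure.ae_ne_top (hN : IsPoissonRandomMeasure N m P) {B : Set S}
    (hB : MeasurableSet B) (hfin : m B ≠ ∞) : ∀ᵐ ω ∂P, N ω B ≠ ∞ := by
  have hm := hN.measurable_apply hB
  have h := hN.law B hB hfin
  rw [ae_iff]
  have h2 : {ω | ¬ N ω B ≠ ∞} = (fun ω => N ω B) ⁻¹' {∞} := by ext; simp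
  rw [h2, ← Measure.map_apply hm (measurableSet_singleton _), h,
    Measure.map_apply .of_discrete (measurableSet_singleton _)]
  have : (fun n : ℕ => (n : ℝ≥0∞)) ⁻¹' {∞} = ∅ := by ext; simp
  rw [this]; simp

/-- Both sides are read off the same law on `ℝ≥0∞`: that of N(B), which is the image of the Poisson
law under the cast from `ℕ`. -/
theorem IsPoissonRandomMeasure.integrable_comp_iff (hN : IsPoissonRandomMeasure N m P) {B : Set S}
    (hB : MeasurableSet B) (hfin : m B ≠ ∞) {f : ℝ → ℝ} (hf : Measurable f) :
    (Integrable (fun ω => f (compensated N m B ω)) P ↔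
      Integrable (fun n : ℕ => f (n - (m B).toNNReal)) (poissonMeasure (m B).toNNReal)) ∧
    ∫ ω, f (compensated N m B ω) ∂P
      = ∫ n : ℕ, f (n - (m B).toNNReal) ∂(poissonMeasure (m B).toNNReal) := by
  have hm := hN.measurable_apply hB
  have hg : Measurable fun x : ℝ≥0∞ => f (x.toReal - (m B).toReal) :=
    hf.comp (measurable_id.ennreal_toReal.sub_const _)
  constructor
  · have h1 := integrable_map_measure (μ := P) (f := fun ω => N ω B) hg.aestronglyMeasurable
      hm.aemeasurable
    have h2 := integrable_map_measure (μ := poissonMeasure (m B).toNNReal)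
      (f := fun n : ℕ => (n : ℝ≥0∞)) hg.aestronglyMeasurable (Measurable.of_discrete).aemeasurable
    rw [hN.law B hB hfin, h2] at h1
    exact h1.symm
  · have h1 := integral_map (μ := P) hm.aemeasurable hg.aestronglyMeasurable
    rw [hN.law B hB hfin, integral_map (Measurable.of_discrete).aemeasurable
      hg.aestronglyMeasurable] at h1
    exact h1.symm

theorem IsPoissonRandomMeasure.memLp_compensated (hN : IsPoissonRandomMeasure N m P) {B : Set S}
    (hB : MeasurableSet B) (hfin : m B ≠ ∞) : MemLp (compensated N m B) 2 P := by
  rw [memLp_two_iff_integrable_sq (hN.measurable_compensated hB).aestronglyMeasurable]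
  rw [(hN.integrable_comp_iff hB hfin (f := fun x => x ^ 2) (by fun_prop)).1,
    integrable_poissonMeasure_iff]
  refine (hasSum_poisson_variance (m B).toNNReal).summable.congr fun n => ?_
  simp

theorem IsPoissonRandomMeasure.integral_sq_compensated (hN : IsPoissonRandomMeasure N m P)
    {B : Set S} (hB : MeasurableSet B) (hfin : m B ≠ ∞) :
    ∫ ω, compensated N m B ω * compensated N m B ω ∂P = (m B).toReal := by
  have := (hN.integrable_comp_iff hB hfin (f := fun x => x ^ 2) (by fun_prop)).2
  simp only [← sq]
  rw [this, integral_poissonMeasure]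
  exact (hasSum_poisson_variance _).tsum_eq

theorem IsPoissonRandomMeasure.integral_compensated (hN : IsPoissonRandomMeasure N m P)
    {B : Set S} (hB : MeasurableSet B) (hfin : m B ≠ ∞) :
    ∫ ω, compensated N m B ω ∂P = 0 := by
  have := (hN.integrable_comp_iff hB hfin (f := fun x => x) (by fun_prop)).2
  rw [this, integral_poissonMeasure]
  exact (hasSum_poisson_centered _).tsum_eq

theorem IsPoissonRandomMeasure.integral_mul_of_disjoint (hN : IsPoissonRandomMeasure N m P)
    {A B : Set S} (hA : MeasurableSet A) (hB : MeasurableSet B) (hfin : m A ≠ ∞) (hd : Disjoint A B) :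
    ∫ ω, compensated N m A ω * compensated N m B ω ∂P = 0 := by
  have hi := hN.indep 2 ![A, B] (by intro i; fin_cases i <;> simpa) (by
    intro i j hij
    fin_cases i <;> fin_cases j <;> simp_all [Function.onFun, hd.symm])
  have h01 : IndepFun (fun ω => N ω A) (fun ω => N ω B) P := by
    simpa using hi.indepFun (i := 0) (j := 1) (by simp)
  have := h01.integral_fun_comp_mul_comp (f := fun x => x.toReal - (m A).toReal)
    (g := fun x => x.toReal - (m B).toReal)
    (hN.measurable_apply hA).aemeasurable (hN.measurable_apply hB).aemeasurable
    (measurable_id.ennreal_toReal.sub_const _).aestronglyMeasurable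
    (measurable_id.ennreal_toReal.sub_const _).aestronglyMeasurable
  have h0 := hN.integral_compensated hA hfin
  unfold compensated at h0 ⊢
  rw [this, h0, zero_mul]

/-- Only almost sure, since `toReal` is additive only where both counts are finite. -/
theorem IsPoissonRandomMeasure.compensated_union (hN : IsPoissonRandomMeasure N m P)
    {A B : Set S} (hA : MeasurableSet A) (hB : MeasurableSet B) (hfin : m A ≠ ∞) (hfinB : m B ≠ ∞)
    (hd : Disjoint A B) :
    compensated N m (A ∪ B) =ᵐ[P] compensated N m A + compensated N m B := by
  filter_upwards [hN.ae_ne_top hA hfin, hN.ae_ne_top hB hfinB] with ω h1 h2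
  simp only [compensated, Pi.add_apply]
  rw [measure_union hd hB, measure_union hd hB, ENNReal.toReal_add h1 h2,
    ENNReal.toReal_add hfin hfinB]
  ring

/-- Both sets are split along A ∩ B. The three disjoint pieces have independent centered values, so
only the variance over A ∩ B survives. -/
theorem IsPoissonRandomMeasure.integral_mul (hN : IsPoissonRandomMeasure N m P)
    {A B : Set S} (hA : MeasurableSet A) (hB : MeasurableSet B) (hfin : m A ≠ ∞)
    (hfinB : m B ≠ ∞) :
    ∫ ω, compensated N m A ω * compensated N m B ω ∂P = (m (A ∩ B)).toReal := by
  have hC := hA.inter hB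
  have hA' := hA.diff hB
  have hB' := hB.diff hA
  have fC : m (A ∩ B) ≠ ∞ := measure_ne_top_of_subset inter_subset_left hfin
  have fA' : m (A \ B) ≠ ∞ := measure_ne_top_of_subset sdiff_subset hfin
  have fB' : m (B \ A) ≠ ∞ := measure_ne_top_of_subset sdiff_subset hfinB
  have d1 : Disjoint (A ∩ B) (A \ B) :=
    (disjoint_sdiff_right : Disjoint B (A \ B)).mono_left inter_subset_right
  have d2 : Disjoint (A ∩ B) (B \ A) :=
    (disjoint_sdiff_right : Disjoint A (B \ A)).mono_left inter_subset_left
  have d3 : Disjoint (A \ B) (B \ A) :=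
    (disjoint_sdiff_right : Disjoint A (B \ A)).mono_left sdiff_subset
  have eA := hN.compensated_union hC hA' fC fA' d1
  have eB := hN.compensated_union hC hB' fC fB' d2
  rw [inter_union_sdiff] at eA
  rw [inter_comm A B, inter_union_sdiff, inter_comm B A] at eB
  have e : (fun ω => compensated N m A ω * compensated N m B ω) =ᵐ[P] fun ω =>
      (compensated N m (A ∩ B) ω * compensated N m (A ∩ B) ω
        + compensated N m (A ∩ B) ω * compensated N m (B \ A) ω)
      + (compensated N m (A ∩ B) ω * compensated N m (A \ B) ω
        + compensated N m (A \ B) ω * compensated N m (B \ A) ω) := by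
    filter_upwards [eA, eB] with ω h1 h2
    rw [h1, h2]; simp only [Pi.add_apply]; ring
  have lC := hN.memLp_compensated hC fC
  have lA := hN.memLp_compensated hA' fA'
  have lB := hN.memLp_compensated hB' fB'
  rw [integral_congr_ae e, integral_add, integral_add, integral_add,
    hN.integral_sq_compensated hC fC, hN.integral_mul_of_disjoint hC hA' fC d1,
    hN.integral_mul_of_disjoint hC hB' fC d2, hN.integral_mul_of_disjoint hA' hB' fA' d3]
  · ring
  · exact lC.integrable_mul lA
  · exact lA.integrable_mul lB
  · exact lC.integrable_mul lC
  · exact lC.integrable_mul lB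
  · exact (lC.integrable_mul lC).add (lC.integrable_mul lB)
  · exact (lC.integrable_mul lA).add (lA.integrable_mul lB)

end Poisson

/-- A map of vectors with dense span that preserves inner products extends to an isometry. -/
theorem exists_isometry_of_inner_eq {ι H K : Type*} [NormedAddCommGroup H] [InnerProductSpace ℝ H]
    [NormedAddCommGroup K] [InnerProductSpace ℝ K] [CompleteSpace K] (e : ι → H) (f : ι → K)
    (hef : ∀ i j, inner ℝ (f i) (f j) = inner ℝ (e i) (e j))
    (hd : DenseRange (Finsupp.linearCombination ℝ e)) :
    ∃ I : H →L[ℝ] K, (∀ i, I (e i) = f i) ∧ ∀ x, ‖I x‖ = ‖x‖ := by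
  -- Squared norms of finite combinations expand into the same Gram sums, so the map is isometric on
  -- the span.
  have hnorm : ∀ c, ‖Finsupp.linearCombination ℝ f c‖ = ‖Finsupp.linearCombination ℝ e c‖ := by
    intro c
    rw [← sq_eq_sq₀ (norm_nonneg _) (norm_nonneg _), ← real_inner_self_eq_norm_sq,
      ← real_inner_self_eq_norm_sq]
    simp only [Finsupp.linearCombination_apply, Finsupp.sum, sum_inner, inner_sum,
      real_inner_smul_left, real_inner_smul_right, hef]
  have hb : ∃ C, ∀ x, ‖Finsupp.linearCombination ℝ f x‖
      ≤ C * ‖Finsupp.linearCombination ℝ e x‖ := ⟨1, fun x => by rw [one_mul, hnorm]⟩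
  refine ⟨(Finsupp.linearCombination ℝ f).extendOfNorm (Finsupp.linearCombination ℝ e), ?_, ?_⟩
  · intro i
    have := LinearMap.extendOfNorm_eq hd hb (Finsupp.single i 1)
    simpa using this
  · intro x
    refine hd.induction_on x (isClosed_eq (by fun_prop) (by fun_prop)) fun c => ?_
    rw [LinearMap.extendOfNorm_eq hd hb, hnorm]

/-! ### The compensated integral as an isometry. -/

section CompensatedIntegral

variable {Ω S : Type*} [MeasurableSpace Ω] [MeasurableSpace S] {P : Measure Ω}
  {N : Ω → Measure S} {m : Measure S}

/-- Serves twice: for the density of the span of indicators, through orthogonality, and for the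
independence of `compensatedIntegral` from the choice in its definition. -/
theorem ext_of_indicatorConstLp {F : Type*} [NormedAddCommGroup F] [NormedSpace ℝ F]
    {I J : Lp ℝ 2 m →L[ℝ] F}
    (h : ∀ (B : Set S) (hB : MeasurableSet B) (hfin : m B ≠ ∞),
      I (indicatorConstLp 2 hB hfin (1 : ℝ)) = J (indicatorConstLp 2 hB hfin (1 : ℝ))) :
    I = J := by
  ext1 x
  refine Lp.induction (p := 2) (by simp) (motive := fun x => I x = J x) ?_ ?_ ?_ x
  · intro c s hs hfin
    have : (↑(Lp.simpleFunc.indicatorConst 2 hs hfin.ne c) : Lp ℝ 2 m)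
        = c • indicatorConstLp 2 hs hfin.ne (1 : ℝ) := by
      rw [Lp.simpleFunc.coe_indicatorConst]
      ext1
      refine (indicatorConstLp_coeFn).trans ?_
      refine EventuallyEq.trans ?_ (Lp.coeFn_smul _ _).symm
      filter_upwards [indicatorConstLp_coeFn (p := 2) (hs := hs) (hμs := hfin.ne) (c := (1 : ℝ))]
        with y hy
      rw [Pi.smul_apply, hy]
      by_cases hys : y ∈ s <;> simp [hys]
    rw [this, map_smul, map_smul, h]
  · intro f g hf hg _ h1 h2
    rw [map_add, map_add, h1, h2]
  · exact isClosed_eq I.continuous J.continuous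

theorem denseRange_indicatorConstLp :
    DenseRange (Finsupp.linearCombination ℝ
      fun B : {B : Set S // MeasurableSet B ∧ m B ≠ ∞} =>
        indicatorConstLp 2 B.2.1 B.2.2 (1 : ℝ)) := by
  let e := fun B : {B : Set S // MeasurableSet B ∧ m B ≠ ∞} =>
        indicatorConstLp 2 B.2.1 B.2.2 (1 : ℝ)
  have : (LinearMap.range (Finsupp.linearCombination ℝ e)).topologicalClosure = ⊤ := by
    rw [Submodule.topologicalClosure_eq_top_iff, Submodule.eq_bot_iff]
    intro x hx
    have h0 : innerSL ℝ x = 0 := by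
      refine ext_of_indicatorConstLp fun B hB hfin => ?_
      have := hx (e ⟨B, hB, hfin⟩) ⟨Finsupp.single ⟨B, hB, hfin⟩ 1, by simp⟩
      rw [real_inner_comm] at this
      simpa using this
    have : innerSL ℝ x x = 0 := by rw [h0]; rfl
    simpa using this
  rw [DenseRange, ← LinearMap.coe_range]
  exact Submodule.dense_iff_topologicalClosure_eq_top.2 this

/-- The inner product of two indicators is m(A ∩ B), which is also the covariance of the compensated
values. -/
theorem IsPoissonRandomMeasure.exists_integral (hN : IsPoissonRandomMeasure N m P) :
    ∃ I : Lp ℝ 2 m →L[ℝ] Lp ℝ 2 P,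
      (∀ (B : Set S) (hB : MeasurableSet B) (hfin : m B ≠ ∞),
        I (indicatorConstLp 2 hB hfin (1 : ℝ)) =ᵐ[P] fun ω => (N ω B).toReal - (m B).toReal) ∧
      ∀ x, ‖I x‖ = ‖x‖ := by
  obtain ⟨I, h1, h2⟩ := exists_isometry_of_inner_eq
    (fun B : {B : Set S // MeasurableSet B ∧ m B ≠ ∞} =>
        (indicatorConstLp 2 B.2.1 B.2.2 (1 : ℝ) : Lp ℝ 2 m))
    (fun B => (hN.memLp_compensated B.2.1 B.2.2).toLp _) (by
      rintro ⟨A, hA, fA⟩ ⟨B, hB, fB⟩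
      simp only
      rw [L2.inner_indicatorConstLp_indicatorConstLp, L2.inner_def]
      rw [← integral_congr_ae (f := fun ω => compensated N m B ω * compensated N m A ω),
        hN.integral_mul hB hA fB fA]
      · simp [Measure.real, inter_comm]
      · filter_upwards [MemLp.coeFn_toLp (hN.memLp_compensated hA fA),
          MemLp.coeFn_toLp (hN.memLp_compensated hB fB)] with ω e1 e2
        rw [e1, e2]; rfl) denseRange_indicatorConstLp
  refine ⟨I, fun B hB hfin => ?_, h2⟩
  rw [h1 ⟨B, hB, hfin⟩]
  exact MemLp.coeFn_toLp _

theorem IsPoissonRandomMeasure.norm_compensatedIntegral (hN : IsPoissonRandomMeasure N m P)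
    (x : Lp ℝ 2 m) : ‖compensatedIntegral N m P x‖ = ‖x‖ := by
  obtain ⟨J, hJ, hn⟩ := hN.exists_integral
  have H : ∃ I : Lp ℝ 2 m →L[ℝ] Lp ℝ 2 P,
      ∀ (B : Set S) (hB : MeasurableSet B) (hfin : m B ≠ ∞),
        I (indicatorConstLp 2 hB hfin (1 : ℝ)) =ᵐ[P] fun ω => (N ω B).toReal - (m B).toReal :=
    ⟨J, hJ⟩
  have : compensatedIntegral N m P = J := by
    rw [compensatedIntegral, dif_pos H]
    exact ext_of_indicatorConstLp fun B hB hfin =>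
      Lp.ext ((H.choose_spec B hB hfin).trans (hJ B hB hfin).symm)
  rw [this, hn]

end CompensatedIntegral

/-! ### Squared L² norms as lower integrals. -/

section LpTwo

variable {α F : Type*} [MeasurableSpace α] [NormedAddCommGroup F] {μ : Measure α}

theorem eLpNorm_two_sq (f : α → F) : eLpNorm f 2 μ ^ 2 = ∫⁻ x, ‖f x‖ₑ ^ 2 ∂μ := by
  have := eLpNorm_nnreal_pow_eq_lintegral (f := f) (μ := μ) (p := 2) (by norm_num)
  rw [show ((2 : ℝ≥0) : ℝ) = ((2 : ℕ) : ℝ) by norm_num] at this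
  simp only [ENNReal.rpow_natCast] at this
  exact_mod_cast this

theorem memLp_two_iff_lintegral {f : α → F} (hf : AEStronglyMeasurable f μ) :
    MemLp f 2 μ ↔ ∫⁻ x, ‖f x‖ₑ ^ 2 ∂μ < ∞ := by
  rw [← eLpNorm_two_sq]
  constructor
  · intro h; exact ENNReal.pow_lt_top h.2
  · intro h; exact ⟨hf, by simpa using h⟩

theorem enorm_toLp_sq {f : α → F} (hf : MemLp f 2 μ) :
    ‖hf.toLp f‖ₑ ^ 2 = ∫⁻ x, ‖f x‖ₑ ^ 2 ∂μ := by
  rw [Lp.enorm_toLp, eLpNorm_two_sq]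

theorem enorm_Lp_sq (f : Lp F 2 μ) : ‖f‖ₑ ^ 2 = ∫⁻ x, ‖f x‖ₑ ^ 2 ∂μ := by
  rw [Lp.enorm_def, eLpNorm_two_sq]

theorem norm_sq_of_enorm_sq {G : Type*} [NormedAddCommGroup G] {x : F} {y : G} {c : ℝ≥0∞}
    (h : ‖x‖ₑ ^ 2 = c * ‖y‖ₑ ^ 2) : ‖x‖ ^ 2 = c.toReal * ‖y‖ ^ 2 := by
  have := congrArg ENNReal.toReal h
  simpa using this

end LpTwo

/-! ### The Lévy integral as a multiple of an isometry. -/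

section Levy

variable {d : ℕ} {Ω : Type*} [MeasurableSpace Ω] {P : Measure Ω} {ν : Measure ℝ}
  {N : Ω → Measure (Eu d × ℝ)}

/-- The second moment of the jump measure. -/
def jumpVar (ν : Measure ℝ) : ℝ≥0∞ := ∫⁻ z, ENNReal.ofReal (z ^ 2) ∂ν

theorem IsJumpMeasure.ae_ne_zero (hν : IsJumpMeasure ν) : ∀ᵐ z ∂ν, z ≠ 0 := by
  rw [ae_iff]; simpa using hν.zero

theorem IsJumpMeasure.jumpVar_ne_zero (hν : IsJumpMeasure ν) : jumpVar ν ≠ 0 := by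
  intro h
  rw [jumpVar, lintegral_eq_zero_iff (by fun_prop)] at h
  have : ∀ᵐ z ∂ν, False := by
    filter_upwards [h, hν.ae_ne_zero] with z h1 h2
    have : z ^ 2 ≤ 0 := by simpa using h1
    exact h2 (by nlinarith [sq_nonneg z, pow_eq_zero_iff (two_ne_zero) |>.1 (le_antisymm this (sq_nonneg z))])
  have h0 : ν = 0 := by
    rw [← Measure.measure_univ_eq_zero]; simpa [ae_iff] using this
  exact hν.ne_zero h0

/-- The measure z² ν(dz) is finite and z² ≠ 0 almost everywhere, so dividing by this density
exhibits ν as s-finite, as the product measure requires. The measure ν itself may be infinite near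
0. -/
theorem IsJumpMeasure.sFinite (hν : IsJumpMeasure ν) : SFinite ν := by
  have hm : Measurable fun z : ℝ => ENNReal.ofReal (z ^ 2) := by fun_prop
  have : IsFiniteMeasure (ν.withDensity fun z => ENNReal.ofReal (z ^ 2)) :=
    isFiniteMeasure_withDensity hν.second_moment.ne
  have h := withDensity_inv_same (μ := ν) hm (by
    filter_upwards [hν.ae_ne_zero] with z hz
    simp; positivity) (by simp)
  rw [← h]
  infer_instance

theorem lintegral_tensor_sq [SFinite ν] {g : Eu d → ℝ} (hg : AEStronglyMeasurable g volume) :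
    ∫⁻ p : Eu d × ℝ, ‖g p.1 * p.2‖ₑ ^ 2 ∂((volume : Measure (Eu d)).prod ν)
      = jumpVar ν * ∫⁻ x, ‖g x‖ₑ ^ 2 := by
  have : ∀ p : Eu d × ℝ, ‖g p.1 * p.2‖ₑ ^ 2 = ‖g p.1‖ₑ ^ 2 * ENNReal.ofReal (p.2 ^ 2) := by
    intro p
    rw [enorm_mul, mul_pow, Real.enorm_eq_ofReal_abs p.2, ← ENNReal.ofReal_pow (abs_nonneg _),
      sq_abs]
  simp_rw [this]
  rw [lintegral_prod_mul (f := fun x => ‖g x‖ₑ ^ 2) (g := fun z => ENNReal.ofReal (z ^ 2))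
    (hg.enorm.pow_const 2) (by fun_prop), mul_comm]
  rfl

theorem memLp_tensor [SFinite ν] (hν : IsJumpMeasure ν) {g : Eu d → ℝ} (hg : MemLp g 2) :
    MemLp (fun p : Eu d × ℝ => g p.1 * p.2) 2 ((volume : Measure (Eu d)).prod ν) := by
  rw [memLp_two_iff_lintegral, lintegral_tensor_sq hg.1]
  · exact ENNReal.mul_lt_top hν.second_moment ((memLp_two_iff_lintegral hg.1).1 hg)
  · exact (hg.1.comp_quasiMeasurePreserving Measure.quasiMeasurePreserving_fst).mul
      measurable_snd.aestronglyMeasurable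

/-- The Lévy integral as a bounded operator. -/
theorem exists_levyCLM (hν : IsJumpMeasure ν)
    (hN : IsPoissonRandomMeasure N ((volume : Measure (Eu d)).prod ν) P) :
    ∃ L : Lp ℝ 2 (volume : Measure (Eu d)) →L[ℝ] Lp ℝ 2 P,
      (∀ (g : Eu d → ℝ) (hg : MemLp g 2), levyInt ν N P g = L (hg.toLp g)) ∧
      ∀ x, ‖L x‖ₑ ^ 2 = jumpVar ν * ‖x‖ₑ ^ 2 := by
  have := hν.sFinite
  have hfst : ∀ {p : Eu d → Prop}, (∀ᵐ x, p x) →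
      ∀ᵐ q ∂((volume : Measure (Eu d)).prod ν), p q.1 := fun h =>
    Measure.quasiMeasurePreserving_fst.ae h
  let T : Lp ℝ 2 (volume : Measure (Eu d)) →ₗ[ℝ] Lp ℝ 2 ((volume : Measure (Eu d)).prod ν) :=
    { toFun := fun x => (memLp_tensor hν (Lp.memLp x)).toLp _
      map_add' := fun x y => by
        rw [← MemLp.toLp_add]
        refine MemLp.toLp_congr _ _ ?_
        filter_upwards [hfst (Lp.coeFn_add x y)] with q hq
        simp only [hq, Pi.add_apply]; ring
      map_smul' := fun c x => by
        rw [RingHom.id_apply, ← MemLp.toLp_const_smul]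
        refine MemLp.toLp_congr _ _ ?_
        filter_upwards [hfst (Lp.coeFn_smul c x)] with q hq
        simp only [hq, Pi.smul_apply, smul_eq_mul]; ring }
  have hT : ∀ x, ‖T x‖ₑ ^ 2 = jumpVar ν * ‖x‖ₑ ^ 2 := fun x => by
    rw [enorm_Lp_sq x, ← lintegral_tensor_sq (Lp.aestronglyMeasurable x)]
    exact enorm_toLp_sq (memLp_tensor hν (Lp.memLp x))
  have hTn : ∀ x, ‖T x‖ ≤ √(jumpVar ν).toReal * ‖x‖ := fun x => by
    refine le_of_sq_le_sq ?_ (by positivity)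
    rw [mul_pow, Real.sq_sqrt ENNReal.toReal_nonneg]
    exact (norm_sq_of_enorm_sq (hT x)).le
  refine ⟨compensatedIntegral N _ P ∘L T.mkContinuous _ hTn, fun g hg => ?_, fun x => ?_⟩
  · rw [levyInt, dif_pos (memLp_tensor hν hg)]
    refine congrArg (compensatedIntegral N _ P)
      (MemLp.toLp_congr _ (memLp_tensor hν (Lp.memLp (hg.toLp g))) ?_)
    filter_upwards [hfst hg.coeFn_toLp] with q hq
    rw [hq]
  · rw [← hT x, ← ofReal_norm, ← ofReal_norm]
    congr 2
    exact hN.norm_compensatedIntegral _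

end Levy

/-! ### Measurable modifications of mean-square continuous processes. -/

section Modification

variable {Ω T : Type*} [MeasurableSpace Ω] {P : Measure Ω} [PseudoMetricSpace T]
  [SecondCountableTopology T] [MeasurableSpace T] [BorelSpace T]

/-- The approximation takes countably many values: t is sent to the first point of a dense sequence
whose value is within ε. This first index is measurable because the conditions on t are open. -/
theorem exists_measurable_approx (y : T → Lp ℝ 2 P) (hy : Continuous y) {ε : ℝ} (hε : 0 < ε) :
    ∃ Y : T → Ω → ℝ, Measurable (Function.uncurry Y) ∧
      ∀ t, ∃ z : Lp ℝ 2 P, Y t = z ∧ ‖z - y t‖ ≤ ε := by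
  obtain hT | hT := isEmpty_or_nonempty T
  · exact ⟨fun t => isEmptyElim t, measurable_of_empty _, fun t => isEmptyElim t⟩
  let q := TopologicalSpace.denseSeq T
  have hex : ∀ t, ∃ n, ‖y (q n) - y t‖ < ε := fun t => by
    have ho : IsOpen {s | ‖y s - y t‖ < ε} := isOpen_lt (by fun_prop) continuous_const
    obtain ⟨s, hs, n, rfl⟩ := (TopologicalSpace.denseRange_denseSeq T).inter_open_nonempty _ ho
      ⟨t, by simpa using hε⟩
    exact ⟨n, hs⟩
  classical
  let k : T → ℕ := fun t => Nat.find (hex t)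
  have hk : Measurable k := by
    refine measurable_find hex fun n => ?_
    exact (isOpen_lt (by fun_prop) continuous_const).measurableSet
  refine ⟨fun t => y (q (k t)), ?_, fun t => ⟨_, rfl, (Nat.find_spec (hex t)).le⟩⟩
  have h1 : Measurable fun p : ℕ × Ω => (y (q p.1) : Ω → ℝ) p.2 :=
    measurable_from_prod_countable_right fun n => (Lp.stronglyMeasurable (y (q n))).measurable
  exact h1.comp ((hk.comp measurable_fst).prodMk measurable_snd)

/-- A process that is continuous in mean square has a jointly measurable modification. -/
theorem exists_measurable_modification [IsProbabilityMeasure P] (y : T → Lp ℝ 2 P)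
    (hy : Continuous y) :
    ∃ Y : T → Ω → ℝ, Measurable (Function.uncurry Y) ∧ ∀ t, Y t =ᵐ[P] y t := by
  -- Errors of size 2⁻ⁿ have summable squares, so for each fixed t the approximations converge
  -- almost surely.
  choose Y hYm hY using fun n : ℕ => exists_measurable_approx y hy
    (ε := (1 / 2) ^ n) (by positivity)
  refine ⟨fun t ω => limUnder atTop fun n => Y n t ω, ?_, fun t => ?_⟩
  · exact (StronglyMeasurable.limUnder (f := fun n p => Function.uncurry (Y n) p)
      fun n => (hYm n).stronglyMeasurable).measurable
  · choose z hz1 hz2 using fun n => hY n t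
    have hm : ∀ n, AEMeasurable (fun ω => ‖Y n t ω - y t ω‖ₑ ^ 2) P := fun n => by
      rw [hz1 n]
      exact ((Lp.aestronglyMeasurable (z n)).sub (Lp.aestronglyMeasurable (y t))).enorm.pow_const 2
    have h1 : ∀ n, ∫⁻ ω, ‖Y n t ω - y t ω‖ₑ ^ 2 ∂P ≤ ENNReal.ofReal ((1 / 4) ^ n) := fun n => by
      have e : ∫⁻ ω, ‖Y n t ω - y t ω‖ₑ ^ 2 ∂P = ‖z n - y t‖ₑ ^ 2 := by
        rw [enorm_Lp_sq]
        refine lintegral_congr_ae ?_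
        filter_upwards [Lp.coeFn_sub (z n) (y t)] with ω h
        rw [h, hz1 n]; rfl
      rw [e, ← ofReal_norm, ← ENNReal.ofReal_pow (norm_nonneg _)]
      refine ENNReal.ofReal_le_ofReal ((pow_le_pow_left₀ (norm_nonneg _) (hz2 n) 2).trans ?_)
      rw [← pow_mul, mul_comm, pow_mul]; norm_num
    have h2 : ∫⁻ ω, ∑' n, ‖Y n t ω - y t ω‖ₑ ^ 2 ∂P ≠ ∞ := by
      rw [lintegral_tsum hm]
      refine ((ENNReal.tsum_le_tsum h1).trans_lt ?_).ne
      rw [← ENNReal.ofReal_tsum_of_nonneg (fun n => by positivity)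
        (summable_geometric_of_lt_one (by norm_num) (by norm_num))]
      exact ENNReal.ofReal_lt_top
    filter_upwards [ae_lt_top' (AEMeasurable.tsum hm) h2] with ω hω
    refine Tendsto.limUnder_eq ?_
    have h3 := ENNReal.tendsto_atTop_zero_of_tsum_ne_top hω.ne
    rw [tendsto_iff_edist_tendsto_0]
    simp only [edist_eq_enorm_sub]
    have h4 := h3.ennrpow_const (1 / 2 : ℝ)
    refine (h4.congr fun n => ?_).trans (by simp)
    rw [← ENNReal.rpow_natCast, ← ENNReal.rpow_mul]; norm_num

end Modification

/-! ### Density of test functions in Schwartz space. -/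

section Cutoff

variable {d : ℕ} {F : Type*} [NormedAddCommGroup F] [NormedSpace ℝ F]

/-- The factor c‖x‖ costs nothing: the function vanishes near x if c‖x‖ < 1, and otherwise c‖x‖ ≥ 1
while the derivatives are bounded, as c ≤ 1. In the density theorem the surplus ‖x‖ is absorbed by a
seminorm with one more power of x, and c → 0 remains. -/
theorem exists_cutoff_bound (d : ℕ) :
    ∃ χ : Eu d → ℝ, HasCompactSupport χ ∧ ContDiff ℝ (⊤ : ℕ∞) χ ∧ ∀ i : ℕ, ∃ M : ℝ, 0 ≤ M ∧
      ∀ c : ℝ, 0 < c → c ≤ 1 → ∀ x : Eu d,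
        ‖iteratedFDeriv ℝ i (fun y => 1 - χ (c • y)) x‖ ≤ M * (c * ‖x‖) := by
  let χ : ContDiffBump (0 : Eu d) := ⟨1, 2, by norm_num, by norm_num⟩
  have hχ : ContDiff ℝ (⊤ : ℕ∞) (χ : Eu d → ℝ) := χ.contDiff
  refine ⟨χ, χ.hasCompactSupport, hχ, fun i => ?_⟩
  have ha : ContDiff ℝ (⊤ : ℕ∞) (fun y => 1 - χ y) := contDiff_const.sub hχ
  obtain ⟨M, hM⟩ : ∃ M : ℝ, ∀ x, ‖iteratedFDeriv ℝ i (fun y => 1 - χ y) x‖ ≤ M := by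
    obtain ⟨C, hC⟩ := (χ.hasCompactSupport.iteratedFDeriv (𝕜 := ℝ) i).exists_bound_of_continuous
      (hχ.continuous_iteratedFDeriv (mod_cast le_top))
    refine ⟨1 + C, fun x => ?_⟩
    have : iteratedFDeriv ℝ i (fun y => 1 - χ y) x
        = iteratedFDeriv ℝ i (fun _ : Eu d => (1 : ℝ)) x - iteratedFDeriv ℝ i χ x :=
      iteratedFDeriv_sub_apply contDiff_const.contDiffAt (hχ.of_le (mod_cast le_top)).contDiffAt
    rw [this]
    refine (norm_sub_le _ _).trans (add_le_add ?_ (hC x))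
    rcases i with _ | i
    · simp
    · rw [iteratedFDeriv_const_of_ne (by simp)]; simp
  have hM0 : 0 ≤ M := (norm_nonneg _).trans (hM 0)
  refine ⟨M, hM0, fun c hc hc1 x => ?_⟩
  by_cases hx : c * ‖x‖ < 1
  · have : (fun y => 1 - χ (c • y)) =ᶠ[𝓝 x] fun _ => 0 := by
      have ho : IsOpen {y : Eu d | c * ‖y‖ < 1} := isOpen_lt (by fun_prop) continuous_const
      filter_upwards [ho.mem_nhds hx] with y hy
      rw [χ.one_of_mem_closedBall, sub_self]
      rw [mem_closedBall_zero_iff, norm_smul, Real.norm_of_nonneg hc.le]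
      exact (le_of_lt hy)
    rw [(this.iteratedFDeriv ℝ i).eq_of_nhds]
    simp only [iteratedFDeriv_fun_zero, Pi.zero_apply, norm_zero]
    positivity
  · have e : (fun y => 1 - χ (c • y))
        = (fun y => 1 - χ y) ∘ (c • ContinuousLinearMap.id ℝ (Eu d)) := by ext y; simp
    rw [e, ContinuousLinearMap.iteratedFDeriv_comp_right _ ha _ (mod_cast le_top)]
    refine (ContinuousMultilinearMap.norm_compContinuousLinearMap_le _ _).trans ?_
    have h1 : ∏ _j : Fin i, ‖c • ContinuousLinearMap.id ℝ (Eu d)‖ ≤ 1 := by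
      refine Finset.prod_le_one (fun _ _ => norm_nonneg _) fun _ _ => ?_
      rw [norm_smul, Real.norm_of_nonneg hc.le]
      exact mul_le_one₀ hc1 (norm_nonneg _) ContinuousLinearMap.norm_id_le
    push Not at hx
    calc _ ≤ M * 1 := mul_le_mul (hM _) h1 (by positivity) hM0
      _ ≤ _ := by gcongr

/-- Test functions are sequentially dense among the Schwartz functions. -/
theorem exists_tendsto_compactSupport (φ : 𝓢(Eu d, F)) :
    ∃ u : ℕ → 𝓢(Eu d, F), (∀ n, HasCompactSupport (u n)) ∧ Tendsto u atTop (𝓝 φ) := by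
  obtain ⟨χ, hχc, hχs, hM⟩ := exists_cutoff_bound d
  let c : ℕ → ℝ := fun n => 1 / ((n : ℝ) + 1)
  have hc0 : ∀ n, 0 < c n := fun n => by positivity
  have hc1 : ∀ n, c n ≤ 1 := fun n => by
    rw [div_le_one (by positivity)]; linarith [n.cast_nonneg (α := ℝ)]
  have hct : Tendsto c atTop (𝓝 0) := tendsto_one_div_add_atTop_nhds_zero_nat
  have hcc : ∀ n, HasCompactSupport fun x : Eu d => χ (c n • x) := fun n =>
    hχc.comp_smul (hc0 n).ne'
  have hcs : ∀ n, ContDiff ℝ (⊤ : ℕ∞) fun x : Eu d => χ (c n • x) := fun n =>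
    hχs.comp (contDiff_const_smul _)
  have htg : ∀ n, Function.HasTemperateGrowth fun x : Eu d => χ (c n • x) := fun n =>
    (hcc n).hasTemperateGrowth (hcs n)
  have happ : ∀ n x, SchwartzMap.smulLeftCLM F (fun x : Eu d => χ (c n • x)) φ x
      = χ (c n • x) • φ x := fun n x => SchwartzMap.smulLeftCLM_apply_apply (htg n) φ x
  refine ⟨fun n => SchwartzMap.smulLeftCLM F (fun x : Eu d => χ (c n • x)) φ, fun n => ?_, ?_⟩
  · have : ⇑(SchwartzMap.smulLeftCLM F (fun x : Eu d => χ (c n • x)) φ)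
        = (fun x => χ (c n • x)) • ⇑φ := funext (happ n)
    rw [this]; exact (hcc n).smul_right
  · rw [(schwartz_withSeminorms ℝ (Eu d) F).tendsto_nhds _ _]
    rintro ⟨k, n⟩ ε hε
    choose M hM0 hM using hM
    set A : ℝ := ∑ i ∈ Finset.range (n + 1),
      (n.choose i : ℝ) * M i * SchwartzMap.seminorm ℝ (k + 1) (n - i) φ
    have hb : ∀ m, schwartzSeminormFamily ℝ (Eu d) F (k, n)
        (SchwartzMap.smulLeftCLM F (fun x : Eu d => χ (c m • x)) φ - φ) ≤ c m * A := by
      intro m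
      rw [map_sub_rev, SchwartzMap.schwartzSeminormFamily_apply]
      have hA : 0 ≤ A := Finset.sum_nonneg fun i _ =>
        mul_nonneg (mul_nonneg (by positivity) (hM0 i)) (apply_nonneg _ _)
      refine SchwartzMap.seminorm_le_bound ℝ k n _ (mul_nonneg (hc0 m).le hA) fun x => ?_
      have e : ⇑(φ - SchwartzMap.smulLeftCLM F (fun x : Eu d => χ (c m • x)) φ)
          = fun x => (1 - χ (c m • x)) • φ x := by
        ext x; rw [sub_smul, one_smul, ← happ]; rfl
      rw [e]
      have h1 := norm_iteratedFDeriv_smul_le (𝕜 := ℝ) (f := fun x => 1 - χ (c m • x))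
          (contDiff_const.sub (hcs m)) (φ.smooth ⊤) x
        (n := n) (mod_cast le_top)
      refine (mul_le_mul_of_nonneg_left h1 (by positivity)).trans ?_
      rw [Finset.mul_sum, Finset.mul_sum]
      refine Finset.sum_le_sum fun i _ => ?_
      calc ‖x‖ ^ k * ((n.choose i : ℝ) * ‖iteratedFDeriv ℝ i (fun x => 1 - χ (c m • x)) x‖
            * ‖iteratedFDeriv ℝ (n - i) φ x‖)
          ≤ ‖x‖ ^ k * ((n.choose i : ℝ) * (M i * (c m * ‖x‖))
            * ‖iteratedFDeriv ℝ (n - i) φ x‖) := by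
            gcongr
            exact hM i (c m) (hc0 m) (hc1 m) x
        _ = c m * ((n.choose i : ℝ) * M i * (‖x‖ ^ (k + 1) * ‖iteratedFDeriv ℝ (n - i) φ x‖)) := by
            ring
        _ ≤ _ := by
            have := hM0 i
            have := (hc0 m).le
            gcongr
            exact SchwartzMap.le_seminorm ℝ _ _ φ x
    have h0 : Tendsto (fun m => c m * A) atTop (𝓝 0) := by simpa using hct.mul_const A
    filter_upwards [h0.eventually_lt_const hε] with m hm
    exact (hb m).trans_lt hm

end Cutoff

/-! ### Fourier transform of Schwartz functions in the probabilistic normalization. -/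

section FourierS

variable {d : ℕ}

/-- The complexification of a real Schwartz function. -/
abbrev ofR (φ : 𝓢(Eu d, ℝ)) : 𝓢(Eu d, ℂ) := SchwartzMap.postcompCLM Complex.ofRealCLM φ

/-- The constant `(2π)^{-d}`. -/
def cst (d : ℕ) : ℝ := ((2 * Real.pi) ^ d)⁻¹

theorem cst_pos (d : ℕ) : 0 < cst d := by unfold cst; positivity

/-- The character `exp(i ξ·x)`. -/
def chr (ξ x : Eu d) : ℂ := Complex.exp (Complex.I * (inner ℝ ξ x : ℝ))

@[simp] theorem norm_chr (ξ x : Eu d) : ‖chr ξ x‖ = 1 := by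
  rw [chr, mul_comm]; exact Complex.norm_exp_ofReal_mul_I _

theorem chr_add_right (ξ x y : Eu d) : chr ξ (x + y) = chr ξ x * chr ξ y := by
  rw [chr, chr, chr, ← Complex.exp_add, inner_add_right]; push_cast; ring_nf

@[simp] theorem chr_neg_left (ξ x : Eu d) : chr (-ξ) x = chr ξ (-x) := by
  simp [chr]

theorem chr_neg_eq_conj (ξ x : Eu d) : chr ξ (-x) = starRingEnd ℂ (chr ξ x) := by
  rw [chr, chr, ← Complex.exp_conj]
  simp

theorem chr_mul_neg (ξ x : Eu d) : chr ξ x * chr ξ (-x) = 1 := by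
  rw [← chr_add_right]; simp [chr]

theorem chr_comm (ξ x : Eu d) : chr ξ x = chr x ξ := by rw [chr, chr, real_inner_comm]

@[fun_prop] theorem continuous_chr {X : Type*} [TopologicalSpace X] {f g : X → Eu d}
    (hf : Continuous f) (hg : Continuous g) : Continuous fun x => chr (f x) (g x) := by
  unfold chr; fun_prop

theorem fourierS_eq (ψ : 𝓢(Eu d, ℂ)) (ξ : Eu d) :
    fourierS ψ ξ = ∫ x, chr ξ (-x) * ψ x := by
  rw [fourierS_apply]
  refine integral_congr_ae (Eventually.of_forall fun x => ?_)
  simp [chr]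

theorem fourierS_neg (ψ : 𝓢(Eu d, ℂ)) (ξ : Eu d) :
    fourierS ψ (-ξ) = ∫ x, chr ξ x * ψ x := by
  rw [fourierS_eq]; simp

/-- The inverse Fourier transform of a Schwartz function. -/
def invFourierS (Φ : 𝓢(Eu d, ℂ)) : 𝓢(Eu d, ℂ) :=
  𝓕⁻ (SchwartzMap.compCLMOfContinuousLinearEquiv ℂ (dilation d).symm Φ)

theorem fourierS_invFourierS (Φ : 𝓢(Eu d, ℂ)) : fourierS (invFourierS Φ) = Φ := by
  rw [fourierS, invFourierS, FourierTransform.fourier_fourierInv_eq]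
  ext x
  simp

theorem dilation_symm_apply (x : Eu d) : (dilation d).symm x = (2 * Real.pi) • x := by
  rw [ContinuousLinearEquiv.symm_apply_eq]
  change x = (2 * Real.pi)⁻¹ • _
  rw [smul_smul, inv_mul_cancel₀ (by positivity), one_smul]

theorem fourierChar_eq_chr (v w : Eu d) :
    Complex.exp (↑(2 * Real.pi * inner ℝ v w) * Complex.I) = chr w ((2 * Real.pi) • v) := by
  rw [chr, real_inner_smul_right, real_inner_comm, mul_comm]

theorem integral_comp_two_pi_smul {F : Type*} [NormedAddCommGroup F] [NormedSpace ℝ F]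
    (f : Eu d → F) : ∫ x, f ((2 * Real.pi) • x) = cst d • ∫ x, f x := by
  rw [Measure.integral_comp_smul]
  congr 1
  rw [finrank_euclideanSpace_fin, cst, abs_of_nonneg (by positivity)]

theorem invFourierS_apply (Φ : 𝓢(Eu d, ℂ)) (ξ : Eu d) :
    invFourierS Φ ξ = cst d * fourierS Φ (-ξ) := by
  rw [fourierS_neg]
  have h1 : invFourierS Φ ξ = (𝓕⁻ (fun v : Eu d => Φ ((2 * Real.pi) • v))) ξ := by
    rw [invFourierS, SchwartzMap.fourierInv_coe]
    refine congrArg _ (funext fun v => ?_)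
    simp [dilation_symm_apply]
  rw [h1, Real.fourierInv_eq']
  have : ∀ v : Eu d, Complex.exp (↑(2 * Real.pi * inner ℝ v ξ) * Complex.I)
      • Φ ((2 * Real.pi) • v) = (fun x => chr ξ x * Φ x) ((2 * Real.pi) • v) := by
    intro v; rw [fourierChar_eq_chr, smul_eq_mul]
  simp_rw [this]
  rw [integral_comp_two_pi_smul (fun x => chr ξ x * Φ x), Complex.real_smul]

theorem fourierS_fourierS (Φ : 𝓢(Eu d, ℂ)) (ξ : Eu d) :
    (cst d : ℂ) * fourierS (fourierS Φ) ξ = Φ (-ξ) := by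
  have h : invFourierS (fourierS Φ) = Φ := by
    rw [fourierS, invFourierS]
    have : SchwartzMap.compCLMOfContinuousLinearEquiv ℂ (dilation d).symm
        (SchwartzMap.compCLMOfContinuousLinearEquiv ℂ (dilation d) (𝓕 Φ)) = 𝓕 Φ := by
      ext x; simp
    rw [this, FourierTransform.fourierInv_fourier_eq]
  rw [← neg_neg ξ, ← invFourierS_apply, h, neg_neg]

theorem conj_fourierS_ofR (φ : 𝓢(Eu d, ℝ)) (ξ : Eu d) :
    starRingEnd ℂ (fourierS (ofR φ) ξ) = fourierS (ofR φ) (-ξ) := by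
  rw [fourierS_neg, fourierS_eq, ← integral_conj]
  refine integral_congr_ae (Eventually.of_forall fun x => ?_)
  simp [chr_neg_eq_conj]

theorem continuous_fourierS : Continuous (fourierS : 𝓢(Eu d, ℂ) → 𝓢(Eu d, ℂ)) := by
  unfold fourierS
  fun_prop

theorem fourierS_ofR_translate (φ : 𝓢(Eu d, ℝ)) (y ξ : Eu d) :
    fourierS (ofR (translate y φ)) ξ = chr ξ y * fourierS (ofR φ) ξ := by
  rw [fourierS_eq, fourierS_eq, ← integral_const_mul,
    ← integral_add_right_eq_self (fun x => chr ξ y * (chr ξ (-x) * ofR φ x)) y]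
  refine integral_congr_ae (Eventually.of_forall fun x => ?_)
  simp only [SchwartzMap.postcompCLM_apply, translate_apply]
  rw [neg_add, chr_add_right, ← mul_assoc, mul_left_comm, chr_mul_neg, mul_one]

end FourierS

/-! ### Fourier transforms of distributions that are functions. -/

section Pairing

variable {d : ℕ}

theorem continuous_complexPairing (T : RealDist d) : Continuous (complexPairing T) := by
  unfold complexPairing
  have h1 : Continuous fun ψ : 𝓢(Eu d, ℂ) => T (SchwartzMap.postcompCLM Complex.reCLM ψ) :=
    T.continuous.comp (SchwartzMap.postcompCLM Complex.reCLM).continuous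
  have h2 : Continuous fun ψ : 𝓢(Eu d, ℂ) => T (SchwartzMap.postcompCLM Complex.imCLM ψ) :=
    T.continuous.comp (SchwartzMap.postcompCLM Complex.imCLM).continuous
  fun_prop

theorem complexPairing_ofR (T : RealDist d) (φ : 𝓢(Eu d, ℝ)) :
    complexPairing T (ofR φ) = (T φ : ℂ) := by
  have h1 : SchwartzMap.postcompCLM Complex.reCLM (ofR φ) = φ := by ext x; simp
  have h2 : SchwartzMap.postcompCLM Complex.imCLM (ofR φ) = 0 := by ext x; simp
  rw [complexPairing, h1, h2]; simp

theorem continuous_integral_mul {g : Eu d → ℂ} (hg : AEStronglyMeasurable g volume) {C : ℝ}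
    (hC : ∀ ξ, ‖g ξ‖ ≤ C) : Continuous fun ψ : 𝓢(Eu d, ℂ) => ∫ ξ, g ξ * ψ ξ := by
  have hi : ∀ ψ : 𝓢(Eu d, ℂ), Integrable fun ξ => g ξ * ψ ξ := fun ψ =>
    ψ.integrable.bdd_mul hg (Eventually.of_forall hC)
  let A : 𝓢(Eu d, ℂ) →ₗ[ℝ] ℂ :=
    { toFun := fun ψ => ∫ ξ, g ξ * ψ ξ
      map_add' := fun a b => by
        rw [← integral_add (hi a) (hi b)]; simp [mul_add]
      map_smul' := fun c a => by
        rw [RingHom.id_apply, ← integral_smul]; simp [mul_left_comm] }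
  have hb : ∀ ψ, ‖A ψ‖ ≤ C * ‖SchwartzMap.toLpCLM ℝ ℂ 1 volume ψ‖ := fun ψ => by
    rw [SchwartzMap.toLpCLM_apply, SchwartzMap.norm_toLp_one, ← integral_const_mul]
    refine norm_integral_le_of_norm_le (ψ.integrable.norm.const_mul C)
      (Eventually.of_forall fun ξ => ?_)
    rw [norm_mul]
    exact mul_le_mul_of_nonneg_right (hC ξ) (norm_nonneg _)
  refine continuous_of_continuousAt_zero A ?_
  rw [ContinuousAt, map_zero]
  have hL : Continuous fun ψ : 𝓢(Eu d, ℂ) => C * ‖SchwartzMap.toLpCLM ℝ ℂ 1 volume ψ‖ := by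
    fun_prop
  exact squeeze_zero_norm hb (by simpa only [map_zero, norm_zero, mul_zero] using hL.tendsto 0)

/-- `HasFourier` tests only compactly supported functions. Boundedness of g makes both sides
continuous on Schwartz space, and density extends the identity. -/
theorem HasFourier.pairing_fourierS {T : RealDist d} {g : Eu d → ℂ} (hT : HasFourier T g) {C : ℝ}
    (hC : ∀ ξ, ‖g ξ‖ ≤ C) (ψ : 𝓢(Eu d, ℂ)) :
    complexPairing T (fourierS ψ) = ∫ ξ, g ξ * ψ ξ := by
  obtain ⟨u, hu, hlim⟩ := exists_tendsto_compactSupport ψ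
  have h1 := (((continuous_complexPairing T).comp continuous_fourierS).tendsto ψ).comp hlim
  have h2 := ((continuous_integral_mul hT.1.aestronglyMeasurable hC).tendsto ψ).comp hlim
  refine tendsto_nhds_unique h1 (h2.congr fun n => ?_)
  exact (hT.2 (u n) (hu n)).symm

theorem HasFourier.pairing_eq {T : RealDist d} {g : Eu d → ℂ} (hT : HasFourier T g) {C : ℝ}
    (hC : ∀ ξ, ‖g ξ‖ ≤ C) (Φ : 𝓢(Eu d, ℂ)) :
    complexPairing T Φ = cst d * ∫ ξ, g ξ * fourierS Φ (-ξ) := by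
  conv_lhs => rw [← fourierS_invFourierS Φ]
  rw [hT.pairing_fourierS hC, ← integral_const_mul]
  refine integral_congr_ae (Eventually.of_forall fun x => ?_)
  simp only [invFourierS_apply]; ring

theorem HasFourier.unique {T : RealDist d} {g g' : Eu d → ℂ} (h : HasFourier T g)
    (h' : HasFourier T g') : g =ᵐ[volume] g' := by
  refine ae_eq_of_integral_contDiff_smul_eq h.1 h'.1 fun ψ hψ hc => ?_
  let φ : 𝓢(Eu d, ℝ) := hc.toSchwartzMap hψ
  have hφ : HasCompactSupport (ofR φ) :=
    (show HasCompactSupport (Complex.ofReal ∘ ψ) from hc.comp_left Complex.ofReal_zero)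
  have e := (h.2 (ofR φ) hφ).symm.trans (h'.2 (ofR φ) hφ)
  have : ∀ x, ofR φ x = (ψ x : ℂ) := fun x => rfl
  simpa [this, mul_comm] using e

/-- Continuous functions that agree almost everywhere agree, so the choice inside `fourierFun` is
immaterial. -/
theorem fourierFun_eq {T : RealDist d} {g : Eu d → ℂ} (hg : Continuous g) (h : HasFourier T g) :
    fourierFun T = g := by
  have H : ∃ g : Eu d → ℂ, Continuous g ∧ HasFourier T g := ⟨g, hg, h⟩
  rw [fourierFun, dif_pos H]
  exact (Continuous.ae_eq_iff_eq volume H.choose_spec.1 hg).1 (H.choose_spec.2.unique h)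

/-- A real distribution commutes with conjugation of its test functions. Together with uniqueness
this gives the Hermitian symmetry of 𝓕T. -/
theorem HasFourier.conj_neg {T : RealDist d} {g : Eu d → ℂ} (h : HasFourier T g) {C : ℝ}
    (hC : ∀ ξ, ‖g ξ‖ ≤ C) : HasFourier T fun ξ => starRingEnd ℂ (g (-ξ)) := by
  have hm : AEStronglyMeasurable (fun ξ => starRingEnd ℂ (g (-ξ))) volume :=
    (RCLike.continuous_conj).comp_aestronglyMeasurable
      (h.1.aestronglyMeasurable.comp_measurePreserving (Measure.measurePreserving_neg volume))
  refine ⟨?_, fun ψ _ => ?_⟩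
  · refine (locallyIntegrable_const C).mono hm (Eventually.of_forall fun ξ => ?_)
    rw [RCLike.norm_conj]
    exact (hC _).trans (le_abs_self C)
  · let Φ : 𝓢(Eu d, ℂ) := SchwartzMap.postcompCLM (Complex.conjCLE : ℂ →L[ℝ] ℂ) (fourierS ψ)
    have hΦ : complexPairing T Φ = starRingEnd ℂ (complexPairing T (fourierS ψ)) := by
      have h1 : SchwartzMap.postcompCLM Complex.reCLM Φ
          = SchwartzMap.postcompCLM Complex.reCLM (fourierS ψ) := by ext x; simp [Φ]
      have h2 : SchwartzMap.postcompCLM Complex.imCLM Φ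
          = - SchwartzMap.postcompCLM Complex.imCLM (fourierS ψ) := by ext x; simp [Φ]
      rw [complexPairing, complexPairing, h1, h2]
      simp
    have h3 := h.pairing_eq hC Φ
    rw [hΦ] at h3
    have h4 := congrArg (starRingEnd ℂ) h3
    rw [Complex.conj_conj] at h4
    rw [h4, map_mul, ← integral_conj, ← integral_const_mul, ← integral_neg_eq_self]
    refine integral_congr_ae (Eventually.of_forall fun ξ => ?_)
    simp only [map_mul, Complex.conj_ofReal, neg_neg]
    have h5 : starRingEnd ℂ (fourierS Φ ξ) = fourierS (fourierS ψ) (-ξ) := by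
      rw [fourierS_neg, fourierS_eq, ← integral_conj]
      refine integral_congr_ae (Eventually.of_forall fun x => ?_)
      simp [Φ, chr_neg_eq_conj]
    rw [h5, mul_left_comm, fourierS_fourierS, neg_neg]

theorem HasFourier.shifted {T : RealDist d} {g : Eu d → ℂ} (h : HasFourier T g) {C : ℝ}
    (hC : ∀ ξ, ‖g ξ‖ ≤ C) (x : Eu d) :
    HasFourier (shifted T x) fun ξ => chr ξ (-x) * g (-ξ) := by
  have hm : AEStronglyMeasurable (fun ξ => chr ξ (-x) * g (-ξ)) volume :=
    (Continuous.aestronglyMeasurable (by fun_prop)).mul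
      (h.1.aestronglyMeasurable.comp_measurePreserving (Measure.measurePreserving_neg volume))
  refine ⟨?_, fun ψ _ => ?_⟩
  · refine (locallyIntegrable_const C).mono hm (Eventually.of_forall fun ξ => ?_)
    rw [norm_mul, norm_chr, one_mul]
    exact (hC _).trans (le_abs_self C)
  · let Φ : 𝓢(Eu d, ℂ) := SchwartzMap.compCLMOfContinuousLinearEquiv ℂ
      (ContinuousLinearEquiv.neg ℝ) (SchwartzMap.compSubConstCLM ℂ (-x) (fourierS ψ))
    have hΦx : ∀ z, Φ z = fourierS ψ (-z + x) := fun z => by simp [Φ]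
    have hΦ : complexPairing (LevySPDE.shifted T x) (fourierS ψ) = complexPairing T Φ := by
      have h1 : SchwartzMap.postcompCLM Complex.reCLM Φ
          = reflect (translate x (SchwartzMap.postcompCLM Complex.reCLM (fourierS ψ))) := by
        ext z; simp [hΦx, reflect_apply, translate_apply]
      have h2 : SchwartzMap.postcompCLM Complex.imCLM Φ
          = reflect (translate x (SchwartzMap.postcompCLM Complex.imCLM (fourierS ψ))) := by
        ext z; simp [hΦx, reflect_apply, translate_apply]
      rw [complexPairing, complexPairing, h1, h2]
      rfl
    rw [hΦ, h.pairing_eq hC, ← integral_const_mul, ← integral_neg_eq_self]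
    refine integral_congr_ae (Eventually.of_forall fun ξ => ?_)
    simp only [neg_neg]
    have h5 : fourierS Φ ξ = chr ξ (-x) * fourierS (fourierS ψ) (-ξ) := by
      rw [fourierS_neg, fourierS_eq, ← integral_const_mul, ← integral_neg_eq_self,
        ← integral_add_right_eq_self (fun z => chr ξ (-x) * (chr ξ z * fourierS ψ z)) x]
      refine integral_congr_ae (Eventually.of_forall fun z => ?_)
      simp only [hΦx, neg_neg]
      rw [chr_add_right]
      linear_combination (-(chr ξ z) * fourierS ψ (z + x)) * chr_mul_neg ξ x
    rw [h5]
    linear_combination (chr ξ (-x) * g (-ξ)) * (fourierS_fourierS ψ (-ξ)).trans (by rw [neg_neg])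

end Pairing

/-! ### Derivative bounds for radial functions and polynomial weights. -/

section Radial

variable {d : ℕ}

theorem norm_iteratedFDeriv_clm_le {E F : Type*} [NormedAddCommGroup E] [NormedSpace ℝ E]
    [NormedAddCommGroup F] [NormedSpace ℝ F] (L : E →L[ℝ] F) {n : ℕ} (hn : n ≠ 0) (x : E) :
    ‖iteratedFDeriv ℝ n L x‖ ≤ ‖L‖ := by
  obtain ⟨k, rfl⟩ := Nat.exists_eq_succ_of_ne_zero hn
  rw [Nat.succ_eq_add_one, ← norm_iteratedFDeriv_fderiv]
  have : fderiv ℝ (L : E → F) = fun _ => L := by ext1 x; exact L.fderiv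
  rw [this]
  rcases k with _ | k
  · simp
  · rw [iteratedFDeriv_const_of_ne (by simp)]; simp

/-- Bounds on all derivatives of a family of functions with `∇f_j(x) = c_j f_{j+1}(x) x`. -/
theorem iteratedFDeriv_bound_of_radial (f : ℕ → Eu d → ℝ) (c : ℕ → ℝ) (W : ℕ → ℕ → Eu d → ℝ)
    (hf : ∀ j x, HasFDerivAt (f j) ((c j * f (j + 1) x) • innerSL ℝ x) x)
    (h0 : ∀ j, ∃ C, 0 ≤ C ∧ ∀ x, ‖f j x‖ ≤ C * W j 0 x) (hWpos : ∀ j n x, 0 ≤ W j n x)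
    (hW1 : ∀ j n x, W (j + 1) n x * ‖x‖ ≤ W j (n + 1) x)
    (hW2 : ∀ j m n x, m ≤ n → W (j + 1) m x ≤ W j (n + 1) x) :
    (∀ j, ContDiff ℝ (⊤ : ℕ∞) (f j)) ∧
      ∀ n j, ∃ C, 0 ≤ C ∧ ∀ x, ‖iteratedFDeriv ℝ n (f j) x‖ ≤ C * W j n x := by
  have hfd : ∀ j, fderiv ℝ (f j) = fun x => (c j * f (j + 1) x) • innerSL ℝ x := fun j =>
    funext fun x => (hf j x).fderiv
  have hn : ∀ n : ℕ, ∀ j, ContDiff ℝ n (f j) := by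
    intro n
    induction n with
    | zero =>
      intro j
      simp only [CharP.cast_eq_zero, contDiff_zero]
      exact continuous_iff_continuousAt.2 fun x => (hf j x).continuousAt
    | succ n ih =>
      intro j
      have := (contDiff_succ_iff_fderiv (𝕜 := ℝ) (n := n) (f := f j)).2
      push_cast
      refine this ⟨fun x => (hf j x).differentiableAt, by simp, ?_⟩
      rw [hfd]
      exact (contDiff_const.mul (ih (j + 1))).smul (innerSL ℝ).contDiff
  have hs : ∀ j, ContDiff ℝ (⊤ : ℕ∞) (f j) := fun j => contDiff_infty.2 fun n => hn n j
  refine ⟨hs, fun n => ?_⟩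
  induction n using Nat.strong_induction_on with
  | _ n ih =>
    intro j
    rcases n with _ | n
    · obtain ⟨C, hC, h⟩ := h0 j
      exact ⟨C, hC, fun x => by rw [norm_iteratedFDeriv_zero]; exact h x⟩
    · choose! C hC hb using fun i (hi : i < n + 1) => ih i hi (j + 1)
      refine ⟨∑ i ∈ Finset.range (n + 1), (n.choose i : ℝ) * (|c j| * C i), ?_, fun x => ?_⟩
      · exact Finset.sum_nonneg fun i hi =>
          mul_nonneg (by positivity) (mul_nonneg (abs_nonneg _) (hC i (Finset.mem_range.1 hi)))
      · rw [← norm_iteratedFDeriv_fderiv, hfd]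
        refine (norm_iteratedFDeriv_smul_le (𝕜 := ℝ) (f := fun x => c j * f (j + 1) x)
          (contDiff_const.mul (hn n (j + 1))) (innerSL ℝ).contDiff x (n := n) le_rfl).trans ?_
        rw [Finset.sum_mul]
        refine Finset.sum_le_sum fun i hi => ?_
        have hi' := Finset.mem_range.1 hi
        have e1 : ‖iteratedFDeriv ℝ i (fun x => c j * f (j + 1) x) x‖
            ≤ |c j| * (C i * W (j + 1) i x) := by
          have := iteratedFDeriv_const_smul_apply' (𝕜 := ℝ) (a := c j) (x := x)
            ((hn i (j + 1)).contDiffAt (x := x))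
          simp only [smul_eq_mul] at this
          rw [this, norm_smul, Real.norm_eq_abs]
          exact mul_le_mul_of_nonneg_left (hb i hi' x) (abs_nonneg _)
        -- For i = n the linear factor is not differentiated and contributes ‖x‖, absorbed by `hW1`;
        -- for i < n it contributes at most 1, and `hW2` applies.
        have e2 : W (j + 1) i x * ‖iteratedFDeriv ℝ (n - i) (innerSL ℝ : Eu d → _) x‖
            ≤ W j (n + 1) x := by
          rcases eq_or_ne i n with rfl | hne
          · rw [Nat.sub_self, norm_iteratedFDeriv_zero, innerSL_apply_norm]
            exact hW1 j i x
          · refine le_trans (mul_le_of_le_one_right (hWpos _ _ _) ?_) (hW2 j i n x (by omega))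
            exact (norm_iteratedFDeriv_clm_le _ (by omega) x).trans (norm_innerSL_le ℝ)
        calc _ ≤ (n.choose i : ℝ) * (|c j| * (C i * W (j + 1) i x))
              * ‖iteratedFDeriv ℝ (n - i) (innerSL ℝ : Eu d → _) x‖ := by gcongr
          _ = (n.choose i : ℝ) * (|c j| * C i) * (W (j + 1) i x
              * ‖iteratedFDeriv ℝ (n - i) (innerSL ℝ : Eu d → _) x‖) := by ring
          _ ≤ _ := mul_le_mul_of_nonneg_left e2
              (mul_nonneg (by positivity) (mul_nonneg (abs_nonneg _) (hC i hi')))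

/-- The weight `(1 + |x|²)^s`. -/
def wt (s : ℝ) (x : Eu d) : ℝ := (1 + ‖x‖ ^ 2) ^ s

theorem wt_pos (s : ℝ) (x : Eu d) : 0 < wt s x := Real.rpow_pos_of_pos (by positivity) _

theorem wt_add (s t : ℝ) (x : Eu d) : wt (s + t) x = wt s x * wt t x :=
  Real.rpow_add (by positivity) _ _

theorem wt_neg_mul (s : ℝ) (x : Eu d) : wt s x * wt (-s) x = 1 := by
  rw [← wt_add, add_neg_cancel, wt, Real.rpow_zero]

@[fun_prop] theorem continuous_wt (s : ℝ) : Continuous (wt s : Eu d → ℝ) := by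
  unfold wt
  exact Continuous.rpow_const (by fun_prop) fun x => Or.inl (by positivity)

theorem hasTemperateGrowth_wt (s : ℝ) : Function.HasTemperateGrowth (wt s : Eu d → ℝ) :=
  Function.hasTemperateGrowth_one_add_norm_sq_rpow (Eu d) s

theorem wt_mono {s t : ℝ} (h : s ≤ t) (x : Eu d) : wt s x ≤ wt t x :=
  Real.rpow_le_rpow_of_exponent_le (by nlinarith [sq_nonneg ‖x‖]) h

theorem wt_le_one {s : ℝ} (h : s ≤ 0) (x : Eu d) : wt s x ≤ 1 := by
  simpa [wt] using wt_mono h x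

theorem norm_mul_wt_le (x : Eu d) : ‖x‖ * wt (-(1 / 2)) x ≤ 1 := by
  have h : ‖x‖ ≤ wt (1 / 2) x := by
    rw [wt, ← Real.sqrt_eq_rpow]
    exact Real.le_sqrt_of_sq_le (by linarith)
  calc _ ≤ wt (1 / 2) x * wt (-(1 / 2)) x := mul_le_mul_of_nonneg_right h (wt_pos _ _).le
    _ = 1 := wt_neg_mul _ _

theorem norm_pow_mul_wt_le (k : ℕ) (x : Eu d) : ‖x‖ ^ k * wt (-(k / 2 : ℝ)) x ≤ 1 := by
  have : wt (-(k / 2 : ℝ)) x = wt (-(1 / 2)) x ^ k := by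
    rw [wt, wt, ← Real.rpow_mul_natCast (by positivity)]; congr 1; ring
  rw [this, ← mul_pow]
  exact pow_le_one₀ (mul_nonneg (norm_nonneg _) (wt_pos _ _).le) (norm_mul_wt_le x)

/-- Peetre's inequality, from 1 + |y|² ≤ 2 (1 + |x|²)(1 + |x+y|²). It moves a weight from x to y at
the price of a weight in x + y. -/
theorem wt_peetre {s : ℝ} (hs : 0 ≤ s) (x y : Eu d) :
    wt (-s) x ≤ 2 ^ s * wt (-s) y * wt s (x + y) := by
  have h : wt s y ≤ 2 ^ s * wt s x * wt s (x + y) := by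
    unfold wt
    rw [← Real.mul_rpow (by norm_num) (by positivity), ← Real.mul_rpow (by positivity)
      (by positivity)]
    refine Real.rpow_le_rpow (by positivity) ?_ hs
    have h1 : ‖y‖ ≤ ‖x + y‖ + ‖x‖ := by
      calc ‖y‖ = ‖(x + y) - x‖ := by simp
        _ ≤ _ := norm_sub_le _ _
    have h2 : ‖y‖ ^ 2 ≤ (‖x + y‖ + ‖x‖) ^ 2 := pow_le_pow_left₀ (norm_nonneg _) h1 2
    nlinarith [sq_nonneg (‖x + y‖ - ‖x‖), sq_nonneg (‖x + y‖ * ‖x‖)]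
  have hx := wt_neg_mul s x
  have hy := wt_neg_mul s y
  have px := wt_pos (-s) x
  have py := wt_pos (-s) y
  calc wt (-s) x = wt s y * wt (-s) y * wt (-s) x := by rw [hy, one_mul]
    _ ≤ (2 ^ s * wt s x * wt s (x + y)) * wt (-s) y * wt (-s) x := by gcongr
    _ = 2 ^ s * wt (-s) y * wt s (x + y) * (wt s x * wt (-s) x) := by ring
    _ = _ := by rw [hx, mul_one]

theorem contDiff_wt (s : ℝ) : ContDiff ℝ (⊤ : ℕ∞) (wt s : Eu d → ℝ) :=
  (hasTemperateGrowth_wt s).1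

theorem hasFDerivAt_wt (s : ℝ) (x : Eu d) :
    HasFDerivAt (wt s) ((2 * s * wt (s - 1) x) • innerSL ℝ x) x := by
  have h1 : HasFDerivAt (fun y : Eu d => 1 + ‖y‖ ^ 2) (2 • innerSL ℝ x) x :=
    ((hasStrictFDerivAt_norm_sq x).hasFDerivAt).const_add 1
  have h2 := h1.rpow_const (p := s) (Or.inl (by positivity))
  refine h2.congr_fderiv ?_
  ext v
  simp only [smul_apply, wt, nsmul_eq_mul, smul_eq_mul]
  push_cast
  ring

/-- The gradient of (1 + |x|²)^{s-j} is a multiple of (1 + |x|²)^{s-j-1} x: the exponent drops by 1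
and the factor x gives back at most 1/2, so differentiation never worsens the weight. -/
theorem exists_bound_iteratedFDeriv_wt (s : ℝ) (n : ℕ) :
    ∃ C, 0 ≤ C ∧ ∀ x : Eu d, ‖iteratedFDeriv ℝ n (wt s) x‖ ≤ C * wt s x := by
  have h := (iteratedFDeriv_bound_of_radial (d := d) (fun j => wt (s - j)) (fun j => 2 * (s - j))
    (fun j _ => wt (s - j)) (fun j x => ?_) (fun j => ⟨1, by norm_num, fun x => ?_⟩)
    (fun j n x => (wt_pos _ _).le) (fun j n x => ?_) (fun j m n x _ => ?_)).2 n 0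
  · simpa using h
  · convert hasFDerivAt_wt (s - j) x using 3
    push_cast; ring_nf
  · rw [one_mul, Real.norm_of_nonneg (wt_pos _ _).le]
  · have e : wt (s - (j + 1 : ℕ)) x = wt (s - j - 1 / 2) x * wt (-(1 / 2)) x := by
      rw [← wt_add]; congr 1; push_cast; ring
    rw [e, mul_assoc, mul_comm (wt _ x) ‖x‖]
    exact (mul_le_of_le_one_right (wt_pos _ _).le (norm_mul_wt_le x)).trans
      (wt_mono (by linarith) x)
  · exact wt_mono (by push_cast; linarith) x

end Radial

/-! ### Weighted Sobolev bounds for rapidly decreasing distributions. -/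

section BoundedDist

variable {d : ℕ}

theorem integrable_wt_mul_iteratedFDeriv {F : Type*} [NormedAddCommGroup F] [NormedSpace ℝ F]
    (φ : 𝓢(Eu d, F)) (hφ : HasCompactSupport φ) (s : ℝ) (i : ℕ) (y : Eu d) :
    Integrable fun x => wt s x * ‖iteratedFDeriv ℝ i φ (x + y)‖ := by
  have hc : Continuous fun x => iteratedFDeriv ℝ i φ (x + y) :=
    ((φ.smooth ⊤).continuous_iteratedFDeriv (mod_cast le_top)).comp (by fun_prop)
  have hs : HasCompactSupport fun x => iteratedFDeriv ℝ i φ (x + y) :=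
    (hφ.iteratedFDeriv i).comp_homeomorph (Homeomorph.addRight y)
  exact ((continuous_wt s).mul hc.norm).integrable_of_hasCompactSupport hs.norm.mul_left

theorem smulLeft_wt_apply (s : ℝ) (φ : 𝓢(Eu d, ℝ)) (x : Eu d) :
    SchwartzMap.smulLeftCLM ℝ (wt s) φ x = wt s x * φ x := by
  rw [SchwartzMap.smulLeftCLM_apply_apply (hasTemperateGrowth_wt s), smul_eq_mul]

theorem hasCompactSupport_smulLeft_wt (s : ℝ) {φ : 𝓢(Eu d, ℝ)} (hφ : HasCompactSupport φ) :
    HasCompactSupport (SchwartzMap.smulLeftCLM ℝ (wt s) φ) := by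
  have : ⇑(SchwartzMap.smulLeftCLM ℝ (wt s) φ) = wt s * ⇑φ := funext (smulLeft_wt_apply s φ)
  rw [this]; exact hφ.mul_left

theorem exists_bound_iteratedFDeriv_wt_mul (s : ℝ) (m : ℕ) :
    ∃ C, 0 ≤ C ∧ ∀ φ : 𝓢(Eu d, ℝ), HasCompactSupport φ →
      ∑ i ∈ Finset.range (m + 1), ∫ x, ‖iteratedFDeriv ℝ i (SchwartzMap.smulLeftCLM ℝ (wt s) φ) x‖
        ≤ C * ∑ i ∈ Finset.range (m + 1), ∫ x, wt s x * ‖iteratedFDeriv ℝ i φ x‖ := by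
  choose A hA0 hA using exists_bound_iteratedFDeriv_wt (d := d) s
  set B : ℝ := ∑ i ∈ Finset.range (m + 1), ∑ j ∈ Finset.range (m + 1), (i.choose j : ℝ) * A j
  have hB : 0 ≤ B := Finset.sum_nonneg fun i _ => Finset.sum_nonneg fun j _ =>
    mul_nonneg (by positivity) (hA0 j)
  refine ⟨B, hB, fun φ hφ => ?_⟩
  set I : ℕ → ℝ := fun i => ∫ x, wt s x * ‖iteratedFDeriv ℝ i φ x‖
  have hI : ∀ i, 0 ≤ I i := fun i => integral_nonneg fun x =>
    mul_nonneg (wt_pos _ _).le (norm_nonneg _)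
  have hint : ∀ i, Integrable fun x => wt s x * ‖iteratedFDeriv ℝ i φ x‖ := fun i => by
    simpa using integrable_wt_mul_iteratedFDeriv φ hφ s i 0
  rw [Finset.sum_mul]
  refine Finset.sum_le_sum fun i hi => ?_
  rw [Finset.sum_mul]
  have hpt : ∀ x, ‖iteratedFDeriv ℝ i (SchwartzMap.smulLeftCLM ℝ (wt s) φ) x‖
      ≤ ∑ j ∈ Finset.range (i + 1), (i.choose j : ℝ) * A j
        * (wt s x * ‖iteratedFDeriv ℝ (i - j) φ x‖) := fun x => by
    have e : ⇑(SchwartzMap.smulLeftCLM ℝ (wt s) φ) = fun x => wt s x * φ x :=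
      funext (smulLeft_wt_apply s φ)
    rw [e]
    refine (norm_iteratedFDeriv_mul_le (𝕜 := ℝ) (contDiff_wt s) (φ.smooth ⊤) x (n := i)
      (mod_cast le_top)).trans (Finset.sum_le_sum fun j _ => ?_)
    calc _ ≤ (i.choose j : ℝ) * (A j * wt s x) * ‖iteratedFDeriv ℝ (i - j) φ x‖ := by
          gcongr; exact hA j x
      _ = _ := by ring
  have hsumle : ∀ j ≤ i, I (i - j) ≤ ∑ l ∈ Finset.range (m + 1), I l := fun j _ =>
    Finset.single_le_sum (fun l _ => hI l) (Finset.mem_range.2 (by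
      have := Finset.mem_range.1 hi; omega))
  calc ∫ x, ‖iteratedFDeriv ℝ i (SchwartzMap.smulLeftCLM ℝ (wt s) φ) x‖
      ≤ ∫ x, ∑ j ∈ Finset.range (i + 1), (i.choose j : ℝ) * A j
        * (wt s x * ‖iteratedFDeriv ℝ (i - j) φ x‖) := by
        refine integral_mono_of_nonneg (Eventually.of_forall fun x => norm_nonneg _)
          (integrable_finsetSum _ fun j _ => (hint _).const_mul _) (Eventually.of_forall hpt)
    _ = ∑ j ∈ Finset.range (i + 1), (i.choose j : ℝ) * A j * I (i - j) := by
        rw [integral_finsetSum _ fun j _ => (hint _).const_mul _]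
        simp_rw [integral_const_mul]
        rfl
    _ ≤ ∑ j ∈ Finset.range (i + 1), (i.choose j : ℝ) * A j * ∑ l ∈ Finset.range (m + 1), I l := by
        refine Finset.sum_le_sum fun j hj => mul_le_mul_of_nonneg_left (hsumle j ?_)
          (mul_nonneg (by positivity) (hA0 j))
        have := Finset.mem_range.1 hj; omega
    _ ≤ _ := by
        refine Finset.sum_le_sum_of_subset_of_nonneg ?_ fun j _ _ =>
          mul_nonneg (mul_nonneg (by positivity) (hA0 j)) (Finset.sum_nonneg fun l _ => hI l)
        intro j hj
        have := Finset.mem_range.1 hj; have := Finset.mem_range.1 hi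
        exact Finset.mem_range.2 (by omega)

/-- A distribution with rapid decrease is bounded by weighted Sobolev norms. -/
theorem IsRapidlyDecreasing.exists_bound {T : RealDist d} (hT : IsRapidlyDecreasing T) (k : ℕ) :
    ∃ (m : ℕ) (C : ℝ), 0 ≤ C ∧ ∀ φ : 𝓢(Eu d, ℝ), HasCompactSupport φ →
      |T φ| ≤ C * ∑ i ∈ Finset.range (m + 1),
        ∫ x, wt (-(k / 2 : ℝ)) x * ‖iteratedFDeriv ℝ i φ x‖ := by
  obtain ⟨m, C, h⟩ := hT k
  obtain ⟨B, hB0, hB⟩ := exists_bound_iteratedFDeriv_wt_mul (d := d) (-(k / 2 : ℝ)) m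
  refine ⟨m, |C| * B, by positivity, fun φ hφ => ?_⟩
  -- The test function is divided by (1 + |x|²)^{k/2}, which undoes the weight in the hypothesis.
  have h1 := h _ (hasCompactSupport_smulLeft_wt (-(k / 2 : ℝ)) hφ)
  have e : (T ∘L SchwartzMap.smulLeftCLM ℝ (fun x : Eu d => (1 + ‖x‖ ^ 2) ^ ((k : ℝ) / 2)))
      (SchwartzMap.smulLeftCLM ℝ (wt (-(k / 2 : ℝ))) φ) = T φ := by
    rw [ContinuousLinearMap.comp_apply]
    refine congrArg T ?_
    ext x
    have := smulLeft_wt_apply ((k : ℝ) / 2) (SchwartzMap.smulLeftCLM ℝ (wt (-(k / 2 : ℝ))) φ) x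
    refine this.trans ?_
    rw [smulLeft_wt_apply, ← mul_assoc, wt_neg_mul, one_mul]
  rw [e] at h1
  refine h1.trans ?_
  rw [mul_assoc]
  have h2 := hB φ hφ
  calc _ ≤ |C| * _ := mul_le_mul_of_nonneg_right (le_abs_self C)
        (Finset.sum_nonneg fun i _ => integral_nonneg fun x => norm_nonneg _)
    _ ≤ _ := mul_le_mul_of_nonneg_left h2 (abs_nonneg C)

end BoundedDist

/-! ### Continuity of the Fourier transform on 𝓞_C'. -/

section FourierOfRapidlyDecreasing

variable {d : ℕ}

theorem norm_chr_sub_le (ξ x y : Eu d) : ‖chr ξ x - chr ξ y‖ ≤ ‖ξ‖ * ‖x - y‖ := by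
  have h : chr ξ x - chr ξ y = chr ξ y * (chr ξ (x - y) - 1) := by
    rw [mul_sub, ← chr_add_right, mul_one]; congr 2; abel
  rw [h, norm_mul, norm_chr, one_mul, chr]
  exact (Real.norm_exp_I_mul_ofReal_sub_one_le).trans (norm_inner_le_norm ξ (x - y))

/-- The bilinear form `(2π)⁻¹ x·y`, for which Mathlib's Fourier integral is `fourierS`. -/
def innerForm (d : ℕ) : Eu d →L[ℝ] Eu d →L[ℝ] ℝ := (2 * Real.pi)⁻¹ • innerSL ℝ

theorem innerForm_apply (x y : Eu d) : innerForm d x y = (2 * Real.pi)⁻¹ * inner ℝ x y := rfl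

theorem fourierChar_innerForm (x y : Eu d) :
    (Real.fourierChar (-(innerForm d x y)) : ℂ) = chr y (-x) := by
  rw [Real.fourierChar_apply, innerForm_apply, chr, inner_neg_right, real_inner_comm, mul_comm]
  congr 2
  have : (Real.pi : ℂ) ≠ 0 := by exact_mod_cast Real.pi_ne_zero
  push_cast; field_simp

theorem fourierChar_neg_innerForm (x y : Eu d) :
    (Real.fourierChar (-((-innerForm d) x y)) : ℂ) = chr y x := by
  have := fourierChar_innerForm (-x) y
  rw [neg_neg] at this
  rw [← this]; simp

theorem vectorFourierIntegral_eq {F : Type*} [NormedAddCommGroup F] [NormedSpace ℂ F]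
    (f : Eu d → F) (x : Eu d) :
    VectorFourier.fourierIntegral Real.fourierChar volume (innerForm d).toLinearMap₁₂ f x
      = ∫ v, chr x (-v) • f v := by
  refine integral_congr_ae (Eventually.of_forall fun v => ?_)
  change Real.fourierChar (-(innerForm d v x)) • f v = chr x (-v) • f v
  rw [← fourierChar_innerForm]; rfl

theorem vectorFourierIntegral_neg_eq {F : Type*} [NormedAddCommGroup F] [NormedSpace ℂ F]
    (f : Eu d → F) (x : Eu d) :
    VectorFourier.fourierIntegral Real.fourierChar volume (-innerForm d).toLinearMap₁₂ f x
      = ∫ v, chr x v • f v := by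
  refine integral_congr_ae (Eventually.of_forall fun v => ?_)
  change Real.fourierChar (-((-innerForm d) v x)) • f v = chr x v • f v
  rw [← fourierChar_neg_innerForm]; rfl

/-- The multilinear symbol of the `i`-th derivative of `x ↦ exp(-i v·x)`. -/
def symb (i : ℕ) (v : Eu d) : ContinuousMultilinearMap ℝ (fun _ : Fin i => Eu d) ℂ :=
  VectorFourier.fourierPowSMulRight (innerForm d) (fun _ => (1 : ℂ)) v i

@[fun_prop] theorem continuous_symb (i : ℕ) : Continuous (symb i : Eu d → _) :=
  Continuous.fourierPowSMulRight _ continuous_const i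

theorem iteratedFDeriv_fourierS (ψ : 𝓢(Eu d, ℂ)) (i : ℕ) (x : Eu d) :
    iteratedFDeriv ℝ i (fourierS ψ) x = ∫ v, ψ v • (chr x (-v) • symb i v) := by
  have e : ⇑(fourierS ψ)
      = VectorFourier.fourierIntegral Real.fourierChar volume (innerForm d).toLinearMap₁₂ ψ := by
    ext y; rw [vectorFourierIntegral_eq, fourierS_eq]; rfl
  rw [e, VectorFourier.iteratedFDeriv_fourierIntegral (N := ⊤) (innerForm d)
    (fun n _ => ψ.integrable_pow_mul volume n) ψ.integrable.aestronglyMeasurable le_top,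
    vectorFourierIntegral_eq]
  refine integral_congr_ae (Eventually.of_forall fun v => ?_)
  ext m
  simp only [symb, smul_apply, VectorFourier.fourierPowSMulRight_apply,
    smul_eq_mul, Complex.real_smul]
  ring

/-- Weighted bounded continuous jets. -/
abbrev JetSpace (d m : ℕ) : Type :=
  ∀ i : Fin (m + 1), BoundedContinuousFunction (Eu d)
    (ContinuousMultilinearMap ℝ (fun _ : Fin i => Eu d) ℂ)

instance (m : ℕ) : NormedAddCommGroup (JetSpace d m) := Pi.normedAddCommGroup

instance (m : ℕ) : NormedSpace ℂ (JetSpace d m) := Pi.normedSpace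

/-- The weighted `i`-th derivative as a bounded continuous function. -/
def jetComp (d i : ℕ) : 𝓢(Eu d, ℂ) →L[ℂ] BoundedContinuousFunction (Eu d)
    (ContinuousMultilinearMap ℝ (fun _ : Fin i => Eu d) ℂ) :=
  SchwartzMap.mkCLMtoNormedSpace (σ := RingHom.id ℂ)
    (fun φ => BoundedContinuousFunction.ofNormedAddCommGroup
      (fun x => wt (-(1 / 2)) x • iteratedFDeriv ℝ i φ x)
      ((continuous_wt _).smul ((φ.smooth ⊤).continuous_iteratedFDeriv (mod_cast le_top)))
      (SchwartzMap.seminorm ℂ 0 i φ) (fun x => by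
        rw [norm_smul, Real.norm_of_nonneg (wt_pos _ _).le]
        exact (mul_le_of_le_one_left (norm_nonneg _) (wt_le_one (by norm_num) x)).trans
          (SchwartzMap.norm_iteratedFDeriv_le_seminorm ℂ φ i x)))
    (fun f g => by
      ext1 x
      change wt _ x • iteratedFDeriv ℝ i (⇑f + ⇑g) x = _
      rw [iteratedFDeriv_add_apply (f.contDiffAt i) (g.contDiffAt i), smul_add]
      rfl)
    (fun a f => by
      ext1 x
      change wt _ x • iteratedFDeriv ℝ i (a • ⇑f) x = _
      rw [iteratedFDeriv_const_smul_apply (f.contDiffAt i), smul_comm]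
      rfl)
    ⟨{(0, i)}, 1, by norm_num, fun f => by
      rw [one_mul, Finset.sup_singleton]
      exact BoundedContinuousFunction.norm_ofNormedAddCommGroup_le _ (apply_nonneg _ _) _⟩

/-- The weighted jet of a Schwartz function. -/
def jet (d m : ℕ) : 𝓢(Eu d, ℂ) →L[ℂ] JetSpace d m :=
  ContinuousLinearMap.pi fun i => jetComp d i

/-- The weighted jet of the exponential `x ↦ exp(-i v·x)`. -/
def expJet (d m : ℕ) (v : Eu d) : JetSpace d m := fun i =>
  BoundedContinuousFunction.ofNormedAddCommGroup
    (fun x => wt (-(1 / 2)) x • (chr x (-v) • symb i v))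
    (by fun_prop) ‖symb (d := d) i v‖ (fun x => by
      rw [norm_smul, norm_smul, norm_chr, one_mul, Real.norm_of_nonneg (wt_pos _ _).le]
      exact mul_le_of_le_one_left (norm_nonneg _) (wt_le_one (by norm_num) x))

/-- This is what the jet weight is for: |e^{-ix·v} - e^{-ix·v₀}| ≤ |x| |v - v₀| is small uniformly
in x only after division by (1 + |x|²)^{1/2}. -/
theorem continuous_expJet (m : ℕ) : Continuous (expJet d m) := by
  refine continuous_pi fun i => continuous_iff_continuousAt.2 fun v₀ => ?_
  rw [ContinuousAt, tendsto_iff_dist_tendsto_zero]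
  have hb : ∀ v, dist (expJet d m v i) (expJet d m v₀ i)
      ≤ ‖v - v₀‖ * ‖symb (d := d) i v‖ + ‖symb (d := d) i v - symb i v₀‖ := fun v => by
    refine (BoundedContinuousFunction.dist_le (by positivity)).2 fun x => ?_
    rw [dist_eq_norm]
    change ‖wt (-(1 / 2)) x • (chr x (-v) • symb (d := d) i v)
      - wt (-(1 / 2)) x • (chr x (-v₀) • symb i v₀)‖ ≤ _
    have e : wt (-(1 / 2)) x • (chr x (-v) • symb (d := d) i v)
        - wt (-(1 / 2)) x • (chr x (-v₀) • symb i v₀)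
        = wt (-(1 / 2)) x • ((chr x (-v) - chr x (-v₀)) • symb (d := d) i v)
          + wt (-(1 / 2)) x • (chr x (-v₀) • (symb i v - symb i v₀)) := by
      ext w
      simp only [sub_apply, add_apply,
        smul_apply, smul_eq_mul, Complex.real_smul]
      ring
    rw [e]
    refine (norm_add_le _ _).trans (add_le_add ?_ ?_)
    · rw [norm_smul, norm_smul, Real.norm_of_nonneg (wt_pos _ _).le, ← mul_assoc]
      refine mul_le_mul_of_nonneg_right ?_ (norm_nonneg _)
      calc _ ≤ wt (-(1 / 2)) x * (‖x‖ * ‖-v - -v₀‖) :=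
            mul_le_mul_of_nonneg_left (norm_chr_sub_le x _ _) (wt_pos _ _).le
        _ = (‖x‖ * wt (-(1 / 2)) x) * ‖v - v₀‖ := by
            rw [show -v - -v₀ = -(v - v₀) by abel, norm_neg]; ring
        _ ≤ _ := mul_le_of_le_one_left (norm_nonneg _) (norm_mul_wt_le x)
    · rw [norm_smul, norm_smul, norm_chr, one_mul, Real.norm_of_nonneg (wt_pos _ _).le]
      exact mul_le_of_le_one_left (norm_nonneg _) (wt_le_one (by norm_num) x)
  refine squeeze_zero (fun _ => dist_nonneg) hb ?_
  have hc : Continuous fun v : Eu d =>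
      ‖v - v₀‖ * ‖symb (d := d) i v‖ + ‖symb (d := d) i v - symb i v₀‖ := by fun_prop
  simpa using hc.tendsto v₀

/-- As a Bochner integral of exponentials in the jet space, the transform lets any continuous
functional on jets pass under the integral sign. -/
theorem jet_fourierS (m : ℕ) (ψ : 𝓢(Eu d, ℂ)) (hψ : HasCompactSupport ψ) :
    jet d m (fourierS ψ) = ∫ v, ψ v • expJet d m v := by
  have hi : Integrable fun v => ψ v • expJet d m v :=
    (ψ.continuous.smul (continuous_expJet m)).integrable_of_hasCompactSupport hψ.smul_right
  ext1 i
  ext1 x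
  let ev : JetSpace d m →L[ℝ] ContinuousMultilinearMap ℝ (fun _ : Fin i => Eu d) ℂ :=
    (BoundedContinuousFunction.evalCLM ℝ x).comp (ContinuousLinearMap.proj i)
  have h1 : (∫ v, ψ v • expJet d m v) i x = ev (∫ v, ψ v • expJet d m v) := rfl
  rw [h1, ← ev.integral_comp_comm hi]
  have h2 : jet d m (fourierS ψ) i x = wt (-(1 / 2)) x • iteratedFDeriv ℝ i (fourierS ψ) x := rfl
  rw [h2, iteratedFDeriv_fourierS, ← integral_smul]
  refine integral_congr_ae (Eventually.of_forall fun v => ?_)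
  change wt (-(1 / 2)) x • ψ v • chr x (-v) • symb (d := d) i v
    = ψ v • (wt (-(1 / 2)) x • (chr x (-v) • symb i v))
  rw [smul_comm]

theorem integrable_wt_neg (d : ℕ) : Integrable fun x : Eu d => wt (-((d + 1 : ℝ) / 2)) x := by
  have h := integrable_rpow_neg_one_add_norm_sq (E := Eu d) (μ := volume) (r := d + 1)
    (by simp)
  refine h.congr (Eventually.of_forall fun x => ?_)
  simp only [wt]; congr 1; ring

/-- The complexification as a linear functional. -/
def complexFunctional (T : RealDist d) : 𝓢(Eu d, ℂ) →ₗ[ℂ] ℂ where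
  toFun := complexPairing T
  map_add' a b := by simp only [complexPairing, map_add, Complex.ofReal_add]; ring
  map_smul' c a := by
    have h1 : SchwartzMap.postcompCLM Complex.reCLM (c • a)
        = c.re • SchwartzMap.postcompCLM Complex.reCLM a
          - c.im • SchwartzMap.postcompCLM Complex.imCLM a := by
      ext x; simp
    have h2 : SchwartzMap.postcompCLM Complex.imCLM (c • a)
        = c.re • SchwartzMap.postcompCLM Complex.imCLM a
          + c.im • SchwartzMap.postcompCLM Complex.reCLM a := by
      ext x; simp
    simp only [complexPairing, h1, h2, map_add, map_sub, map_smul, smul_eq_mul, RingHom.id_apply]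
    push_cast
    conv_rhs => rw [← Complex.re_add_im c]
    linear_combination (-(c.im : ℂ) * (T (SchwartzMap.postcompCLM Complex.imCLM a) : ℂ)) * Complex.I_sq

theorem hasCompactSupport_postcomp {F G : Type*} [NormedAddCommGroup F] [NormedSpace ℝ F]
    [NormedAddCommGroup G] [NormedSpace ℝ G] (L : F →L[ℝ] G) {φ : 𝓢(Eu d, F)}
    (hφ : HasCompactSupport φ) : HasCompactSupport (SchwartzMap.postcompCLM L φ) :=
  hφ.comp_left (g := L) (map_zero L)

theorem IsRapidlyDecreasing.exists_jet_bound {T : RealDist d} (hT : IsRapidlyDecreasing T) :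
    ∃ (m : ℕ) (C : ℝ), ∀ φ : 𝓢(Eu d, ℂ), ‖complexFunctional T φ‖ ≤ C * ‖jet d m φ‖ := by
  -- The exponent (d+2)/2 splits into (d+1)/2, which makes the weight integrable on ℝ^d, and 1/2,
  -- the weight of the jets.
  obtain ⟨m, C, hC0, hC⟩ := hT.exists_bound (d + 2)
  set A : ℝ := ∫ x : Eu d, wt (-((d + 1 : ℝ) / 2)) x
  have key : ∀ (φ : 𝓢(Eu d, ℂ)) (L : ℂ →L[ℝ] ℝ), ‖L‖ ≤ 1 → HasCompactSupport φ →
      |T (SchwartzMap.postcompCLM L φ)| ≤ C * ((m + 1) * (A * ‖jet d m φ‖)) := by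
    intro φ L hL hφ
    refine (hC _ (hasCompactSupport_postcomp L hφ)).trans (mul_le_mul_of_nonneg_left ?_ hC0)
    have : ∀ i ∈ Finset.range (m + 1), ∫ x, wt (-(((d + 2 : ℕ) : ℝ) / 2)) x
        * ‖iteratedFDeriv ℝ i (SchwartzMap.postcompCLM L φ) x‖ ≤ A * ‖jet d m φ‖ := by
      intro i hi
      rw [← integral_mul_const]
      refine integral_mono_of_nonneg (Eventually.of_forall fun x =>
        mul_nonneg (wt_pos _ _).le (norm_nonneg _)) ((integrable_wt_neg d).mul_const _)
        (Eventually.of_forall fun x => ?_)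
      have e : wt (-(((d + 2 : ℕ) : ℝ) / 2)) x
          = wt (-((d + 1 : ℝ) / 2)) x * wt (-(1 / 2)) x := by
        rw [← wt_add]; congr 1; push_cast; ring
      simp only
      rw [e, mul_assoc]
      refine mul_le_mul_of_nonneg_left ?_ (wt_pos _ _).le
      have h1 : ‖iteratedFDeriv ℝ i (SchwartzMap.postcompCLM L φ) x‖
          ≤ ‖iteratedFDeriv ℝ i φ x‖ := by
        refine (L.norm_iteratedFDeriv_comp_left (f := φ) (n := i) (N := i) (φ.contDiffAt i)
          le_rfl).trans (mul_le_of_le_one_left (norm_nonneg _) hL)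
      have h2 : wt (-(1 / 2)) x * ‖iteratedFDeriv ℝ i φ x‖
          = ‖jet d m φ ⟨i, Finset.mem_range.1 hi⟩ x‖ := by
        change _ = ‖wt (-(1 / 2)) x • iteratedFDeriv ℝ i φ x‖
        rw [norm_smul, Real.norm_of_nonneg (wt_pos _ _).le]
      calc _ ≤ wt (-(1 / 2)) x * ‖iteratedFDeriv ℝ i φ x‖ :=
            mul_le_mul_of_nonneg_left h1 (wt_pos _ _).le
        _ = _ := h2
        _ ≤ _ := (BoundedContinuousFunction.norm_coe_le_norm _ x).trans (norm_le_pi_norm (jet d m φ) ⟨i, Finset.mem_range.1 hi⟩)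
    calc _ ≤ ∑ i ∈ Finset.range (m + 1), A * ‖jet d m φ‖ := Finset.sum_le_sum this
      _ = _ := by rw [Finset.sum_const, Finset.card_range, nsmul_eq_mul]; push_cast; ring
  refine ⟨m, 2 * (C * ((m + 1) * A)), fun φ => ?_⟩
  obtain ⟨u, hu, hlim⟩ := exists_tendsto_compactSupport φ
  have hb : ∀ n, ‖complexPairing T (u n)‖ ≤ 2 * (C * ((m + 1) * A)) * ‖jet d m (u n)‖ := by
    intro n
    have h1 := key (u n) Complex.reCLM (by simp) (hu n)
    have h2 := key (u n) Complex.imCLM (by simp) (hu n)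
    rw [complexPairing]
    refine (norm_add_le _ _).trans ?_
    rw [norm_mul, Complex.norm_I, one_mul, Complex.norm_real, Complex.norm_real]
    calc _ ≤ _ := add_le_add h1 h2
      _ = _ := by ring
  exact le_of_tendsto_of_tendsto
    (((continuous_complexPairing T).norm.tendsto φ).comp hlim)
    ((((jet d m).continuous.norm.const_mul _).tendsto φ).comp hlim)
    (Eventually.of_forall hb)

/-- The Fourier transform of a distribution with rapid decrease is a continuous function. -/
theorem IsRapidlyDecreasing.exists_fourier {T : RealDist d} (hT : IsRapidlyDecreasing T) :
    ∃ g : Eu d → ℂ, Continuous g ∧ HasFourier T g := by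
  obtain ⟨m, C, hC⟩ := hT.exists_jet_bound
  let p : Subspace ℂ (JetSpace d m) := LinearMap.range (jet d m).toLinearMap
  let J : 𝓢(Eu d, ℂ) →ₗ[ℂ] p := (jet d m).toLinearMap.rangeRestrict
  have hJd : DenseRange J := (LinearMap.surjective_rangeRestrict _).denseRange
  have hb : ∃ C, ∀ φ, ‖complexFunctional T φ‖ ≤ C * ‖J φ‖ := ⟨C, hC⟩
  -- T is bounded by the jet norm, so it factors through the jets of Schwartz functions; Hahn–Banach
  -- extends it to all jets. The exponentials are not Schwartz, but Λ can be applied to their jets,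
  -- and this defines 𝓕T.
  obtain ⟨Λ, hΛ, -⟩ := exists_extension_norm_eq p ((complexFunctional T).extendOfNorm J)
  have hΛT : ∀ φ, Λ (jet d m φ) = complexPairing T φ := fun φ => by
    have h1 := hΛ (J φ)
    rw [LinearMap.extendOfNorm_eq hJd hb] at h1
    exact h1
  have hcont : Continuous fun v => Λ (expJet d m v) := Λ.continuous.comp (continuous_expJet m)
  refine ⟨fun v => Λ (expJet d m v), hcont, hcont.locallyIntegrable, fun ψ hψ => ?_⟩
  have hi : Integrable fun v => ψ v • expJet d m v :=
    (ψ.continuous.smul (continuous_expJet m)).integrable_of_hasCompactSupport hψ.smul_right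
  rw [← hΛT, jet_fourierS m ψ hψ, ← Λ.integral_comp_comm hi]
  refine integral_congr_ae (Eventually.of_forall fun v => ?_)
  simp [mul_comm]

end FourierOfRapidlyDecreasing

/-! ### The convolution φ * T̃ is a Schwartz function. -/

section ConvTilde

variable {d : ℕ}

open scoped LineDeriv

theorem fourierS_lineDerivOp (ψ : 𝓢(Eu d, ℂ)) (m ξ : Eu d) :
    fourierS (∂_{m} ψ) ξ = Complex.I * (inner ℝ ξ m : ℝ) * fourierS ψ ξ := by
  have hg : (inner ℝ · m : Eu d → ℝ).HasTemperateGrowth :=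
    ((innerSL ℝ).flip m).hasTemperateGrowth
  have h1 : fourierS (∂_{m} ψ) ξ = (𝓕 (∂_{m} ψ)) (dilation d ξ) := rfl
  have h2 : fourierS ψ ξ = (𝓕 ψ) (dilation d ξ) := rfl
  rw [h1, h2, SchwartzMap.fourier_lineDerivOp_eq, smul_apply,
    SchwartzMap.smulLeftCLM_apply_apply hg]
  have h3 : (inner ℝ (dilation d ξ) m : ℝ) = (2 * Real.pi)⁻¹ * inner ℝ ξ m :=
    real_inner_smul_left _ _ _
  have : (Real.pi : ℂ) ≠ 0 := by exact_mod_cast Real.pi_ne_zero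
  rw [h3, smul_eq_mul, Complex.real_smul]
  push_cast; field_simp

theorem ofR_lineDerivOp (φ : 𝓢(Eu d, ℝ)) (m : Eu d) : ofR (∂_{m} φ) = ∂_{m} (ofR φ) := by
  ext x
  have h := (Complex.ofRealCLM.hasFDerivAt.comp x (φ.differentiableAt (x := x)).hasFDerivAt).fderiv
  rw [SchwartzMap.lineDerivOp_apply_eq_fderiv]
  change _ = fderiv ℝ (Complex.ofRealCLM ∘ φ) x m
  rw [h]
  simp [SchwartzMap.lineDerivOp_apply_eq_fderiv]

theorem HasFourier.convTilde_eq {T : RealDist d} {g : Eu d → ℂ} (hT : HasFourier T g) {C : ℝ}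
    (hC : ∀ ξ, ‖g ξ‖ ≤ C) (φ : 𝓢(Eu d, ℝ)) (y : Eu d) :
    (convTilde T φ y : ℂ) = ∫ ξ, chr y ξ • (cst d * (g (-ξ) * fourierS (ofR φ) ξ)) := by
  rw [convTilde, ← complexPairing_ofR, hT.pairing_eq hC, ← integral_const_mul,
    ← integral_neg_eq_self]
  refine integral_congr_ae (Eventually.of_forall fun ξ => ?_)
  simp only [neg_neg, fourierS_ofR_translate, smul_eq_mul, chr_comm ξ y]
  ring

/-- The convolution is an inverse Fourier integral whose symbol has an integrable first moment, so
it may be differentiated under the integral. The factor iξ_j turns 𝓕φ into 𝓕(∂_jφ), hence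
derivatives keep the form of a convolution with T̃. -/
theorem hasFDerivAt_convTilde {T : RealDist d} {g : Eu d → ℂ} (hg : Continuous g)
    (hT : HasFourier T g) {C : ℝ} (hC : ∀ ξ, ‖g ξ‖ ≤ C) (φ : 𝓢(Eu d, ℝ)) (y : Eu d) :
    HasFDerivAt (convTilde T φ) (∑ j, convTilde T (∂_{EuclideanSpace.basisFun (Fin d) ℝ j} φ) y •
      (EuclideanSpace.proj j : Eu d →L[ℝ] ℝ)) y := by
  set a : Eu d → ℂ := fun ξ => cst d * (g (-ξ) * fourierS (ofR φ) ξ) with ha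
  have hac : Continuous a := by
    have := (fourierS (ofR φ)).continuous
    fun_prop
  have hb : ∀ ξ, ‖a ξ‖ ≤ cst d * C * ‖fourierS (ofR φ) ξ‖ := fun ξ => by
    rw [ha]; simp only
    rw [norm_mul, norm_mul, Complex.norm_real, Real.norm_of_nonneg (cst_pos d).le, mul_assoc]
    have := hC (-ξ)
    have := (cst_pos d).le
    gcongr
  have hi : Integrable a := ((fourierS (ofR φ)).integrable.norm.const_mul _).mono'
    hac.aestronglyMeasurable (Eventually.of_forall hb)
  have hi1 : Integrable fun ξ => ‖ξ‖ * ‖a ξ‖ := by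
    have h := ((fourierS (ofR φ)).integrable_pow_mul volume 1).const_mul (cst d * C)
    refine h.mono' (by fun_prop) (Eventually.of_forall fun ξ => ?_)
    rw [norm_mul, norm_norm, norm_norm, pow_one]
    calc _ ≤ ‖ξ‖ * (cst d * C * ‖fourierS (ofR φ) ξ‖) := by gcongr; exact hb ξ
      _ = _ := by ring
  have h1 := VectorFourier.hasFDerivAt_fourierIntegral (-innerForm d) hi hi1 y
  have e1 : convTilde T φ = Complex.reCLM ∘ VectorFourier.fourierIntegral Real.fourierChar volume
      (-innerForm d).toLinearMap₁₂ a := by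
    ext z
    rw [Function.comp_apply, vectorFourierIntegral_neg_eq, ← hT.convTilde_eq hC φ z]
    simp
  have hi2 : Integrable fun v => chr y v • VectorFourier.fourierSMulRight (-innerForm d) a v := by
    have h2 : Integrable fun v => VectorFourier.fourierSMulRight (-innerForm d) a v := by
      refine (hi1.const_mul (2 * Real.pi * ‖-innerForm d‖)).mono'
        hi.aestronglyMeasurable.fourierSMulRight (Eventually.of_forall fun v => ?_)
      exact (VectorFourier.norm_fourierSMulRight_le _ _ _).trans_eq (by ring)
    have h3 : Continuous fun v : Eu d => chr y v := by fun_prop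
    refine h2.mono (h3.aestronglyMeasurable.smul h2.1)
      (Eventually.of_forall fun x => ?_)
    rw [norm_smul, norm_chr, one_mul]
  rw [e1]
  refine (Complex.reCLM.hasFDerivAt.comp y h1).congr_fderiv ?_
  rw [vectorFourierIntegral_neg_eq]
  refine ContinuousLinearMap.coe_injective
    ((EuclideanSpace.basisFun (Fin d) ℝ).toBasis.ext fun j => ?_)
  set e := EuclideanSpace.basisFun (Fin d) ℝ with he
  have hr : (((∑ j, convTilde T (∂_{e j} φ) y • (EuclideanSpace.proj j : Eu d →L[ℝ] ℝ) :
      Eu d →L[ℝ] ℝ) : Eu d →ₗ[ℝ] ℝ) (e.toBasis j)) = convTilde T (∂_{e j} φ) y := by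
    simp [he]
  rw [hr]
  let ev : (Eu d →L[ℝ] ℂ) →L[ℝ] ℂ := ContinuousLinearMap.apply ℝ ℂ (e j)
  have hl : ((∫ v, chr y v • VectorFourier.fourierSMulRight (-innerForm d) a v) : Eu d →L[ℝ] ℂ)
      (e j) = convTilde T (∂_{e j} φ) y := by
    change ev _ = _
    rw [← ev.integral_comp_comm hi2, hT.convTilde_eq hC]
    refine integral_congr_ae (Eventually.of_forall fun v => ?_)
    change chr y v • (-(2 * Real.pi * Complex.I) • (-innerForm d) v (e j) • a v) = _
    simp only [ofR_lineDerivOp, fourierS_lineDerivOp]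
    have h3 : ((-innerForm d) v (e j) : ℝ) = -((2 * Real.pi)⁻¹ * inner ℝ v (e j)) := rfl
    have : (Real.pi : ℂ) ≠ 0 := by exact_mod_cast Real.pi_ne_zero
    rw [h3, ha]
    simp only [smul_eq_mul, Complex.real_smul]
    push_cast; field_simp
  have h4 := congrArg Complex.re hl
  rw [Complex.ofReal_re] at h4
  rw [← h4]
  simp

/-- Peetre's inequality trades the decay in x for decay in y. The remaining weight sits at x + y, in
the compact support of φ. -/
theorem IsRapidlyDecreasing.exists_convTilde_bound {T : RealDist d} (hT : IsRapidlyDecreasing T)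
    {φ : 𝓢(Eu d, ℝ)} (hφ : HasCompactSupport φ) (k : ℕ) :
    ∃ C : ℝ, ∀ y, ‖convTilde T φ y‖ ≤ C * wt (-(k / 2 : ℝ)) y := by
  obtain ⟨m, C, hC0, hC⟩ := hT.exists_bound k
  refine ⟨C * ∑ i ∈ Finset.range (m + 1), 2 ^ (k / 2 : ℝ) *
    ∫ x, wt (k / 2 : ℝ) x * ‖iteratedFDeriv ℝ i φ x‖, fun y => ?_⟩
  have hcs : HasCompactSupport (translate y φ) := by
    have := hφ.comp_homeomorph (Homeomorph.addRight y)
    convert this using 1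
    ext x; simp [translate_apply]
  rw [convTilde, Real.norm_eq_abs]
  refine (hC _ hcs).trans ?_
  rw [mul_assoc, Finset.sum_mul]
  refine mul_le_mul_of_nonneg_left (Finset.sum_le_sum fun i _ => ?_) hC0
  have e : ∀ x, iteratedFDeriv ℝ i (translate y φ) x = iteratedFDeriv ℝ i φ (x + y) := fun x => by
    have : ⇑(translate y φ) = fun x => φ (x + y) := funext fun x => translate_apply y φ x
    rw [this, iteratedFDeriv_comp_add_right]
  simp_rw [e]
  have hs := integrable_wt_mul_iteratedFDeriv φ hφ (k / 2 : ℝ) i 0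
  simp only [add_zero] at hs
  have hs' := hs.comp_add_right y
  calc ∫ x, wt (-(k / 2 : ℝ)) x * ‖iteratedFDeriv ℝ i φ (x + y)‖
      ≤ ∫ x, 2 ^ (k / 2 : ℝ) * wt (-(k / 2 : ℝ)) y *
          (wt (k / 2 : ℝ) (x + y) * ‖iteratedFDeriv ℝ i φ (x + y)‖) := by
        refine integral_mono (integrable_wt_mul_iteratedFDeriv φ hφ _ i y) (hs'.const_mul _)
          fun x => ?_
        rw [← mul_assoc]
        exact mul_le_mul_of_nonneg_right (wt_peetre (by positivity) x y) (norm_nonneg _)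
    _ = _ := by
        rw [integral_const_mul,
          integral_add_right_eq_self (fun x => wt (k / 2 : ℝ) x * ‖iteratedFDeriv ℝ i φ x‖) y]
        ring

theorem hasCompactSupport_lineDerivOp {φ : 𝓢(Eu d, ℝ)} (hφ : HasCompactSupport φ) (m : Eu d) :
    HasCompactSupport (∂_{m} φ : 𝓢(Eu d, ℝ)) :=
  hφ.mono' ((subset_tsupport _).trans (SchwartzMap.tsupport_lineDerivOp_subset m φ))

theorem IsRapidlyDecreasing.convTilde_smooth_decay {T : RealDist d} (hT : IsRapidlyDecreasing T)
    {g : Eu d → ℂ} (hg : Continuous g) (hTg : HasFourier T g) {C : ℝ} (hC : ∀ ξ, ‖g ξ‖ ≤ C)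
    (n : ℕ) : ∀ φ : 𝓢(Eu d, ℝ), HasCompactSupport φ → ContDiff ℝ n (convTilde T φ) ∧
      ∀ k : ℕ, ∃ B : ℝ, ∀ y, ‖iteratedFDeriv ℝ n (convTilde T φ) y‖ ≤ B * wt (-(k / 2 : ℝ)) y := by
  induction n with
  | zero =>
    refine fun φ hφ => ⟨contDiff_zero.2 ?_, fun k => ?_⟩
    · exact continuous_iff_continuousAt.2 fun y =>
        (hasFDerivAt_convTilde hg hTg hC φ y).continuousAt
    · simpa using hT.exists_convTilde_bound hφ k
  | succ n ih =>
    intro φ hφ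
    have hd := fun y => hasFDerivAt_convTilde hg hTg hC φ y
    have hf : fderiv ℝ (convTilde T φ) = fun y => ∑ j,
        convTilde T (∂_{EuclideanSpace.basisFun (Fin d) ℝ j} φ) y •
          (EuclideanSpace.proj j : Eu d →L[ℝ] ℝ) := funext fun y => (hd y).fderiv
    have ih' := fun j => ih (∂_{EuclideanSpace.basisFun (Fin d) ℝ j} φ)
      (hasCompactSupport_lineDerivOp hφ _)
    have hs : ∀ j, ContDiff ℝ n fun y => convTilde T (∂_{EuclideanSpace.basisFun (Fin d) ℝ j} φ) y •
          (EuclideanSpace.proj j : Eu d →L[ℝ] ℝ) := fun j => (ih' j).1.smul contDiff_const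
    refine ⟨?_, fun k => ?_⟩
    · rw [Nat.cast_succ, contDiff_succ_iff_fderiv]
      refine ⟨fun y => (hd y).differentiableAt, by simp, ?_⟩
      rw [hf]
      exact ContDiff.sum fun j _ => hs j
    · choose B hB using fun j => (ih' j).2 k
      refine ⟨∑ j, ‖(EuclideanSpace.proj j : Eu d →L[ℝ] ℝ)‖ * B j, fun y => ?_⟩
      rw [← norm_iteratedFDeriv_fderiv, hf,
        iteratedFDeriv_fun_sum_apply (fun j _ => (hs j).contDiffAt), Finset.sum_mul]
      refine (norm_sum_le _ _).trans (Finset.sum_le_sum fun j _ => ?_)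
      have hL := ((ContinuousLinearMap.id ℝ ℝ).smulRight
        (EuclideanSpace.proj j : Eu d →L[ℝ] ℝ)).norm_iteratedFDeriv_comp_left
          (n := n) (N := n) ((ih' j).1.contDiffAt (x := y)) le_rfl
      rw [mul_assoc]
      refine (le_trans hL ?_).trans (mul_le_mul_of_nonneg_left (hB j y) (norm_nonneg _))
      refine mul_le_mul_of_nonneg_right ?_ (norm_nonneg _)
      rw [ContinuousLinearMap.norm_smulRight_apply]
      exact mul_le_of_le_one_left (norm_nonneg _) ContinuousLinearMap.norm_id_le

/-- The function `φ * T̃` is a Schwartz function with Fourier transform `𝓕φ(ξ) 𝓕T(-ξ)`. -/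
theorem IsRapidlyDecreasing.exists_convTilde {T : RealDist d} (hT : IsRapidlyDecreasing T)
    {g : Eu d → ℂ} (hg : Continuous g) (hTg : HasFourier T g) {C : ℝ} (hC : ∀ ξ, ‖g ξ‖ ≤ C)
    {φ : 𝓢(Eu d, ℝ)} (hφ : HasCompactSupport φ) :
    ∃ ψ : 𝓢(Eu d, ℝ), ⇑ψ = convTilde T φ ∧
      ∀ ξ, fourierS (ofR ψ) ξ = g (-ξ) * fourierS (ofR φ) ξ := by
  have h := fun n => hT.convTilde_smooth_decay hg hTg hC n φ hφ
  let ψ : 𝓢(Eu d, ℝ) :=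
    { toFun := convTilde T φ
      smooth' := contDiff_infty.2 fun n => (h n).1
      decay' := fun k n => by
        obtain ⟨B, hB⟩ := (h n).2 k
        have hB0 : 0 ≤ B := by
          have := (norm_nonneg _).trans (hB 0)
          exact nonneg_of_mul_nonneg_left this (wt_pos _ _)
        refine ⟨B, fun y => ?_⟩
        calc _ ≤ ‖y‖ ^ k * (B * wt (-(k / 2 : ℝ)) y) := by gcongr; exact hB y
          _ = B * (‖y‖ ^ k * wt (-(k / 2 : ℝ)) y) := by ring
          _ ≤ B := mul_le_of_le_one_right hB0 (norm_pow_mul_wt_le k y) }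
  refine ⟨ψ, rfl, fun ξ => ?_⟩
  set b : Eu d → ℂ := fun ξ => g (-ξ) * fourierS (ofR φ) ξ with hbdef
  have hbc : Continuous b := by
    have := (fourierS (ofR φ)).continuous
    fun_prop
  have hbi : Integrable b := (fourierS (ofR φ)).integrable.bdd_mul (c := C)
    (Continuous.aestronglyMeasurable (by fun_prop)) (Eventually.of_forall fun ξ => hC _)
  let b' : Eu d → ℂ := fun v => b ((2 * Real.pi) • v)
  have hinv : 𝓕⁻ b' = ofR ψ := by
    ext y
    change _ = ((convTilde T φ y : ℝ) : ℂ)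
    rw [hTg.convTilde_eq hC, Real.fourierInv_eq']
    have : ∀ v : Eu d, Complex.exp (↑(2 * Real.pi * inner ℝ v y) * Complex.I)
        • b' v = (fun x => chr y x * b x) ((2 * Real.pi) • v) := by
      intro v; rw [fourierChar_eq_chr, smul_eq_mul]
    simp_rw [this]
    rw [integral_comp_two_pi_smul (fun x => chr y x * b x), Complex.real_smul,
      ← integral_const_mul]
    refine integral_congr_ae (Eventually.of_forall fun ξ => ?_)
    simp only [hbdef, smul_eq_mul]; ring
  have hb'i : Integrable b' := hbi.comp_smul (by positivity)
  -- Fourier inversion requires the transform of b' to be integrable; up to reflection it is the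
  -- Schwartz function ψ.
  have hF : 𝓕 (𝓕⁻ b') = b' := by
    refine Continuous.fourier_fourierInv_eq (by fun_prop) hb'i ?_
    have e : 𝓕 b' = fun y => 𝓕⁻ b' (-y) := by
      ext y; rw [Real.fourierInv_eq_fourier_neg, neg_neg]
    rw [e, hinv]
    exact (ofR ψ).integrable.comp_neg
  have h1 : fourierS (ofR ψ) ξ = (𝓕 (⇑(ofR ψ))) (dilation d ξ) := rfl
  rw [h1, ← hinv, hF]
  change b ((2 * Real.pi) • ((2 * Real.pi)⁻¹ • ξ)) = _
  rw [smul_smul, mul_inv_cancel₀ (by positivity), one_smul]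

end ConvTilde

/-! ### Plancherel between L²(μ) and L²(ℝ^d). -/

section SpectralMeasure

variable {d : ℕ} {h : Eu d → ℂ}

theorem spectralMeasure_eq (h : Eu d → ℂ) : spectralMeasure h
    = ENNReal.ofReal (cst d) • volume.withDensity fun ξ => ‖h ξ‖ₑ ^ 2 := rfl

theorem ofReal_cst_ne_zero (d : ℕ) : ENNReal.ofReal (cst d) ≠ 0 := by
  simpa using cst_pos d

instance : SigmaFinite (spectralMeasure h) := by
  have : SigmaFinite (volume.withDensity fun ξ => ‖h ξ‖ₑ ^ 2) :=
    SigmaFinite.withDensity_of_ne_top (Eventually.of_forall fun ξ => by finiteness)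
  rw [spectralMeasure_eq, ENNReal.ofReal, ← ENNReal.smul_def]
  infer_instance

theorem lintegral_spectralMeasure (hh : Measurable h) (f : Eu d → ℝ≥0∞) :
    ∫⁻ ξ, f ξ ∂(spectralMeasure h) = ENNReal.ofReal (cst d) * ∫⁻ ξ, ‖h ξ‖ₑ ^ 2 * f ξ := by
  rw [spectralMeasure_eq, lintegral_smul_measure,
    lintegral_withDensity_eq_lintegral_mul_non_measurable _ (by fun_prop)
      (Eventually.of_forall fun ξ => by finiteness)]
  rfl

/-- The measure μ does not see the zeros of h, so identities between classes in L²(μ) carry the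
guard `h ξ ≠ 0`, which multiplication by h removes. -/
theorem ae_spectralMeasure_iff (hh : Measurable h) {p : Eu d → Prop} :
    (∀ᵐ ξ ∂(spectralMeasure h), p ξ) ↔ ∀ᵐ ξ, h ξ ≠ 0 → p ξ := by
  rw [spectralMeasure_eq, Measure.ae_ennreal_smul_measure_iff (ofReal_cst_ne_zero d),
    ae_withDensity_iff (by fun_prop)]
  simp

theorem mul_ae_eq_of_ae_spectralMeasure (hh : Measurable h) {u v : Eu d → ℂ}
    (huv : u =ᵐ[spectralMeasure h] v) : (fun ξ => h ξ * u ξ) =ᵐ[volume] fun ξ => h ξ * v ξ := by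
  filter_upwards [(ae_spectralMeasure_iff hh).1 huv] with ξ hξ
  by_cases h0 : h ξ = 0
  · simp [h0]
  · rw [hξ h0]

theorem spectralMeasure_absolutelyContinuous (h : Eu d → ℂ) :
    spectralMeasure h ≪ volume :=
  (withDensity_absolutelyContinuous _ _).smul_left _

theorem quasiMeasurePreserving_two_pi_smul (d : ℕ) :
    Measure.QuasiMeasurePreserving (fun η : Eu d => (2 * Real.pi) • η) :=
  ⟨by fun_prop, by
    rw [Measure.map_addHaar_smul _ (by positivity)]
    exact Measure.smul_absolutelyContinuous⟩

theorem lintegral_comp_two_pi_smul {f : Eu d → ℝ≥0∞} (hf : AEMeasurable f) :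
    ∫⁻ η, f ((2 * Real.pi) • η) = ENNReal.ofReal (cst d) * ∫⁻ ξ, f ξ := by
  have hm := Measure.map_addHaar_smul (volume : Measure (Eu d)) (r := 2 * Real.pi) (by positivity)
  rw [finrank_euclideanSpace_fin, abs_of_nonneg (by positivity)] at hm
  rw [← lintegral_map' (f := f) (g := fun η : Eu d => (2 * Real.pi) • η), hm,
    lintegral_smul_measure]
  · rfl
  · rw [hm]; exact hf.smul_measure _
  · fun_prop

theorem aestronglyMeasurable_mul_Lp (hh : Measurable h) (w : Lp ℂ 2 (spectralMeasure h)) :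
    AEStronglyMeasurable (fun ξ => h ξ * w ξ) volume :=
  hh.aestronglyMeasurable.mul (Lp.stronglyMeasurable w).aestronglyMeasurable

/-- The factor (2π)^{-d} in μ is the Jacobian of η ↦ 2πη, the passage between the two normalizations
of the Fourier transform; no constant remains. -/
theorem lintegral_comp_mul_Lp (hh : Measurable h) (w : Lp ℂ 2 (spectralMeasure h)) :
    ∫⁻ η, ‖h ((2 * Real.pi) • η) * w ((2 * Real.pi) • η)‖ₑ ^ 2 = ‖w‖ₑ ^ 2 := by
  rw [lintegral_comp_two_pi_smul (f := fun ξ => ‖h ξ * w ξ‖ₑ ^ 2)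
    ((aestronglyMeasurable_mul_Lp hh w).enorm.pow_const 2), enorm_Lp_sq,
    lintegral_spectralMeasure hh]
  simp [mul_pow]

theorem memLp_comp_mul_Lp (hh : Measurable h) (w : Lp ℂ 2 (spectralMeasure h)) :
    MemLp (fun η => h ((2 * Real.pi) • η) * w ((2 * Real.pi) • η)) 2 := by
  refine (memLp_two_iff_lintegral ?_).2 ?_
  · exact (aestronglyMeasurable_mul_Lp hh w).comp_quasiMeasurePreserving
      (quasiMeasurePreserving_two_pi_smul d)
  · rw [lintegral_comp_mul_Lp hh w]; finiteness

/-- The isometry `w ↦ (h w)(2π·)` from `L²(μ)` to `L²(ℝ^d)`. -/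
def spectralToL2 (hh : Measurable h) :
    Lp ℂ 2 (spectralMeasure h) →ₗᵢ[ℝ] Lp ℂ 2 (volume : Measure (Eu d)) where
  toFun w := (memLp_comp_mul_Lp hh w).toLp
  map_add' w w' := by
    rw [← MemLp.toLp_add]
    refine MemLp.toLp_congr _ _ ?_
    filter_upwards [(quasiMeasurePreserving_two_pi_smul d).ae
      (mul_ae_eq_of_ae_spectralMeasure hh (Lp.coeFn_add w w'))] with η hη
    simpa [mul_add] using hη
  map_smul' c w := by
    rw [RingHom.id_apply, ← MemLp.toLp_const_smul]
    refine MemLp.toLp_congr _ _ ?_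
    filter_upwards [(quasiMeasurePreserving_two_pi_smul d).ae
      (mul_ae_eq_of_ae_spectralMeasure hh (Lp.coeFn_smul c w))] with η hη
    simp only [Pi.smul_apply, Complex.real_smul] at hη ⊢
    rw [hη]; ring
  norm_map' w := by
    rw [← toReal_enorm, ← toReal_enorm]
    congr 1
    refine (ENNReal.pow_right_strictMono two_ne_zero).injective ?_
    change ‖(memLp_comp_mul_Lp hh w).toLp‖ₑ ^ 2 = ‖w‖ₑ ^ 2
    rw [enorm_toLp_sq, lintegral_comp_mul_Lp hh]

theorem coeFn_spectralToL2 (hh : Measurable h) (w : Lp ℂ 2 (spectralMeasure h)) :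
    spectralToL2 hh w =ᵐ[volume] fun η => h ((2 * Real.pi) • η) * w ((2 * Real.pi) • η) :=
  (memLp_comp_mul_Lp hh w).coeFn_toLp

/-- The inverse Fourier transform of `h w`, as an element of complex `L²`. -/
def spectralInv (hh : Measurable h) :
    Lp ℂ 2 (spectralMeasure h) →ₗᵢ[ℝ] Lp ℂ 2 (volume : Measure (Eu d)) :=
  { toFun := fun w => 𝓕⁻ (spectralToL2 hh w)
    map_add' := fun w w' => by rw [map_add, FourierTransform.fourierInv_add]
    map_smul' := fun c w => by
      have e : ∀ u : Lp ℂ 2 (volume : Measure (Eu d)), c • u = (c : ℂ) • u := fun u => rfl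
      rw [map_smul, RingHom.id_apply, e, e, FourierTransform.fourierInv_smul]
    norm_map' := fun w =>
      ((Lp.fourierTransformₗᵢ (Eu d) ℂ).symm.norm_map _).trans ((spectralToL2 hh).norm_map w) }

theorem integral_spectralInv (hh : Measurable h) (w : Lp ℂ 2 (spectralMeasure h))
    (Φ : 𝓢(Eu d, ℂ)) :
    ∫ x, Φ x * spectralInv hh w x = cst d * ∫ ξ, h ξ * w ξ * fourierS Φ (-ξ) := by
  have h1 := DFunLike.congr_fun
    (Lp.fourierInv_toTemperedDistribution_eq (spectralToL2 hh w)) Φ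
  rw [TemperedDistribution.fourierInv_apply, Lp.toTemperedDistribution_apply,
    Lp.toTemperedDistribution_apply] at h1
  change _ = ∫ x, Φ x • spectralInv hh w x at h1
  simp only [smul_eq_mul] at h1
  rw [← h1, ← Complex.real_smul,
    ← integral_comp_two_pi_smul (fun ξ => h ξ * w ξ * fourierS Φ (-ξ))]
  refine integral_congr_ae ?_
  filter_upwards [coeFn_spectralToL2 hh w] with η hη
  rw [hη, mul_comm]
  congr 1
  have h2 : fourierS Φ (-((2 * Real.pi) • η)) = 𝓕 Φ ((2 * Real.pi)⁻¹ • -((2 * Real.pi) • η)) := rfl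
  rw [h2, smul_neg, smul_smul, inv_mul_cancel₀ (by positivity), one_smul,
    SchwartzMap.fourierInv_apply_eq]
  rfl

/-- The real part of the inverse Fourier transform of `h w`. -/
def spectralKernel (hh : Measurable h) :
    Lp ℂ 2 (spectralMeasure h) →L[ℝ] Lp ℝ 2 (volume : Measure (Eu d)) :=
  (Complex.reCLM.compLpL 2 volume).comp (spectralInv hh).toContinuousLinearMap

theorem coeFn_spectralKernel (hh : Measurable h) (w : Lp ℂ 2 (spectralMeasure h)) :
    spectralKernel hh w =ᵐ[volume] fun x => (spectralInv hh w x).re :=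
  Complex.reCLM.coeFn_compLpL (spectralInv hh w)

theorem integrable_schwartz_mul_Lp {F : Type*} [NormedRing F] [NormedSpace ℝ F] (Φ : 𝓢(Eu d, F))
    (f : Lp F 2 (volume : Measure (Eu d))) : Integrable fun x => Φ x * f x :=
  (Φ.memLp 2).integrable_mul (Lp.memLp f)

theorem integral_spectralKernel (hh : Measurable h) (w : Lp ℂ 2 (spectralMeasure h))
    (φ : 𝓢(Eu d, ℝ)) :
    ∫ x, φ x * spectralKernel hh w x = (cst d * ∫ ξ, h ξ * w ξ * fourierS (ofR φ) (-ξ)).re := by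
  rw [← integral_spectralInv hh w (ofR φ)]
  have h1 := Complex.reCLM.integral_comp_comm (integrable_schwartz_mul_Lp (ofR φ) (spectralInv hh w))
  rw [Complex.reCLM_apply] at h1
  rw [← h1]
  refine integral_congr_ae ?_
  filter_upwards [coeFn_spectralKernel hh w] with x hx
  rw [hx]
  simp

/-- Recognizes a locally integrable function from its pairings with test functions. Square
integrability is a consequence, not an assumption. -/
theorem ae_eq_spectralKernel (hh : Measurable h) (w : Lp ℂ 2 (spectralMeasure h))
    {γ : Eu d → ℝ} (hγ : LocallyIntegrable γ) (hp : ∀ φ : 𝓢(Eu d, ℝ), HasCompactSupport φ →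
      ((∫ x, γ x * φ x : ℝ) : ℂ) = cst d * ∫ ξ, h ξ * w ξ * fourierS (ofR φ) (-ξ)) :
    γ =ᵐ[volume] spectralKernel hh w := by
  refine ae_eq_of_integral_contDiff_smul_eq hγ
    ((Lp.memLp _).locallyIntegrable (by norm_num)) fun ψ hψ hc => ?_
  have h1 := integral_spectralKernel hh w (hc.toSchwartzMap hψ)
  rw [← hp (hc.toSchwartzMap hψ) hc, Complex.ofReal_re] at h1
  simp only [smul_eq_mul]
  refine Eq.trans ?_ h1.symm
  exact integral_congr_ae (Eventually.of_forall fun x => mul_comm _ _)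

theorem integral_comp_neg_eq {F : Type*} [NormedAddCommGroup F] [NormedSpace ℝ F]
    (f : Eu d → F) : ∫ x, f (-x) = ∫ x, f x := integral_neg_eq_self f volume

/-- If h and w are both Hermitian, the pairing with a real test function equals its own conjugate.
Thus the real part taken in `spectralKernel` loses no norm. -/
theorem spectralInv_im (hh : Measurable h) (hH : ∀ᵐ ξ, h (-ξ) = starRingEnd ℂ (h ξ))
    {w : Lp ℂ 2 (spectralMeasure h)}
    (hw : ∀ᵐ ξ, h ξ ≠ 0 → w (-ξ) = starRingEnd ℂ (w ξ)) :
    ∀ᵐ x, (spectralInv hh w x).im = 0 := by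
  have hi : LocallyIntegrable fun x => (spectralInv hh w x).im :=
    (Complex.imCLM.comp_memLp (spectralInv hh w)).locallyIntegrable (by norm_num)
  refine ae_eq_of_integral_contDiff_smul_eq hi (locallyIntegrable_const 0) fun ψ hψ hc => ?_
  set φ : 𝓢(Eu d, ℝ) := hc.toSchwartzMap hψ with hφ
  have h1 := integral_spectralInv hh w (ofR φ)
  have h2 : starRingEnd ℂ (∫ ξ, h ξ * w ξ * fourierS (ofR φ) (-ξ))
      = ∫ ξ, h ξ * w ξ * fourierS (ofR φ) (-ξ) := by
    rw [← integral_conj, ← integral_comp_neg_eq (fun ξ => h ξ * w ξ * fourierS (ofR φ) (-ξ))]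
    refine integral_congr_ae ?_
    filter_upwards [hH, hw] with ξ h1 h2
    simp only [neg_neg, map_mul]
    rw [conj_fourierS_ofR, neg_neg, h1]
    by_cases h0 : h ξ = 0
    · simp [h0]
    · rw [h2 h0]
  have h3 := Complex.imCLM.integral_comp_comm
    (integrable_schwartz_mul_Lp (ofR φ) (spectralInv hh w))
  rw [h1, Complex.imCLM_apply, Complex.im_ofReal_mul, Complex.conj_eq_iff_im.1 h2, mul_zero] at h3
  simp only [smul_zero, integral_zero]
  rw [← h3]
  exact integral_congr_ae (Eventually.of_forall fun x => by simp [hφ])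

theorem enorm_spectralKernel (hh : Measurable h) (hH : ∀ᵐ ξ, h (-ξ) = starRingEnd ℂ (h ξ))
    {w : Lp ℂ 2 (spectralMeasure h)}
    (hw : ∀ᵐ ξ, h ξ ≠ 0 → w (-ξ) = starRingEnd ℂ (w ξ)) :
    ‖spectralKernel hh w‖ₑ = ‖w‖ₑ := by
  have h1 : ‖spectralKernel hh w‖ₑ = ‖spectralInv hh w‖ₑ := by
    refine (ENNReal.pow_right_strictMono two_ne_zero).injective ?_
    beta_reduce
    rw [enorm_Lp_sq, enorm_Lp_sq]
    refine lintegral_congr_ae ?_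
    filter_upwards [coeFn_spectralKernel hh w, spectralInv_im hh hH hw] with x h2 h3
    rw [h2]
    congr 1
    conv_rhs => rw [← Complex.re_add_im (spectralInv hh w x), h3]
    simp [← ofReal_norm]
  rw [h1, ← ofReal_norm, LinearIsometry.norm_map, ofReal_norm]

end SpectralMeasure

/-! ### The kernel κ and the transform of ψ * κ. -/

section Kernel

variable {d : ℕ} {κ : Eu d → ℝ≥0∞} {h : Eu d → ℂ}

theorem ofReal_inv_pow_eq_wt (k : ℕ) (x : Eu d) :
    ((1 + ‖x‖ ^ 2) ^ k)⁻¹ = wt (-(k : ℝ)) x := by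
  rw [wt, Real.rpow_neg (by positivity), Real.rpow_natCast]

theorem wt_neg_arg (s : ℝ) (x : Eu d) : wt s (-x) = wt s x := by simp [wt]

theorem IsTempered.exists_integrable {u : Eu d → ℝ≥0∞} (hu : IsTempered u) :
    ∃ k : ℕ, Integrable fun x => (u x).toReal * wt (-(k : ℝ)) x := by
  obtain ⟨hm, k, hk⟩ := hu
  refine ⟨k, ?_⟩
  have h1 := integrable_toReal_of_lintegral_ne_top (by fun_prop) hk.ne
  refine h1.congr (Eventually.of_forall fun x => ?_)
  simp only
  rw [ENNReal.toReal_mul, ENNReal.toReal_ofReal (by positivity), ofReal_inv_pow_eq_wt]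

theorem exists_le_wt {F : Type*} [NormedAddCommGroup F] [NormedSpace ℝ F] (Φ : 𝓢(Eu d, F))
    (k : ℕ) : ∃ A : ℝ, 0 ≤ A ∧ ∀ x, ‖Φ x‖ ≤ A * wt (-(k : ℝ)) x := by
  have h1 := SchwartzMap.one_add_le_sup_seminorm_apply (𝕜 := ℝ) (m := (2 * k, 0)) (k := 2 * k)
    (n := 0) le_rfl le_rfl Φ
  set A := 2 ^ (2 * k, 0).1 * ((Finset.Iic (2 * k, 0)).sup
    fun m => SchwartzMap.seminorm ℝ m.1 m.2) Φ
  refine ⟨A, (by positivity : 0 ≤ (1 + ‖(0 : Eu d)‖) ^ (2 * k)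
    * ‖iteratedFDeriv ℝ 0 Φ 0‖).trans (h1 0), fun x => ?_⟩
  have h2 := h1 x
  rw [norm_iteratedFDeriv_zero] at h2
  have h3 : wt (k : ℝ) x ≤ (1 + ‖x‖) ^ (2 * k) := by
    rw [wt, Real.rpow_natCast, pow_mul]
    exact pow_le_pow_left₀ (by positivity) (by nlinarith [norm_nonneg x]) _
  calc ‖Φ x‖ = (wt (k : ℝ) x * ‖Φ x‖) * wt (-(k : ℝ)) x := by
        rw [mul_right_comm, wt_neg_mul, one_mul]
    _ ≤ A * wt (-(k : ℝ)) x := by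
        refine mul_le_mul_of_nonneg_right (le_trans ?_ h2) (wt_pos _ _).le
        exact mul_le_mul_of_nonneg_right h3 (norm_nonneg _)

theorem locallyIntegrable_of_wt_smul {F : Type*} [NormedAddCommGroup F] [NormedSpace ℝ F]
    {u : Eu d → F} {s : ℝ} (hu : Integrable fun x => wt s x • u x) : LocallyIntegrable u := by
  have e : (fun x => wt (-s) x • wt s x • u x) = u := funext fun x => by
    rw [smul_smul, mul_comm, wt_neg_mul, one_smul]
  rw [← e]
  exact hu.locallyIntegrable.continuous_smul (continuous_wt (-s))

theorem IsTempered.locallyIntegrable {u : Eu d → ℂ} (hm : Measurable u)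
    (hu : IsTempered fun x => ‖u x‖ₑ) : LocallyIntegrable u := by
  obtain ⟨k, hk⟩ := hu.exists_integrable
  refine locallyIntegrable_of_wt_smul (s := -(k : ℝ)) (hk.mono' (by fun_prop)
      (Eventually.of_forall fun x => ?_))
  rw [norm_smul, Real.norm_of_nonneg (wt_pos _ _).le, toReal_enorm, mul_comm]

theorem KernelAssumption.memLp_schwartz (hκ : KernelAssumption κ h) (Φ : 𝓢(Eu d, ℂ)) :
    MemLp Φ 2 (spectralMeasure h) := by
  refine (memLp_two_iff_lintegral Φ.continuous.aestronglyMeasurable).2 ?_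
  rw [lintegral_spectralMeasure hκ.measurable_fourier]
  refine ENNReal.mul_lt_top (by finiteness) ?_
  obtain ⟨-, k, hk⟩ := hκ.tempered_sq
  obtain ⟨A, hA0, hA⟩ := exists_le_wt Φ k
  have hb : ∀ ξ, ‖Φ ξ‖ₑ ^ 2 ≤ ENNReal.ofReal (A ^ 2) * ENNReal.ofReal ((1 + ‖ξ‖ ^ 2) ^ k)⁻¹ := by
    intro ξ
    rw [← ENNReal.ofReal_mul (by positivity), ofReal_inv_pow_eq_wt, ← ofReal_norm,
      ← ENNReal.ofReal_pow (norm_nonneg _)]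
    refine ENNReal.ofReal_le_ofReal ?_
    calc ‖Φ ξ‖ ^ 2 ≤ (A * wt (-(k : ℝ)) ξ) ^ 2 := pow_le_pow_left₀ (norm_nonneg _) (hA ξ) 2
      _ = A ^ 2 * (wt (-(k : ℝ)) ξ * wt (-(k : ℝ)) ξ) := by ring
      _ ≤ _ := by
        refine mul_le_mul_of_nonneg_left ?_ (sq_nonneg A)
        exact mul_le_of_le_one_left (wt_pos _ _).le (wt_le_one (by simp) _)
  calc ∫⁻ ξ, ‖h ξ‖ₑ ^ 2 * ‖Φ ξ‖ₑ ^ 2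
      ≤ ∫⁻ ξ, ENNReal.ofReal (A ^ 2) * (‖h ξ‖ₑ ^ 2 * ENNReal.ofReal ((1 + ‖ξ‖ ^ 2) ^ k)⁻¹) :=
        lintegral_mono fun ξ => by
          rw [mul_left_comm]
          exact mul_le_mul_right (hb ξ) _
    _ < ∞ := by
        rw [lintegral_const_mul' _ _ (by finiteness)]
        exact ENNReal.mul_lt_top (by finiteness) hk

theorem fourierS_ofR_reflect (φ : 𝓢(Eu d, ℝ)) (ξ : Eu d) :
    fourierS (ofR (reflect φ)) ξ = fourierS (ofR φ) (-ξ) := by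
  rw [fourierS_neg, fourierS_eq, ← integral_neg_eq_self]
  refine integral_congr_ae (Eventually.of_forall fun x => ?_)
  simp [reflect_apply]

/-- Since κ is real, conjugating a pairing of h with a real test function amounts to reflecting the
test function. -/
theorem KernelAssumption.conj_neg (hκ : KernelAssumption κ h) :
    ∀ᵐ ξ, h (-ξ) = starRingEnd ℂ (h ξ) := by
  have hl := IsTempered.locallyIntegrable hκ.measurable_fourier hκ.tempered_fourier
  have hm := hκ.measurable_fourier
  have hl1 : LocallyIntegrable fun ξ => h (-ξ) := by
    refine IsTempered.locallyIntegrable (by fun_prop) ⟨by fun_prop, ?_⟩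
    obtain ⟨-, k, hk⟩ := hκ.tempered_fourier
    refine ⟨k, ?_⟩
    rw [← lintegral_neg_eq_self] at hk
    simpa using hk
  have hl2 : LocallyIntegrable fun ξ => starRingEnd ℂ (h ξ) := by
    refine IsTempered.locallyIntegrable (by fun_prop) ?_
    simpa using hκ.tempered_fourier
  refine ae_eq_of_integral_contDiff_smul_eq hl1 hl2 fun ψ hψ hc => ?_
  set φ : 𝓢(Eu d, ℝ) := hc.toSchwartzMap hψ with hφ
  have h1 := hκ.fourier_eq (ofR φ)
  have h2 := hκ.fourier_eq (ofR (reflect φ))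
  have h3 : starRingEnd ℂ (∫ ξ, h ξ * ofR φ ξ) = ∫ ξ, h ξ * ofR (reflect φ) ξ := by
    rw [h1, h2, ← integral_conj]
    refine integral_congr_ae (Eventually.of_forall fun x => ?_)
    simp only [map_mul, Complex.conj_ofReal, conj_fourierS_ofR, fourierS_ofR_reflect]
  rw [← integral_conj, ← integral_comp_neg_eq (fun ξ => h ξ * ofR (reflect φ) ξ)] at h3
  calc ∫ ξ, ψ ξ • h (-ξ) = ∫ ξ, h (-ξ) * ofR (reflect φ) (-ξ) :=
        integral_congr_ae (Eventually.of_forall fun x => by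
          simp [reflect_apply, hφ, mul_comm])
    _ = _ := h3.symm
    _ = _ := integral_congr_ae (Eventually.of_forall fun x => by simp [hφ, mul_comm])

/-- The regular distribution given by a Schwartz function. -/
def schwartzDist (ψ : 𝓢(Eu d, ℝ)) : RealDist d :=
  SchwartzMap.integralCLM ℝ volume ∘L SchwartzMap.smulLeftCLM ℝ (ψ : Eu d → ℝ)

theorem schwartzDist_apply (ψ φ : 𝓢(Eu d, ℝ)) : schwartzDist ψ φ = ∫ x, ψ x * φ x := by
  change ∫ x, SchwartzMap.smulLeftCLM ℝ (ψ : Eu d → ℝ) φ x = _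
  simp [SchwartzMap.smulLeftCLM_apply_apply ψ.hasTemperateGrowth]

theorem integral_mul_fourierS (Φ Ψ : 𝓢(Eu d, ℂ)) :
    ∫ x, Φ x * fourierS Ψ x = ∫ ξ, fourierS Φ ξ * Ψ ξ := by
  set Φ' := SchwartzMap.compCLMOfContinuousLinearEquiv ℂ (dilation d).symm Φ with hΦ'
  have h1 : ∀ ξ, 𝓕 Φ' ξ = cst d * fourierS Φ ξ := fun ξ => by
    have h := invFourierS_apply Φ (-ξ)
    rw [invFourierS, SchwartzMap.fourierInv_apply_eq, neg_neg] at h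
    rw [← h]; simp [hΦ']
  have h2 := SchwartzMap.integral_fourier_mul_eq Φ' Ψ
  simp only [h1, mul_assoc] at h2
  rw [integral_const_mul] at h2
  have h3 := integral_comp_two_pi_smul (fun x => Φ x * fourierS Ψ x)
  have h4 : ∫ x, Φ' x * 𝓕 Ψ x = cst d * ∫ x, Φ x * fourierS Ψ x := by
    rw [← Complex.real_smul, ← h3]
    refine integral_congr_ae (Eventually.of_forall fun x => ?_)
    have e : fourierS Ψ ((2 * Real.pi) • x) = 𝓕 Ψ ((2 * Real.pi)⁻¹ • ((2 * Real.pi) • x)) := rfl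
    simp only [e, smul_smul, inv_mul_cancel₀ (show 2 * Real.pi ≠ 0 by positivity), one_smul]
    simp [hΦ', dilation_symm_apply]
  rw [h4] at h2
  exact (mul_left_cancel₀ (by exact_mod_cast (cst_pos d).ne') h2).symm

theorem hasFourier_schwartzDist (ψ : 𝓢(Eu d, ℝ)) :
    HasFourier (schwartzDist ψ) (fourierS (ofR ψ)) := by
  refine ⟨(fourierS (ofR ψ)).continuous.locallyIntegrable, fun χ _ => ?_⟩
  rw [← integral_mul_fourierS, complexPairing, schwartzDist_apply, schwartzDist_apply]
  have hi : Integrable fun x => ofR ψ x * fourierS χ x :=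
    ((ofR ψ).memLp 2).integrable_mul ((fourierS χ).memLp 2)
  rw [← integral_re_add_im hi, mul_comm Complex.I]
  congr 2 <;> simp

/-- The Schwartz function `ξ ↦ (2π)^{-d} 𝓕ψ(ξ) 𝓕φ(-ξ)`. -/
def crossSpectrum (Φ : 𝓢(Eu d, ℂ)) (φ : 𝓢(Eu d, ℝ)) : 𝓢(Eu d, ℂ) :=
  (cst d : ℂ) • SchwartzMap.smulLeftCLM ℂ (Φ : Eu d → ℂ) (fourierS (ofR (reflect φ)))

theorem crossSpectrum_apply (Φ : 𝓢(Eu d, ℂ)) (φ : 𝓢(Eu d, ℝ)) (ξ : Eu d) :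
    crossSpectrum Φ φ ξ = cst d * (Φ ξ * fourierS (ofR φ) (-ξ)) := by
  rw [crossSpectrum, smul_apply, SchwartzMap.smulLeftCLM_apply_apply Φ.hasTemperateGrowth,
    fourierS_ofR_reflect]
  rfl

theorem convTilde_schwartzDist_eq (ψ φ : 𝓢(Eu d, ℝ)) (z : Eu d) :
    (convTilde (schwartzDist ψ) φ z : ℂ) = fourierS (crossSpectrum (fourierS (ofR ψ)) φ) z := by
  obtain ⟨A, -, hA⟩ := exists_le_wt (fourierS (ofR ψ)) 0
  have hC : ∀ ξ, ‖fourierS (ofR ψ) ξ‖ ≤ A := fun ξ => by simpa [wt] using hA ξ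
  rw [(hasFourier_schwartzDist ψ).convTilde_eq hC, fourierS_eq, ← integral_neg_eq_self]
  refine integral_congr_ae (Eventually.of_forall fun ξ => ?_)
  simp only [crossSpectrum_apply, smul_eq_mul, neg_neg, chr_comm z]

/-- For a continuous rapidly decreasing `φ`, the function `ψ(y) κ(x - y) φ(x)` is integrable. -/
theorem KernelAssumption.exists_integrable_conv (hκ : KernelAssumption κ h) :
    ∃ k : ℕ, ∀ (ψ : 𝓢(Eu d, ℝ)) (φ : Eu d → ℝ) (A : ℝ), Measurable φ →
      (∀ x, ‖φ x‖ ≤ A * wt (-(k : ℝ)) x) →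
      Integrable (fun p : Eu d × Eu d => ψ p.1 * (κ p.2).toReal * φ (p.1 + p.2))
        (volume.prod volume) := by
  obtain ⟨k, hk⟩ := hκ.tempered.exists_integrable
  have hκm := hκ.tempered.1
  refine ⟨k, fun ψ φ A hφ hA => ?_⟩
  have hψm := ψ.continuous.measurable
  have hA0 : 0 ≤ A := nonneg_of_mul_nonneg_left ((norm_nonneg _).trans (hA 0)) (wt_pos _ _)
  have hi : Integrable fun y => ψ y * wt (k : ℝ) y := by
    have := (SchwartzMap.smulLeftCLM ℝ (wt (k : ℝ)) ψ).integrable (μ := volume)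
    refine this.congr (Eventually.of_forall fun x => ?_)
    simp only
    rw [smulLeft_wt_apply, mul_comm]
  refine ((hi.norm.mul_prod hk).const_mul (A * 2 ^ (k : ℝ))).mono'
    (Measurable.aestronglyMeasurable (by fun_prop)) (Eventually.of_forall fun p => ?_)
  rw [norm_mul, norm_mul, norm_mul, Real.norm_of_nonneg (wt_pos _ _).le,
    Real.norm_of_nonneg (ENNReal.toReal_nonneg (a := κ p.2))]
  have h1 := wt_peetre (d := d) (s := k) (by positivity) (p.1 + p.2) (-p.2)
  rw [wt_neg_arg, add_neg_cancel_right] at h1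
  calc _ ≤ ‖ψ p.1‖ * (κ p.2).toReal * (A * (2 ^ (k : ℝ) * wt (-(k : ℝ)) p.2 * wt k p.1)) := by
        refine mul_le_mul_of_nonneg_left ((hA _).trans ?_)
          (mul_nonneg (norm_nonneg _) ENNReal.toReal_nonneg)
        exact mul_le_mul_of_nonneg_left h1 hA0
    _ = _ := by ring

theorem KernelAssumption.conv_integrable (hκ : KernelAssumption κ h) :
    ∃ k : ℕ, ∀ (ψ : 𝓢(Eu d, ℝ)) (φ : Eu d → ℝ) (A : ℝ), Measurable φ →
      (∀ x, ‖φ x‖ ≤ A * wt (-(k : ℝ)) x) →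
      Integrable (fun p : Eu d × Eu d => ψ p.1 * (κ (p.2 - p.1)).toReal * φ p.2)
        (volume.prod volume) := by
  obtain ⟨k, hk⟩ := hκ.exists_integrable_conv
  refine ⟨k, fun ψ φ A hφ hA => ?_⟩
  have hκm := hκ.tempered.1
  have hψm := ψ.continuous.measurable
  refine ((measurePreserving_prod_add (volume : Measure (Eu d)) volume).integrable_comp
    (Measurable.aestronglyMeasurable (by fun_prop))).1 ?_
  refine (hk ψ φ A hφ hA).congr (Eventually.of_forall fun p => ?_)
  simp

theorem KernelAssumption.locallyIntegrable_conv (hκ : KernelAssumption κ h) (ψ : 𝓢(Eu d, ℝ)) :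
    LocallyIntegrable fun x => ∫ y, ψ y * (κ (x - y)).toReal := by
  obtain ⟨k, hk⟩ := hκ.conv_integrable
  have h1 := (hk ψ (wt (-(k : ℝ))) 1 (continuous_wt _).measurable fun x => by
    rw [Real.norm_of_nonneg (wt_pos _ _).le, one_mul]).integral_prod_right
  simp only [integral_mul_const] at h1
  refine locallyIntegrable_of_wt_smul (s := -(k : ℝ)) (h1.congr (Eventually.of_forall fun x => ?_))
  simp only [smul_eq_mul, mul_comm]

/-- Fubini turns ∫(ψ * κ) φ into ∫ κ (φ * ψ̃). The function φ * ψ̃ is the transform of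
`crossSpectrum`, so the relation h = 𝓕κ applies to it. -/
theorem KernelAssumption.integral_conv_mul (hκ : KernelAssumption κ h) (ψ φ : 𝓢(Eu d, ℝ)) :
    ((∫ x, (∫ y, ψ y * (κ (x - y)).toReal) * φ x : ℝ) : ℂ)
      = cst d * ∫ ξ, h ξ * fourierS (ofR ψ) ξ * fourierS (ofR φ) (-ξ) := by
  obtain ⟨k, hk⟩ := hκ.conv_integrable
  obtain ⟨k', hk'⟩ := hκ.exists_integrable_conv
  obtain ⟨A, -, hA⟩ := exists_le_wt φ k
  obtain ⟨A', -, hA'⟩ := exists_le_wt φ k'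
  have h1 := hk ψ φ A φ.continuous.measurable hA
  have h2 := hk' ψ φ A' φ.continuous.measurable hA'
  have e1 : ∫ x, (∫ y, ψ y * (κ (x - y)).toReal) * φ x
      = ∫ z, (κ z).toReal * convTilde (schwartzDist ψ) φ z := by
    simp_rw [← integral_mul_const]
    rw [← integral_prod_symm (fun p : Eu d × Eu d => ψ p.1 * (κ (p.2 - p.1)).toReal * φ p.2) h1,
      ← (measurePreserving_prod_add (volume : Measure (Eu d)) volume).integral_comp
        (MeasurableEquiv.shearAddRight (Eu d)).measurableEmbedding]
    simp only [add_sub_cancel_left]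
    rw [integral_prod_symm _ h2]
    refine integral_congr_ae (Eventually.of_forall fun z => ?_)
    simp only
    rw [convTilde, schwartzDist_apply, ← integral_const_mul]
    refine integral_congr_ae (Eventually.of_forall fun y => ?_)
    simp only [translate_apply]
    ring
  rw [e1, ← integral_const_mul, ← integral_complex_ofReal]
  simp only [Complex.ofReal_mul, convTilde_schwartzDist_eq]
  rw [← hκ.fourier_eq]
  refine integral_congr_ae (Eventually.of_forall fun ξ => ?_)
  simp only [crossSpectrum_apply]
  ring

end Kernel

/-! ### Bochner integrals in L² and pointwise integrals. -/

section FubiniLp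

variable {X S 𝕜 : Type*} [MeasurableSpace X] [MeasurableSpace S] [RCLike 𝕜]

/-- The Bochner integral of an `L²`-valued function is given by the pointwise integrals of a
jointly measurable version. -/
theorem integral_Lp_two_ae_eq {m : Measure X} [SigmaFinite m] {l : Measure S} [SFinite l]
    {f : S → Lp 𝕜 2 m} (hf : Integrable f l) {F : S → X → 𝕜}
    (hF : Measurable (Function.uncurry F)) (hFf : ∀ᵐ s ∂l, F s =ᵐ[m] f s) :
    (∀ᵐ x ∂m, Integrable (fun s => F s x) l) ∧
      (∫ s, f s ∂l : Lp 𝕜 2 m) =ᵐ[m] fun x => ∫ s, F s x ∂l := by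
  -- On a set of finite measure the L² norm controls the L¹ norm by Cauchy–Schwarz, which gives
  -- joint integrability; σ-finiteness then covers the space.
  have hB : ∀ B : Set X, MeasurableSet B → m B < ∞ →
      Integrable (Function.uncurry F) (l.prod (m.restrict B)) := by
    intro B hB hmB
    refine ⟨hF.aestronglyMeasurable, ?_⟩
    rw [HasFiniteIntegral, lintegral_prod _ hF.enorm.aemeasurable]
    calc ∫⁻ s, ∫⁻ x in B, ‖F s x‖ₑ ∂m ∂l ≤ ∫⁻ s, ‖f s‖ₑ * m B ^ (1 / 2 : ℝ) ∂l := by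
          refine lintegral_mono_ae ?_
          filter_upwards [hFf] with s hs
          have h1 : ∫⁻ x in B, ‖F s x‖ₑ ∂m = eLpNorm (f s) 1 (m.restrict B) := by
            rw [eLpNorm_one_eq_lintegral_enorm]
            refine lintegral_congr_ae ?_
            filter_upwards [ae_restrict_of_ae hs] with x hx
            rw [hx]
          rw [h1]
          refine (eLpNorm_le_eLpNorm_mul_rpow_measure_univ (q := 2) (by norm_num)
            (Lp.aestronglyMeasurable (f s)).restrict).trans ?_
          rw [Measure.restrict_apply_univ, Lp.enorm_def]
          refine mul_le_mul' (eLpNorm_mono_measure _ Measure.restrict_le_self) (le_of_eq ?_)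
          norm_num
      _ < ∞ := by
          rw [lintegral_mul_const' _ _ (ENNReal.rpow_ne_top_of_nonneg (by norm_num) hmB.ne)]
          exact ENNReal.mul_lt_top hf.2 (ENNReal.rpow_lt_top_of_nonneg (by norm_num) hmB.ne)
  refine ⟨ae_of_forall_measure_lt_top_ae_restrict _ fun B hBm hBf => (hB B hBm hBf).prod_left_ae,
    ae_eq_of_forall_setIntegral_eq_of_sigmaFinite (fun B hBm hBf => ?_) (fun B hBm hBf => ?_)
      fun B hBm hBf => ?_⟩
  · exact integrableOn_Lp_of_measure_ne_top _ (by norm_num) hBf.ne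
  · exact (hB B hBm hBf).integral_prod_right
  -- The integral over B is the inner product with its indicator, a continuous functional, so it
  -- commutes with the Bochner integral.
  · rw [← integral_integral_swap (hB B hBm hBf), ← L2.inner_indicatorConstLp_one hBm hBf.ne,
      ← integral_inner hf]
    refine integral_congr_ae ?_
    filter_upwards [hFf] with s hs
    rw [L2.inner_indicatorConstLp_one hBm hBf.ne]
    refine integral_congr_ae ?_
    filter_upwards [ae_restrict_of_ae hs] with x hx using hx.symm

end FubiniLp

/-! ### The stochastic integral on the spectral side. -/

section SpectralIntegral

variable {d : ℕ} {Ω : Type*} [MeasurableSpace Ω] {P : Measure Ω} {ν : Measure ℝ}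
  {N : Ω → Measure (Eu d × ℝ)} {κ : Eu d → ℝ≥0∞} {h : Eu d → ℂ}

/-- The map `Θ` is the stochastic integral with respect to the noise `X`, read on the spectral
side: `X(S) = Θ(𝓕S)`. -/
structure IsSpectralIntegral (κ : Eu d → ℝ≥0∞) (h : Eu d → ℂ) (ν : Measure ℝ)
    (N : Ω → Measure (Eu d × ℝ)) (P : Measure Ω)
    (Θ : Lp ℂ 2 (spectralMeasure h) →L[ℝ] Lp ℝ 2 P) : Prop where
  noise_eq : ∀ (ψ : 𝓢(Eu d, ℝ)) (hψ : MemLp (fourierS (ofR ψ)) 2 (spectralMeasure h)),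
    noise κ ν N P ψ = Θ (hψ.toLp _)
  enorm_sq : ∀ (w : Eu d → ℂ) (hw : MemLp w 2 (spectralMeasure h)),
    (∀ ξ, w (-ξ) = starRingEnd ℂ (w ξ)) →
      ‖Θ (hw.toLp w)‖ₑ ^ 2 = jumpVar ν * ∫⁻ ξ, ‖w ξ‖ₑ ^ 2 ∂(spectralMeasure h)
  levyInt_eq : ∀ (w : Eu d → ℂ) (hw : MemLp w 2 (spectralMeasure h)) (γ : Eu d → ℝ), MemLp γ 2 →
    (∀ φ : 𝓢(Eu d, ℝ), HasCompactSupport φ →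
      ((∫ x, γ x * φ x : ℝ) : ℂ) = cst d * ∫ ξ, h ξ * w ξ * fourierS (ofR φ) (-ξ)) →
    levyInt ν N P γ = Θ (hw.toLp w)

/-- The noise `X` extends to a stochastic integral of functions in `L²(μ)`. -/
theorem exists_isSpectralIntegral (hν : IsJumpMeasure ν)
    (hN : IsPoissonRandomMeasure N ((volume : Measure (Eu d)).prod ν) P)
    (hκ : KernelAssumption κ h) :
    ∃ Θ : Lp ℂ 2 (spectralMeasure h) →L[ℝ] Lp ℝ 2 P, IsSpectralIntegral κ h ν N P Θ := by
  obtain ⟨L, hL1, hL2⟩ := exists_levyCLM hν hN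
  have hh := hκ.measurable_fourier
  -- The pairings determine γ as the spectral kernel of w. The same argument serves the noise on
  -- Schwartz functions and the Lévy integrals of L² kernels.
  have key : ∀ (w : Eu d → ℂ) (hw : MemLp w 2 (spectralMeasure h)) (γ : Eu d → ℝ),
      LocallyIntegrable γ → (∀ φ : 𝓢(Eu d, ℝ), HasCompactSupport φ →
        ((∫ x, γ x * φ x : ℝ) : ℂ) = cst d * ∫ ξ, h ξ * w ξ * fourierS (ofR φ) (-ξ)) →
      levyInt ν N P γ = (L.comp (spectralKernel hh)) (hw.toLp w) := by
    intro w hw γ hγ hp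
    have h1 : γ =ᵐ[volume] spectralKernel hh (hw.toLp w) := by
      refine ae_eq_spectralKernel hh _ hγ fun φ hφ => ?_
      rw [hp φ hφ]
      congr 1
      refine integral_congr_ae ?_
      filter_upwards [mul_ae_eq_of_ae_spectralMeasure hh hw.coeFn_toLp] with ξ hξ
      rw [hξ]
    have h2 : MemLp γ 2 := (Lp.memLp (spectralKernel hh (hw.toLp w))).ae_eq h1.symm
    rw [hL1 γ h2, ContinuousLinearMap.comp_apply]
    congr 1
    rw [MemLp.toLp_congr h2 (Lp.memLp _) h1, Lp.toLp_coeFn]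
  refine ⟨L.comp (spectralKernel hh), fun ψ hψ => ?_, fun w hw hH => ?_, fun w hw γ hγ hp => ?_⟩
  · exact key _ hψ _ (hκ.locallyIntegrable_conv ψ)
      fun φ _ => hκ.integral_conv_mul ψ φ
  · rw [ContinuousLinearMap.comp_apply, hL2, enorm_spectralKernel hh hκ.conj_neg, enorm_toLp_sq]
    have h1 := (ae_spectralMeasure_iff hh).1 hw.coeFn_toLp
    -- The class of w is known only where h ≠ 0; by the symmetry of h this set is invariant under ξ
    -- ↦ -ξ, up to a null set.
    have h2 := (Measure.measurePreserving_neg (volume : Measure (Eu d))).quasiMeasurePreserving.ae h1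
    filter_upwards [h1, h2, hκ.conj_neg] with ξ h3 h4 h5 h0
    rw [h3 h0, h4 (by rw [h5]; simpa using h0), hH]
  · exact key w hw γ (hγ.locallyIntegrable (by norm_num)) hp

end SpectralIntegral

/-! ### The symbol 𝓕G_t and its time integral H_t. -/

section Propagator

variable {d : ℕ} {G : ℝ → RealDist d}

theorem HypA.continuous_hasFourier (hA : HypA G) {t : ℝ} (ht : 0 < t) :
    Continuous (fourierFun (G t)) ∧ HasFourier (G t) (fourierFun (G t)) := by
  obtain ⟨g, hg, hG⟩ := (hA t ht).exists_fourier
  rw [fourierFun_eq hg hG]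
  exact ⟨hg, hG⟩

theorem fourierFun_neg {T : RealDist d} (hc : Continuous (fourierFun T))
    (hT : HasFourier T (fourierFun T)) {C : ℝ} (hC : ∀ ξ, ‖fourierFun T ξ‖ ≤ C) (ξ : Eu d) :
    fourierFun T (-ξ) = starRingEnd ℂ (fourierFun T ξ) := by
  have h1 := fourierFun_eq (by fun_prop) (hT.conj_neg hC)
  have h2 := congrFun h1 (-ξ)
  simpa using h2

/-- The Fourier transform of `G_t` for `t > 0`, extended by zero. -/
def propagator (G : ℝ → RealDist d) (t : ℝ) (ξ : Eu d) : ℂ :=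
  if 0 < t then fourierFun (G t) ξ else 0

theorem propagator_of_pos {t : ℝ} (ht : 0 < t) : propagator G t = fourierFun (G t) := by
  ext ξ; simp [propagator, ht]

theorem propagator_of_nonpos {t : ℝ} (ht : t ≤ 0) : propagator G t = 0 := by
  ext ξ; simp [propagator, ht.not_gt]

theorem continuous_propagator (hA : HypA G) (t : ℝ) : Continuous (propagator G t) := by
  rcases lt_or_ge 0 t with ht | ht
  · rw [propagator_of_pos ht]; exact (hA.continuous_hasFourier ht).1
  · rw [propagator_of_nonpos ht]; exact continuous_zero

/-- A function continuous in one variable and measurable in the other is jointly measurable.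
Continuity in t holds only on (0,∞), so time is parametrized by its logarithm. -/
theorem measurable_propagator (hA : HypA G) (hF : HypF G) :
    Measurable (Function.uncurry (propagator G)) := by
  have h1 : Measurable (Function.uncurry fun (r : ℝ) ξ => fourierFun (G (Real.exp r)) ξ) :=
    measurable_uncurry_of_continuous_of_measurable
      (fun ξ => (hF.continuous ξ).comp_continuous Real.continuous_exp fun r => Real.exp_pos r)
      fun r => (hA.continuous_hasFourier (Real.exp_pos r)).1.measurable
  have h2 : Function.uncurry (propagator G) = fun p : ℝ × Eu d => if 0 < p.1 then
      Function.uncurry (fun (r : ℝ) ξ => fourierFun (G (Real.exp r)) ξ) (Real.log p.1, p.2)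
      else 0 := by
    ext ⟨s, ξ⟩
    simp only [Function.uncurry, propagator]
    split_ifs with hs
    · rw [Real.exp_log hs]
    · rfl
  rw [h2]
  exact Measurable.ite (measurableSet_lt measurable_const measurable_fst)
    (h1.comp ((Real.measurable_log.comp measurable_fst).prodMk measurable_snd)) measurable_const

theorem HypF.exists_bound (hF : HypF G) : ∃ C : ℝ → ℝ, (∀ t, 0 ≤ C t) ∧
    ∀ s t, s ≤ t → ∀ ξ : Eu d, ‖propagator G s ξ‖ ≤ C t := by
  obtain ⟨C, hC, hb⟩ := hF.bound
  refine ⟨fun t => if 0 < t then C t else 0, fun t => ?_, fun s t hst ξ => ?_⟩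
  · beta_reduce
    split_ifs with ht
    · exact (norm_nonneg _).trans (hb t ht 0)
    · exact le_rfl
  · beta_reduce
    rcases lt_or_ge 0 s with hs | hs
    · rw [propagator_of_pos hs, if_pos (hs.trans_le hst)]
      exact (hb s hs ξ).trans (hC hs (hs.trans_le hst) hst)
    · rw [propagator_of_nonpos hs]
      simp only [Pi.zero_apply, norm_zero]
      split_ifs with ht
      · exact (norm_nonneg _).trans (hb t ht 0)
      · exact le_rfl

theorem propagator_neg (hA : HypA G) (hF : HypF G) (t : ℝ) (ξ : Eu d) :
    propagator G t (-ξ) = starRingEnd ℂ (propagator G t ξ) := by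
  rcases lt_or_ge 0 t with ht | ht
  · obtain ⟨C, -, hC⟩ := hF.exists_bound
    rw [propagator_of_pos ht]
    obtain ⟨h1, h2⟩ := hA.continuous_hasFourier ht
    exact fourierFun_neg h1 h2 (fun ξ => by
      rw [← propagator_of_pos ht]; exact hC t t le_rfl ξ) ξ
  · simp [propagator_of_nonpos ht]

theorem continuousOn_propagator (hF : HypF G) (ξ : Eu d) :
    ContinuousOn (fun t => propagator G t ξ) (Ioi 0) :=
  (hF.continuous ξ).congr fun t ht => by rw [propagator_of_pos ht]

/-- The endpoint s = t involves `G 0`, about which nothing is known; it is a null set. -/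
theorem Hfun_eq (t : ℝ) (ξ : Eu d) (ht : 0 ≤ t) :
    Hfun G t ξ = ∫ s in (0 : ℝ)..t, propagator G (t - s) ξ := by
  rw [Hfun, intervalIntegral.integral_of_le ht, intervalIntegral.integral_of_le ht,
    integral_Ioc_eq_integral_Ioo, integral_Ioc_eq_integral_Ioo]
  refine setIntegral_congr_fun measurableSet_Ioo fun s hs => ?_
  rw [propagator_of_pos (sub_pos.2 hs.2)]

theorem Hfun_zero : Hfun G 0 = 0 := by ext ξ; simp [Hfun]

theorem Hfun_neg (hA : HypA G) (hF : HypF G) {t : ℝ} (ht : 0 ≤ t) (ξ : Eu d) :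
    Hfun G t (-ξ) = starRingEnd ℂ (Hfun G t ξ) := by
  rw [Hfun_eq t _ ht, Hfun_eq t _ ht, intervalIntegral.integral_of_le ht,
    intervalIntegral.integral_of_le ht, ← integral_conj]
  simp only [propagator_neg hA hF]

theorem measurable_Hfun (hA : HypA G) (hF : HypF G) {t : ℝ} (ht : 0 ≤ t) :
    Measurable (Hfun G t) := by
  have h1 : Hfun G t = fun ξ => ∫ s in Ioc 0 t, propagator G (t - s) ξ := by
    ext ξ
    rw [Hfun_eq t ξ ht, intervalIntegral.integral_of_le ht]
  rw [h1]
  have h2 : StronglyMeasurable (Function.uncurry fun (ξ : Eu d) (s : ℝ) => propagator G (t - s) ξ) :=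
    ((measurable_propagator hA hF).comp
      ((measurable_const.sub measurable_snd).prodMk measurable_fst)).stronglyMeasurable
  exact h2.integral_prod_right.measurable

theorem exists_bound_Hfun (hF : HypF G) : ∃ C : ℝ → ℝ, (∀ t, 0 ≤ C t) ∧
    (∀ s t, s ≤ t → ∀ ξ : Eu d, ‖propagator G s ξ‖ ≤ C t) ∧
    ∀ s t, 0 ≤ s → s ≤ t → ∀ ξ : Eu d, ‖Hfun G s ξ‖ ≤ C t * s := by
  obtain ⟨C, hC0, hC⟩ := hF.exists_bound
  refine ⟨C, hC0, hC, fun s t hs hst ξ => ?_⟩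
  rw [Hfun_eq s ξ hs]
  have := intervalIntegral.norm_integral_le_of_norm_le_const (a := (0 : ℝ)) (b := s) (C := C t)
    (f := fun r => propagator G (s - r) ξ) fun r hr => by
      rw [uIoc_of_le hs] at hr
      exact hC _ _ (by linarith [hr.1]) ξ
  rwa [sub_zero, abs_of_nonneg hs] at this

theorem tendsto_Hfun_zero (hF : HypF G) (ξ : Eu d) :
    Tendsto (fun t => Hfun G t ξ) (𝓝[>] 0) (𝓝 0) := by
  obtain ⟨C, hC0, -, hC⟩ := exists_bound_Hfun hF
  refine squeeze_zero_norm' (a := fun t => C 1 * t) ?_ ?_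
  · filter_upwards [Ioo_mem_nhdsGT (zero_lt_one' ℝ)] with t ht
    exact hC t 1 ht.1.le ht.2.le ξ
  · have : Tendsto (fun t : ℝ => C 1 * t) (𝓝 0) (𝓝 0) := by
      have : Continuous fun t : ℝ => C 1 * t := by fun_prop
      simpa using this.tendsto 0
    exact this.mono_left nhdsWithin_le_nhds

end Propagator

/-! ### Stochastic Fubini theorem and dominated convergence in L²(μ). -/

section SpectralFubini

variable {d : ℕ} {Ω : Type*} [MeasurableSpace Ω] {P : Measure Ω} {h : Eu d → ℂ}

/-- The stochastic Fubini theorem: Θ commutes with the Bochner integral, and on either side that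
integral is computed pointwise from a jointly measurable version. -/
theorem integral_spectralIntegral {S : Type*} [MeasurableSpace S] {l : Measure S} [SFinite l]
    [SigmaFinite P] (Θ : Lp ℂ 2 (spectralMeasure h) →L[ℝ] Lp ℝ 2 P) {w : S → Eu d → ℂ}
    (hwm : Measurable (Function.uncurry w)) (hw : ∀ s, MemLp (w s) 2 (spectralMeasure h))
    (hi : Integrable (fun s => (hw s).toLp (w s)) l) {Y : S → Ω → ℝ}
    (hY : Measurable (Function.uncurry Y)) (hYw : ∀ᵐ s ∂l, Y s =ᵐ[P] Θ ((hw s).toLp (w s))) :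
    ∃ hw' : MemLp (fun ξ => ∫ s, w s ξ ∂l) 2 (spectralMeasure h),
      (∀ᵐ ω ∂P, Integrable (fun s => Y s ω) l) ∧
        (fun ω => ∫ s, Y s ω ∂l) =ᵐ[P] Θ (hw'.toLp _) := by
  obtain ⟨-, h1⟩ := integral_Lp_two_ae_eq hi hwm
    (Eventually.of_forall fun s => (hw s).coeFn_toLp.symm)
  have hw' := (Lp.memLp (∫ s, (hw s).toLp (w s) ∂l)).ae_eq h1
  obtain ⟨h2, h3⟩ := integral_Lp_two_ae_eq (Θ.integrable_comp hi) hY hYw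
  refine ⟨hw', h2, h3.symm.trans ?_⟩
  rw [Θ.integral_comp_comm hi, ← MemLp.toLp_congr (Lp.memLp _) hw' h1, Lp.toLp_coeFn]

theorem tendsto_zero_of_sq {ι : Type*} {l : Filter ι} {u : ι → ℝ≥0∞}
    (hu : Tendsto (fun i => u i ^ 2) l (𝓝 0)) : Tendsto u l (𝓝 0) := by
  have h5 := hu.ennrpow_const (1 / 2 : ℝ)
  rw [ENNReal.zero_rpow_of_pos (by norm_num)] at h5
  refine h5.congr fun i => ?_
  rw [← ENNReal.rpow_natCast, ← ENNReal.rpow_mul]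
  norm_num

theorem tendsto_toLp {ι : Type*} {l : Filter ι} [l.IsCountablyGenerated] {m : Measure (Eu d)}
    {w : ι → Eu d → ℂ} {w₀ : Eu d → ℂ} (hwm : ∀ i, Measurable (w i)) (hwm₀ : Measurable w₀)
    (hw : ∀ i, MemLp (w i) 2 m) (hw₀ : MemLp w₀ 2 m) {b : Eu d → ℝ≥0∞}
    (hb : ∫⁻ ξ, b ξ ^ 2 ∂m ≠ ∞) (hwb : ∀ᶠ i in l, ∀ ξ, ‖w i ξ‖ₑ ≤ b ξ) (hwb₀ : ∀ ξ, ‖w₀ ξ‖ₑ ≤ b ξ)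
    (hlim : ∀ ξ, Tendsto (fun i => w i ξ) l (𝓝 (w₀ ξ))) :
    Tendsto (fun i => (hw i).toLp (w i)) l (𝓝 (hw₀.toLp w₀)) := by
  rw [tendsto_iff_edist_tendsto_0]
  have h1 : Tendsto (fun i => ∫⁻ ξ, ‖w i ξ - w₀ ξ‖ₑ ^ 2 ∂m) l (𝓝 0) := by
    have h2 := tendsto_lintegral_filter_of_dominated_convergence (μ := m) (l := l)
      (F := fun i ξ => ‖w i ξ - w₀ ξ‖ₑ ^ 2) (f := fun _ => 0) (fun ξ => 4 * b ξ ^ 2)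
      (Eventually.of_forall fun i => by have := hwm i; fun_prop) ?_ ?_ ?_
    · simpa using h2
    · filter_upwards [hwb] with i hi
      refine Eventually.of_forall fun ξ => ?_
      calc ‖w i ξ - w₀ ξ‖ₑ ^ 2 ≤ (b ξ + b ξ) ^ 2 := by
            gcongr
            exact (enorm_sub_le).trans (add_le_add (hi ξ) (hwb₀ ξ))
        _ = 4 * b ξ ^ 2 := by ring
    · rw [lintegral_const_mul' _ _ (by norm_num)]
      exact ENNReal.mul_ne_top (by norm_num) hb
    · refine Eventually.of_forall fun ξ => ?_
      have h3 := (ENNReal.continuous_pow 2).tendsto _ |>.comp ((hlim ξ).sub_const (w₀ ξ)).enorm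
      simpa [Function.comp_def] using h3
  have h4 : ∀ i, edist ((hw i).toLp (w i)) (hw₀.toLp w₀) ^ 2 = ∫⁻ ξ, ‖w i ξ - w₀ ξ‖ₑ ^ 2 ∂m := by
    intro i
    rw [edist_eq_enorm_sub, ← MemLp.toLp_sub, enorm_toLp_sq]
    rfl
  simp_rw [← h4] at h1
  exact tendsto_zero_of_sq h1

end SpectralFubini

/-! ### The distribution solution. -/

section DistributionSolution

variable {d : ℕ} {Ω : Type*} [MeasurableSpace Ω] {P : Measure Ω} {ν : Measure ℝ}
  {N : Ω → Measure (Eu d × ℝ)} {κ : Eu d → ℝ≥0∞} {h : Eu d → ℂ} {G : ℝ → RealDist d}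
  {Θ : Lp ℂ 2 (spectralMeasure h) →L[ℝ] Lp ℝ 2 P}

/-- The Fourier transform of `φ * G̃_r`. -/
def solSymbol (G : ℝ → RealDist d) (φ : 𝓢(Eu d, ℝ)) (r : ℝ) (ξ : Eu d) : ℂ :=
  starRingEnd ℂ (propagator G r ξ) * fourierS (ofR φ) ξ

theorem measurable_solSymbol (hA : HypA G) (hF : HypF G) (φ : 𝓢(Eu d, ℝ)) :
    Measurable (Function.uncurry (solSymbol G φ)) := by
  have h1 := measurable_propagator hA hF
  have h2 := (fourierS (ofR φ)).continuous.measurable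
  exact (Complex.continuous_conj.measurable.comp h1).mul (h2.comp measurable_snd)

theorem memLp_bdd_mul_schwartz (hκ : KernelAssumption κ h) {u : Eu d → ℂ} (hu : Measurable u)
    {C : ℝ} (hC : ∀ ξ, ‖u ξ‖ ≤ C) (Φ : 𝓢(Eu d, ℂ)) :
    MemLp (fun ξ => u ξ * Φ ξ) 2 (spectralMeasure h) := by
  refine (hκ.memLp_schwartz Φ).of_le_mul (c := C)
    (hu.mul Φ.continuous.measurable).aestronglyMeasurable (Eventually.of_forall fun ξ => ?_)
  rw [norm_mul]
  exact mul_le_mul_of_nonneg_right (hC ξ) (norm_nonneg _)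

theorem memLp_solSymbol (hκ : KernelAssumption κ h) (hA : HypA G) (hF : HypF G)
    (φ : 𝓢(Eu d, ℝ)) (r : ℝ) : MemLp (solSymbol G φ r) 2 (spectralMeasure h) := by
  obtain ⟨C, hC0, hC⟩ := hF.exists_bound
  refine memLp_bdd_mul_schwartz hκ (Continuous.measurable ?_) (C := C r) (fun ξ => ?_) _
  · exact Complex.continuous_conj.comp (continuous_propagator hA r)
  · rw [RCLike.norm_conj]; exact hC r r le_rfl ξ

theorem memLp_Hfun_mul (hκ : KernelAssumption κ h) (hA : HypA G) (hF : HypF G)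
    (φ : 𝓢(Eu d, ℝ)) {t : ℝ} (ht : 0 ≤ t) :
    MemLp (fun ξ => starRingEnd ℂ (Hfun G t ξ) * fourierS (ofR φ) ξ) 2 (spectralMeasure h) := by
  obtain ⟨C, hC0, -, hC⟩ := exists_bound_Hfun hF
  refine memLp_bdd_mul_schwartz hκ ?_ (C := C t * t) (fun ξ => ?_) _
  · exact Complex.continuous_conj.measurable.comp (measurable_Hfun hA hF ht)
  · rw [RCLike.norm_conj]; exact hC t t ht le_rfl ξ

theorem norm_solSymbol_le {C : ℝ → ℝ} (hC : ∀ s t, s ≤ t → ∀ ξ : Eu d, ‖propagator G s ξ‖ ≤ C t)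
    (φ : 𝓢(Eu d, ℝ)) {s t : ℝ} (hst : s ≤ t) (ξ : Eu d) :
    ‖solSymbol G φ s ξ‖ ≤ C t * ‖fourierS (ofR φ) ξ‖ := by
  rw [solSymbol, norm_mul, RCLike.norm_conj]
  exact mul_le_mul_of_nonneg_right (hC s t hst ξ) (norm_nonneg _)

theorem enorm_solSymbol_le {C : ℝ → ℝ} (hC0 : ∀ t, 0 ≤ C t)
    (hC : ∀ s t, s ≤ t → ∀ ξ : Eu d, ‖propagator G s ξ‖ ≤ C t)
    (φ : 𝓢(Eu d, ℝ)) {s t : ℝ} (hst : s ≤ t) (ξ : Eu d) :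
    ‖solSymbol G φ s ξ‖ₑ ≤ ENNReal.ofReal (C t) * ‖fourierS (ofR φ) ξ‖ₑ := by
  rw [← ofReal_norm, ← ofReal_norm, ← ENNReal.ofReal_mul (hC0 t)]
  exact ENNReal.ofReal_le_ofReal (norm_solSymbol_le hC φ hst ξ)

theorem lintegral_const_mul_schwartz_sq (hκ : KernelAssumption κ h) (Φ : 𝓢(Eu d, ℂ)) (c : ℝ) :
    ∫⁻ ξ, (ENNReal.ofReal c * ‖Φ ξ‖ₑ) ^ 2 ∂(spectralMeasure h) ≠ ∞ := by
  simp only [mul_pow]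
  rw [lintegral_const_mul' _ _ (by finiteness)]
  refine ENNReal.mul_ne_top (by finiteness) (ne_of_lt ?_)
  exact (memLp_two_iff_lintegral Φ.continuous.aestronglyMeasurable).1 (hκ.memLp_schwartz Φ)

theorem continuousOn_solSymbol (hκ : KernelAssumption κ h) (hA : HypA G) (hF : HypF G)
    (φ : 𝓢(Eu d, ℝ)) :
    ContinuousOn (fun r => (memLp_solSymbol hκ hA hF φ r).toLp (solSymbol G φ r)) (Ioi 0) := by
  obtain ⟨C, hC0, hC⟩ := hF.exists_bound
  intro r hr
  have hm := measurable_solSymbol hA hF φ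
  refine tendsto_toLp (fun i => hm.comp measurable_prodMk_left)
    (hm.comp (measurable_prodMk_left (x := r))) _ _
    (lintegral_const_mul_schwartz_sq hκ (fourierS (ofR φ)) (C (r + 1))) ?_
    (fun ξ => enorm_solSymbol_le hC0 hC φ (by linarith) ξ) fun ξ => ?_
  · filter_upwards [nhdsWithin_le_nhds (Iio_mem_nhds (lt_add_one r))] with s hs ξ
    exact enorm_solSymbol_le hC0 hC φ (le_of_lt hs) ξ
  · have h1 := continuousOn_propagator hF ξ r hr
    exact (Complex.continuous_conj.continuousAt.tendsto.comp h1).mul_const _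

theorem integrableOn_solSymbol (hκ : KernelAssumption κ h) (hA : HypA G) (hF : HypF G)
    (φ : 𝓢(Eu d, ℝ)) (t : ℝ) :
    IntegrableOn (fun s => (memLp_solSymbol hκ hA hF φ (t - s)).toLp (solSymbol G φ (t - s)))
      (Ioo 0 t) := by
  obtain ⟨C, hC0, hC⟩ := hF.exists_bound
  have hc : ContinuousOn
      (fun s => (memLp_solSymbol hκ hA hF φ (t - s)).toLp (solSymbol G φ (t - s))) (Ioo 0 t) :=
    (continuousOn_solSymbol hκ hA hF φ).comp (by fun_prop) fun s hs => sub_pos.2 hs.2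
  refine Integrable.of_bound (hc.aestronglyMeasurable measurableSet_Ioo)
    (C t * ‖(hκ.memLp_schwartz (fourierS (ofR φ))).toLp _‖) ?_
  filter_upwards [ae_restrict_mem measurableSet_Ioo] with s hs
  refine Lp.norm_le_mul_norm_of_ae_le_mul ?_
  filter_upwards [(memLp_solSymbol hκ hA hF φ (t - s)).coeFn_toLp,
    (hκ.memLp_schwartz (fourierS (ofR φ))).coeFn_toLp] with ξ h1 h2
  rw [h1, h2]
  exact norm_solSymbol_le hC φ (by linarith [hs.1]) ξ

/-- Here φ * G̃_r is itself Schwartz, so the noise acts on it directly. The Hermitian symmetry turns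
𝓕G_r(-ξ) into the conjugate in `solSymbol`. -/
theorem noise_convTilde (hΘ : IsSpectralIntegral κ h ν N P Θ) (hκ : KernelAssumption κ h)
    (hA : HypA G) (hF : HypF G) {φ : 𝓢(Eu d, ℝ)} (hφ : HasCompactSupport φ) {r : ℝ} (hr : 0 < r) :
    noise κ ν N P (convTilde (G r) φ)
      = Θ ((memLp_solSymbol hκ hA hF φ r).toLp (solSymbol G φ r)) := by
  obtain ⟨C, hC0, hC⟩ := hF.exists_bound
  obtain ⟨hc, hT⟩ := hA.continuous_hasFourier hr
  obtain ⟨ψ, hψ, hψF⟩ := (hA r hr).exists_convTilde hc hT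
    (fun ξ => by rw [← propagator_of_pos hr]; exact hC r r le_rfl ξ) hφ
  have e : solSymbol G φ r = fourierS (ofR ψ) := by
    ext ξ
    rw [hψF, solSymbol, ← propagator_of_pos hr, propagator_neg hA hF]
  rw [← hψ, hΘ.noise_eq ψ (e ▸ memLp_solSymbol hκ hA hF φ r)]
  congr 1
  exact MemLp.toLp_congr _ _ (by rw [e])

theorem integral_solSymbol {t : ℝ} (ht : 0 ≤ t) (φ : 𝓢(Eu d, ℝ)) (ξ : Eu d) :
    ∫ s in Ioo 0 t, solSymbol G φ (t - s) ξ
      = starRingEnd ℂ (Hfun G t ξ) * fourierS (ofR φ) ξ := by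
  simp only [solSymbol]
  rw [integral_mul_const, integral_conj, Hfun_eq t ξ ht, intervalIntegral.integral_of_le ht,
    integral_Ioc_eq_integral_Ioo]

theorem integral_solSymbol_version [SigmaFinite P] (hκ : KernelAssumption κ h) (hA : HypA G)
    (hF : HypF G)
    (φ : 𝓢(Eu d, ℝ)) {t : ℝ} (ht : 0 ≤ t) {Y : ℝ → Ω → ℝ} (hY : Measurable (Function.uncurry Y))
    (hYw : ∀ s ∈ Ioo 0 t,
      Y s =ᵐ[P] Θ ((memLp_solSymbol hκ hA hF φ (t - s)).toLp (solSymbol G φ (t - s)))) :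
    (∀ᵐ ω ∂P, IntegrableOn (fun s => Y s ω) (Icc 0 t)) ∧
      (fun ω => ∫ s in (0 : ℝ)..t, Y s ω) =ᵐ[P] Θ ((memLp_Hfun_mul hκ hA hF φ ht).toLp _) := by
  obtain ⟨hw', h1, h2⟩ := integral_spectralIntegral (l := volume.restrict (Ioo 0 t)) Θ
    (w := fun s => solSymbol G φ (t - s))
    ((measurable_solSymbol hA hF φ).comp
      ((measurable_const.sub measurable_fst).prodMk measurable_snd))
    (fun s => memLp_solSymbol hκ hA hF φ (t - s)) (integrableOn_solSymbol hκ hA hF φ t) hY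
    ((ae_restrict_mem measurableSet_Ioo).mono hYw)
  refine ⟨?_, ?_⟩
  · filter_upwards [h1] with ω hω
    rwa [integrableOn_Icc_iff_integrableOn_Ioo]
  · refine (EventuallyEq.of_eq (funext fun ω => ?_)).trans (h2.trans (EventuallyEq.of_eq ?_))
    · rw [intervalIntegral.integral_of_le ht, integral_Ioc_eq_integral_Ioo]
    · rw [MemLp.toLp_congr hw' (memLp_Hfun_mul hκ hA hF φ ht)
        (Eventually.of_forall fun ξ => integral_solSymbol ht φ ξ)]

theorem IsDistributionSolution.ae_eq [SigmaFinite P] (hΘ : IsSpectralIntegral κ h ν N P Θ)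
    (hκ : KernelAssumption κ h) (hA : HypA G) (hF : HypF G)
    {v : ℝ≥0 → 𝓢(Eu d, ℝ) → Ω → ℝ} (hv : IsDistributionSolution κ ν N P G v)
    {t : ℝ≥0} (ht : 0 < t) {φ : 𝓢(Eu d, ℝ)} (hφ : HasCompactSupport φ) :
    v t φ =ᵐ[P] Θ ((memLp_Hfun_mul hκ hA hF φ t.2).toLp _) := by
  obtain ⟨Y, hY, hYn, -, hvY⟩ := hv t ht φ hφ
  refine hvY.trans (integral_solSymbol_version hκ hA hF φ t.2 hY fun s hs => ?_).2
  rw [← noise_convTilde hΘ hκ hA hF hφ (sub_pos.2 hs.2)]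
  exact hYn s ⟨hs.1.le, hs.2⟩

theorem exists_isDistributionSolution [IsProbabilityMeasure P]
    (hΘ : IsSpectralIntegral κ h ν N P Θ) (hκ : KernelAssumption κ h) (hA : HypA G) (hF : HypF G) :
    ∃ v : ℝ≥0 → 𝓢(Eu d, ℝ) → Ω → ℝ, IsDistributionSolution κ ν N P G v := by
  have key : ∀ (t : ℝ≥0) (φ : 𝓢(Eu d, ℝ)), ∃ v : Ω → ℝ, HasCompactSupport φ →
      ∃ Y : ℝ → Ω → ℝ, Measurable (Function.uncurry Y) ∧
        (∀ s ∈ Ico (0 : ℝ) t, Y s =ᵐ[P] noise κ ν N P (convTilde (G (t - s)) φ)) ∧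
        (∀ᵐ ω ∂P, IntegrableOn (fun s => Y s ω) (Icc (0 : ℝ) t)) ∧
        v =ᵐ[P] fun ω => ∫ s in (0 : ℝ)..t, Y s ω := by
    intro t φ
    -- Mean-square continuity holds only for positive times, so the modification is built in
    -- logarithmic time and pulled back by s ↦ log(t - s); for s ≥ t the value is set to 0.
    have hc : Continuous fun r : ℝ => Θ ((memLp_solSymbol hκ hA hF φ (Real.exp r)).toLp
        (solSymbol G φ (Real.exp r))) :=
      Θ.continuous.comp ((continuousOn_solSymbol hκ hA hF φ).comp_continuous Real.continuous_exp
        fun r => Real.exp_pos r)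
    obtain ⟨Y, hY, hYe⟩ := exists_measurable_modification _ hc
    let Z : ℝ → Ω → ℝ := fun s ω => if s < t then Y (Real.log (t - s)) ω else 0
    have hZ : Measurable (Function.uncurry Z) := by
      refine Measurable.ite (measurableSet_lt measurable_fst measurable_const)
        (hY.comp (Measurable.prodMk ?_ measurable_snd)) measurable_const
      exact Real.measurable_log.comp (measurable_const.sub measurable_fst)
    have hZs : ∀ s < (t : ℝ), Z s =ᵐ[P]
        Θ ((memLp_solSymbol hκ hA hF φ (t - s)).toLp (solSymbol G φ (t - s))) := fun s hs => by
      have h1 := hYe (Real.log (t - s))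
      rw [Real.exp_log (sub_pos.2 hs)] at h1
      refine (EventuallyEq.of_eq (funext fun ω => ?_)).trans h1
      exact if_pos hs
    refine ⟨fun ω => ∫ s in (0 : ℝ)..t, Z s ω, fun hφ => ⟨Z, hZ, fun s hs => ?_, ?_,
      EventuallyEq.rfl⟩⟩
    · rw [noise_convTilde hΘ hκ hA hF hφ (sub_pos.2 hs.2)]
      exact hZs s hs.2
    · exact (integral_solSymbol_version hκ hA hF φ t.2 hZ fun s hs => hZs s hs.2).1
  choose v hv using key
  exact ⟨v, fun t _ φ hφ => hv t φ hφ⟩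

end DistributionSolution

/-! ### Approximate identities and their transforms. -/

section ApproximateIdentity

variable {d : ℕ}

/-- A sequence of bump functions at the origin with shrinking supports. -/
def bumpSeq (d n : ℕ) : ContDiffBump (0 : Eu d) :=
  ⟨1 / (2 * ((n : ℝ) + 1)), 1 / ((n : ℝ) + 1), by positivity,
    one_div_lt_one_div_of_lt (by positivity) (by linarith [(by positivity : (0 : ℝ) < n + 1)])⟩

theorem hasCompactSupport_normed_sub (x : Eu d) (n : ℕ) :
    HasCompactSupport fun y => (bumpSeq d n).normed volume (x - y) :=
  ((bumpSeq d n).hasCompactSupport_normed (μ := volume)).comp_homeomorph (Homeomorph.subLeft x)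

/-- An approximate identity at `x`. -/
def approxId (x : Eu d) (n : ℕ) : 𝓢(Eu d, ℝ) :=
  (hasCompactSupport_normed_sub x n).toSchwartzMap
    ((bumpSeq d n).contDiff_normed.comp (contDiff_const.sub contDiff_id))

theorem approxId_apply (x : Eu d) (n : ℕ) (y : Eu d) :
    approxId x n y = (bumpSeq d n).normed volume (x - y) := rfl

theorem hasCompactSupport_approxId (x : Eu d) (n : ℕ) : HasCompactSupport (approxId x n) :=
  hasCompactSupport_normed_sub x n

theorem tendsto_approxId {F : Type*} [NormedAddCommGroup F] [NormedSpace ℝ F] [CompleteSpace F]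
    {g : Eu d → F} (hg : Continuous g) (x : Eu d) :
    Tendsto (fun n => ∫ y, approxId x n y • g y) atTop (𝓝 (g x)) := by
  have h1 := ContDiffBump.convolution_tendsto_right_of_continuous (μ := (volume : Measure (Eu d)))
    (φ := bumpSeq d) tendsto_one_div_add_atTop_nhds_zero_nat hg x
  simp only [convolution_lsmul_swap] at h1
  exact h1

theorem norm_fourierS_approxId_le (x : Eu d) (n : ℕ) (ξ : Eu d) :
    ‖fourierS (ofR (approxId x n)) ξ‖ ≤ 1 := by
  rw [fourierS_eq]
  refine (norm_integral_le_integral_norm _).trans (le_of_eq ?_)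
  have h1 : ∀ y, ‖chr ξ (-y) * ofR (approxId x n) y‖ = (bumpSeq d n).normed volume (x - y) := by
    intro y
    rw [norm_mul, norm_chr, one_mul, ← approxId_apply]
    change ‖((approxId x n y : ℝ) : ℂ)‖ = _
    rw [Complex.norm_real, Real.norm_of_nonneg]
    exact (bumpSeq d n).nonneg_normed _
  simp_rw [h1]
  rw [integral_sub_left_eq_self (fun y => (bumpSeq d n).normed volume y) volume x]
  exact (bumpSeq d n).integral_normed

theorem tendsto_fourierS_approxId (x ξ : Eu d) :
    Tendsto (fun n => fourierS (ofR (approxId x n)) ξ) atTop (𝓝 (chr ξ (-x))) := by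
  have h1 := tendsto_approxId (g := fun y => chr ξ (-y)) (by fun_prop) x
  refine h1.congr fun n => ?_
  rw [fourierS_eq]
  refine integral_congr_ae (Eventually.of_forall fun y => ?_)
  simp [mul_comm]

end ApproximateIdentity

/-! ### Sufficiency: construction of the field. -/

section FieldVersion

variable {d : ℕ} {Ω : Type*} [MeasurableSpace Ω] {P : Measure Ω} {ν : Measure ℝ}
  {N : Ω → Measure (Eu d × ℝ)} {κ : Eu d → ℝ≥0∞} {h : Eu d → ℂ} {G : ℝ → RealDist d}
  {Θ : Lp ℂ 2 (spectralMeasure h) →L[ℝ] Lp ℝ 2 P}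

/-- The symbol `exp(-i ξ·x) conj (H_t(ξ))` of the field version. -/
def fieldSymbol (G : ℝ → RealDist d) (t : ℝ≥0) (x ξ : Eu d) : ℂ :=
  chr ξ (-x) * starRingEnd ℂ (Hfun G t ξ)

theorem fieldSymbol_zero (x : Eu d) : fieldSymbol G 0 x = 0 := by
  ext ξ; simp [fieldSymbol, Hfun_zero]

theorem fieldSymbol_neg (hA : HypA G) (hF : HypF G) (t : ℝ≥0) (x ξ : Eu d) :
    fieldSymbol G t x (-ξ) = starRingEnd ℂ (fieldSymbol G t x ξ) := by
  rw [fieldSymbol, fieldSymbol, Hfun_neg hA hF t.coe_nonneg, map_mul, ← chr_neg_eq_conj]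
  simp

theorem enorm_fieldSymbol_sub (t s : ℝ≥0) (x ξ : Eu d) :
    ‖fieldSymbol G t x ξ - fieldSymbol G s x ξ‖ₑ = ‖Hfun G t ξ - Hfun G s ξ‖ₑ := by
  rw [fieldSymbol, fieldSymbol, ← mul_sub, ← map_sub, ← ofReal_norm, norm_mul, norm_chr, one_mul,
    RCLike.norm_conj, ofReal_norm]

theorem enorm_fieldSymbol (t : ℝ≥0) (x ξ : Eu d) :
    ‖fieldSymbol G t x ξ‖ₑ = ‖Hfun G t ξ‖ₑ := by
  rw [fieldSymbol, ← ofReal_norm, norm_mul, norm_chr, one_mul, RCLike.norm_conj, ofReal_norm]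

theorem measurable_fieldSymbol (hA : HypA G) (hF : HypF G) (t : ℝ≥0) :
    Measurable (Function.uncurry (fieldSymbol G t)) := by
  have h1 : Continuous fun p : Eu d × Eu d => chr p.2 (-p.1) := by fun_prop
  exact h1.measurable.mul
    (Complex.continuous_conj.measurable.comp ((measurable_Hfun hA hF t.2).comp measurable_snd))

theorem memLp_fieldSymbol (hA : HypA G) (hF : HypF G) {t : ℝ≥0}
    (hH : ∫⁻ ξ, ‖Hfun G t ξ‖ₑ ^ 2 ∂(spectralMeasure h) < ∞) (x : Eu d) :
    MemLp (fieldSymbol G t x) 2 (spectralMeasure h) := by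
  refine (memLp_two_iff_lintegral ?_).2 ?_
  · exact ((measurable_fieldSymbol hA hF t).comp measurable_prodMk_left).aestronglyMeasurable
  · simpa only [enorm_fieldSymbol] using hH

theorem lintegral_enorm_sub_sq {F : Type*} [NormedAddCommGroup F] {f g : Lp F 2 P} {Y Z : Ω → F}
    (hY : Y =ᵐ[P] f) (hZ : Z =ᵐ[P] g) : ∫⁻ ω, ‖Y ω - Z ω‖ₑ ^ 2 ∂P = ‖f - g‖ₑ ^ 2 := by
  rw [enorm_Lp_sq]
  refine lintegral_congr_ae ?_
  filter_upwards [hY, hZ, Lp.coeFn_sub f g] with ω h1 h2 h3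
  rw [h1, h2, h3, Pi.sub_apply]

theorem lintegral_enorm_sq {F : Type*} [NormedAddCommGroup F] {f : Lp F 2 P} {Y : Ω → F}
    (hY : Y =ᵐ[P] f) : ∫⁻ ω, ‖Y ω‖ₑ ^ 2 ∂P = ‖f‖ₑ ^ 2 := by
  rw [enorm_Lp_sq]
  exact lintegral_congr_ae (hY.mono fun ω h => by simp only [h])

theorem IsSpectralIntegral.enorm_sub_sq (hΘ : IsSpectralIntegral κ h ν N P Θ) (hA : HypA G)
    (hF : HypF G) {t s : ℝ≥0} {x : Eu d} (ht : MemLp (fieldSymbol G t x) 2 (spectralMeasure h))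
    (hs : MemLp (fieldSymbol G s x) 2 (spectralMeasure h)) :
    ‖Θ (ht.toLp _) - Θ (hs.toLp _)‖ₑ ^ 2
      = jumpVar ν * ∫⁻ ξ, ‖Hfun G t ξ - Hfun G s ξ‖ₑ ^ 2 ∂(spectralMeasure h) := by
  rw [← map_sub, ← MemLp.toLp_sub, hΘ.enorm_sq]
  · simp only [Pi.sub_apply, enorm_fieldSymbol_sub]
  · intro ξ
    simp only [Pi.sub_apply, map_sub, fieldSymbol_neg hA hF]

theorem IsSpectralIntegral.enorm_fieldSymbol_sq (hΘ : IsSpectralIntegral κ h ν N P Θ)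
    (hA : HypA G) (hF : HypF G) {t : ℝ≥0} {x : Eu d}
    (ht : MemLp (fieldSymbol G t x) 2 (spectralMeasure h)) :
    ‖Θ (ht.toLp _)‖ₑ ^ 2 = jumpVar ν * ∫⁻ ξ, ‖Hfun G t ξ‖ₑ ^ 2 ∂(spectralMeasure h) := by
  rw [hΘ.enorm_sq _ _ (fieldSymbol_neg hA hF t x)]
  simp only [enorm_fieldSymbol]

/-- The condition is applied on [0, t + 1], as it requires a positive horizon and t may be 0. -/
theorem CondBounded.lt_top (hb : CondBounded G h) (t : ℝ≥0) :
    ∫⁻ ξ, ‖Hfun G t ξ‖ₑ ^ 2 ∂(spectralMeasure h) < ∞ :=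
  (le_iSup₂_of_le (f := fun t _ => ∫⁻ ξ, ‖Hfun G t ξ‖ₑ ^ 2 ∂(spectralMeasure h)) (t : ℝ)
    (⟨t.2, (lt_add_one _).le⟩ : (t : ℝ) ∈ Icc (0 : ℝ) (t + 1)) le_rfl).trans_lt
      (hb (t + 1) (add_pos_of_nonneg_of_pos t.2 one_pos))

theorem tendsto_coe_nhdsWithin (s : ℝ≥0) :
    Tendsto ((↑) : ℝ≥0 → ℝ) (𝓝 s) (𝓝[Ici 0] (s : ℝ)) :=
  tendsto_nhdsWithin_iff.2 ⟨NNReal.continuous_coe.tendsto s, Eventually.of_forall fun t => t.2⟩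

theorem continuous_fieldSymbol_right (hA : HypA G) (hF : HypF G) {t : ℝ≥0}
    (hm : ∀ x : Eu d, MemLp (fieldSymbol G t x) 2 (spectralMeasure h)) :
    Continuous fun x => (hm x).toLp (fieldSymbol G t x) := by
  refine continuous_iff_continuousAt.2 fun x => ?_
  refine tendsto_toLp (b := fun ξ => ‖Hfun G t ξ‖ₑ)
    (fun y => (measurable_fieldSymbol hA hF t).comp measurable_prodMk_left)
    ((measurable_fieldSymbol hA hF t).comp (measurable_prodMk_left (x := x))) _ _ ?_
    (Eventually.of_forall fun y ξ => (enorm_fieldSymbol t y ξ).le)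
    (fun ξ => (enorm_fieldSymbol t x ξ).le) fun ξ => ?_
  · have := (memLp_two_iff_lintegral (hm x).1).1 (hm x)
    simp only [enorm_fieldSymbol] at this
    exact this.ne
  · have h4 : Continuous fun y => chr ξ (-y) * starRingEnd ℂ (Hfun G t ξ) := by fun_prop
    exact h4.tendsto x

/-- The step from (t,y) to (s,x) passes through (s,y). The time increment has a norm that does not
depend on y, so continuity in space is needed only at the fixed time s. -/
theorem continuous_fieldSymbol (hA : HypA G) (hF : HypF G) (hc : CondContinuous G h)
    (hm : ∀ (t : ℝ≥0) (x : Eu d), MemLp (fieldSymbol G t x) 2 (spectralMeasure h)) :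
    Continuous fun q : ℝ≥0 × Eu d => (hm q.1 q.2).toLp (fieldSymbol G q.1 q.2) := by
  refine continuous_iff_continuousAt.2 fun ⟨s, x⟩ => ?_
  rw [ContinuousAt, tendsto_iff_edist_tendsto_0]
  have h1 : Tendsto (fun q : ℝ≥0 × Eu d => edist ((hm q.1 q.2).toLp (fieldSymbol G q.1 q.2))
      ((hm s q.2).toLp (fieldSymbol G s q.2))) (𝓝 (s, x)) (𝓝 0) := by
    refine tendsto_zero_of_sq ?_
    have h2 := (hc s s.2).comp ((tendsto_coe_nhdsWithin s).comp
      (continuous_fst.tendsto ((s, x) : ℝ≥0 × Eu d)))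
    refine h2.congr fun q => ?_
    rw [edist_eq_enorm_sub, ← MemLp.toLp_sub, enorm_toLp_sq]
    simp only [Pi.sub_apply, enorm_fieldSymbol_sub, Function.comp_apply]
  have h3 := (continuous_fieldSymbol_right hA hF (hm s)).tendsto x
  rw [tendsto_iff_edist_tendsto_0] at h3
  have h5 := h1.add (h3.comp (continuous_snd.tendsto ((s, x) : ℝ≥0 × Eu d)))
  rw [add_zero] at h5
  exact tendsto_of_tendsto_of_tendsto_of_le_of_le tendsto_const_nhds h5 (fun _ => zero_le)
    fun q => edist_triangle _ _ _

/-- Integrating e^{-iξ·x} against φ(x) reproduces 𝓕φ(ξ), so the tested field has the symbol of the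
distribution solution. -/
theorem integral_fieldSymbol_version [SigmaFinite P] (hκ : KernelAssumption κ h) (hA : HypA G)
    (hF : HypF G) {t : ℝ≥0} (hm : ∀ x, MemLp (fieldSymbol G t x) 2 (spectralMeasure h))
    (hct : Continuous fun x => (hm x).toLp (fieldSymbol G t x)) {Y : Eu d → Ω → ℝ}
    (hY : Measurable (Function.uncurry Y)) (hYe : ∀ x, Y x =ᵐ[P] Θ ((hm x).toLp _))
    {φ : 𝓢(Eu d, ℝ)} (hφ : HasCompactSupport φ) :
    (fun ω => ∫ x, Y x ω * φ x) =ᵐ[P] Θ ((memLp_Hfun_mul hκ hA hF φ t.coe_nonneg).toLp _) := by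
  have hw : ∀ x, MemLp (fun ξ => (φ x : ℂ) * fieldSymbol G t x ξ) 2 (spectralMeasure h) :=
    fun x => (hm x).const_mul _
  have hwe : ∀ x, (hw x).toLp _ = φ x • (hm x).toLp _ := fun x => rfl
  have hwm : Measurable (Function.uncurry fun x ξ => (φ x : ℂ) * fieldSymbol G t x ξ) :=
    (Complex.measurable_ofReal.comp (φ.continuous.measurable.comp measurable_fst)).mul
      (measurable_fieldSymbol hA hF t)
  have hi : Integrable fun x => (hw x).toLp _ := by
    simp only [hwe]
    exact (φ.continuous.smul hct).integrable_of_hasCompactSupport hφ.smul_right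
  have hYm : Measurable (Function.uncurry fun x ω => Y x ω * φ x) :=
    hY.mul (φ.continuous.measurable.comp measurable_fst)
  obtain ⟨hw', h1, h2⟩ := integral_spectralIntegral Θ hwm hw hi hYm
    (Eventually.of_forall fun x => by
      rw [hwe, map_smul]
      filter_upwards [hYe x, Lp.coeFn_smul (φ x) (Θ ((hm x).toLp _))] with ω h3 h4
      rw [h4, h3, Pi.smul_apply, smul_eq_mul, mul_comm])
  refine h2.trans (EventuallyEq.of_eq ?_)
  rw [MemLp.toLp_congr hw' (memLp_Hfun_mul hκ hA hF φ t.coe_nonneg)]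
  refine Eventually.of_forall fun ξ => ?_
  simp only [fieldSymbol]
  rw [fourierS_eq, ← integral_const_mul]
  refine integral_congr_ae (Eventually.of_forall fun x => ?_)
  simp only [SchwartzMap.postcompCLM_apply, Complex.ofRealCLM_apply]
  ring

theorem exists_isFieldVersion [IsProbabilityMeasure P] (hν : IsJumpMeasure ν)
    (hΘ : IsSpectralIntegral κ h ν N P Θ) (hκ : KernelAssumption κ h) (hA : HypA G) (hF : HypF G)
    (hb : CondBounded G h) (hc : CondContinuous G h)
    {v : ℝ≥0 → 𝓢(Eu d, ℝ) → Ω → ℝ} (hv : IsDistributionSolution κ ν N P G v) :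
    ∃ V : ℝ≥0 → Eu d → Ω → ℝ, IsFieldVersion P v V := by
  have hm := fun (t : ℝ≥0) (x : Eu d) => memLp_fieldSymbol (h := h) hA hF (hb.lt_top t) x
  have hcont := continuous_fieldSymbol hA hF hc hm
  have hΘc := Θ.continuous.comp hcont
  obtain ⟨Y, hY, hYe⟩ : ∃ Y : ℝ≥0 × Eu d → Ω → ℝ, Measurable (Function.uncurry Y) ∧
      ∀ q, Y q =ᵐ[P] Θ ((hm q.1 q.2).toLp (fieldSymbol G q.1 q.2)) :=
    exists_measurable_modification _ hΘc
  refine ⟨fun t x => Y (t, x), ⟨?_, ?_, ?_, ?_⟩⟩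
  · exact hY.comp ((measurable_fst.prodMk (measurable_fst.comp measurable_snd)).prodMk
      (measurable_snd.comp measurable_snd))
  · intro T K _
    have h1 := hb (T + 1) (add_pos_of_nonneg_of_pos T.2 one_pos)
    refine lt_of_le_of_lt ?_ (ENNReal.mul_lt_top hν.second_moment h1)
    refine iSup₂_le fun t ht => iSup₂_le fun x _ => ?_
    rw [lintegral_enorm_sq (hYe (t, x))]
    refine (hΘ.enorm_fieldSymbol_sq hA hF (hm t x)).trans_le ?_
    refine mul_le_mul_right ?_ _
    exact le_iSup₂_of_le (f := fun t _ => ∫⁻ ξ, ‖Hfun G t ξ‖ₑ ^ 2 ∂(spectralMeasure h)) (t : ℝ)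
      ⟨t.2, (NNReal.coe_le_coe.2 ht).trans (lt_add_one _).le⟩ le_rfl
  · intro t x
    have h1 := hΘc.tendsto (t, x)
    rw [tendsto_iff_edist_tendsto_0] at h1
    have h2 := (ENNReal.continuous_pow 2).tendsto _ |>.comp h1
    simp only [ne_eq, OfNat.ofNat_ne_zero, not_false_eq_true, zero_pow] at h2
    refine h2.congr fun q => ?_
    rw [lintegral_enorm_sub_sq (hYe (q.1, q.2)) (hYe (t, x)), ← edist_eq_enorm_sub]
    rfl
  · intro t ht φ hφ
    have hct := continuous_fieldSymbol_right hA hF (hm t)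
    have hYt : Measurable (Function.uncurry fun x ω => Y (t, x) ω) :=
      hY.comp ((measurable_const.prodMk measurable_fst).prodMk measurable_snd)
    have hYe' : ∀ x, Y (t, x) =ᵐ[P] Θ ((hm t x).toLp (fieldSymbol G t x)) := fun x => hYe (t, x)
    have h1 := integral_fieldSymbol_version hκ hA hF (hm t) hct hYt hYe' hφ
    have h2 := hv.ae_eq hΘ hκ hA hF ht hφ
    exact h2.trans h1.symm

end FieldVersion

/-! ### Necessity: every field version is a spectral integral. -/

section FieldVersionNecessary

variable {d : ℕ} {Ω : Type*} [MeasurableSpace Ω] {P : Measure Ω} {ν : Measure ℝ}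
  {N : Ω → Measure (Eu d × ℝ)} {κ : Eu d → ℝ≥0∞} {h : Eu d → ℂ} {G : ℝ → RealDist d}
  {Θ : Lp ℂ 2 (spectralMeasure h) →L[ℝ] Lp ℝ 2 P}
  {v : ℝ≥0 → 𝓢(Eu d, ℝ) → Ω → ℝ} {V : ℝ≥0 → Eu d → Ω → ℝ}

theorem IsJumpMeasure.jumpVar_ne_top (hν : IsJumpMeasure ν) : jumpVar ν ≠ ∞ :=
  hν.second_moment.ne

theorem IsFieldVersion.memLp (hV : IsFieldVersion P v V) (t : ℝ≥0) (x : Eu d) :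
    MemLp (V t x) 2 P := by
  have hm : Measurable (V t x) :=
    hV.measurable.comp (measurable_const.prodMk (measurable_const.prodMk measurable_id))
  refine (memLp_two_iff_lintegral hm.aestronglyMeasurable).2 ?_
  refine lt_of_le_of_lt ?_ (hV.locally_bounded t {x} isCompact_singleton)
  exact le_iSup₂_of_le (f := fun t _ => ⨆ x' ∈ ({x} : Set (Eu d)), ∫⁻ ω, ‖V t x' ω‖ₑ ^ 2 ∂P) t
    (mem_Iic.2 le_rfl) (le_iSup₂_of_le (f := fun x' _ => ∫⁻ ω, ‖V t x' ω‖ₑ ^ 2 ∂P) x rfl le_rfl)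

theorem IsFieldVersion.continuous_toLp_right (hV : IsFieldVersion P v V) (t : ℝ≥0) :
    Continuous fun x : Eu d => (hV.memLp t x).toLp (V t x) := by
  refine continuous_iff_continuousAt.2 fun x => ?_
  rw [ContinuousAt, tendsto_iff_edist_tendsto_0]
  have h1 := (hV.ms_continuous t x).comp
    ((Continuous.prodMk_right (Y := Eu d) t).tendsto x)
  refine tendsto_zero_of_sq (h1.congr fun y => ?_)
  rw [edist_eq_enorm_sub, ← lintegral_enorm_sub_sq (hV.memLp t y).coeFn_toLp.symm
    (hV.memLp t x).coeFn_toLp.symm]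
  rfl

/-- Testing a field version with an approximate identity. -/
theorem IsFieldVersion.tendsto_approxId [IsProbabilityMeasure P]
    (hV : IsFieldVersion P v V) (hΘ : IsSpectralIntegral κ h ν N P Θ)
    (hκ : KernelAssumption κ h) (hA : HypA G) (hF : HypF G)
    (hv : IsDistributionSolution κ ν N P G v) {t : ℝ≥0} (ht : 0 < t) (x : Eu d) :
    Tendsto (fun n => Θ ((memLp_Hfun_mul hκ hA hF (approxId x n) t.coe_nonneg).toLp _)) atTop
      (𝓝 ((hV.memLp t x).toLp (V t x))) := by
  have hc := hV.continuous_toLp_right t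
  refine (LevySPDE.tendsto_approxId hc x).congr fun n => ?_
  set φ := approxId x n
  have hφ := hasCompactSupport_approxId x n
  have hm : Measurable (Function.uncurry fun y ω => V t y ω * φ y) :=
    (hV.measurable.comp (measurable_const.prodMk measurable_id)).mul
      (φ.continuous.measurable.comp measurable_fst)
  have hi : Integrable fun y => φ y • (hV.memLp t y).toLp (V t y) :=
    (φ.continuous.smul hc).integrable_of_hasCompactSupport hφ.smul_right
  obtain ⟨-, h1⟩ := integral_Lp_two_ae_eq hi hm (Eventually.of_forall fun y => by
    filter_upwards [(hV.memLp t y).coeFn_toLp, Lp.coeFn_smul (φ y) ((hV.memLp t y).toLp (V t y))]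
      with ω h3 h4
    rw [h4, Pi.smul_apply, h3, smul_eq_mul, mul_comm])
  exact Lp.ext (h1.trans ((hV.representation t ht φ hφ).symm.trans
    (hv.ae_eq hΘ hκ hA hF ht hφ)))

/-- The symbols of the solution tested with an approximate identity tend to |H_t| in modulus. Their
L²(μ) norms are those of the tested solutions, which converge to V(t,0), up to m₂. Fatou's lemma
bounds the limit. -/
theorem IsFieldVersion.lintegral_Hfun_lt_top [IsProbabilityMeasure P]
    (hV : IsFieldVersion P v V) (hν : IsJumpMeasure ν) (hΘ : IsSpectralIntegral κ h ν N P Θ)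
    (hκ : KernelAssumption κ h) (hA : HypA G) (hF : HypF G)
    (hv : IsDistributionSolution κ ν N P G v) {t : ℝ≥0} (ht : 0 < t) :
    ∫⁻ ξ, ‖Hfun G t ξ‖ₑ ^ 2 ∂(spectralMeasure h) < ∞ := by
  have hlim := hV.tendsto_approxId hΘ hκ hA hF hv ht 0
  set w : ℕ → Eu d → ℂ := fun n ξ =>
    starRingEnd ℂ (Hfun G t ξ) * fourierS (ofR (approxId 0 n)) ξ with hw
  have hHm := measurable_Hfun hA hF t.coe_nonneg
  have hwm : ∀ n, Measurable (w n) := fun n =>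
    (Complex.continuous_conj.measurable.comp hHm).mul
      (fourierS (ofR (approxId 0 n))).continuous.measurable
  have h1 : ∀ n, ∫⁻ ξ, ‖w n ξ‖ₑ ^ 2 ∂(spectralMeasure h) = (jumpVar ν)⁻¹ *
      ‖Θ ((memLp_Hfun_mul hκ hA hF (approxId 0 n) t.coe_nonneg).toLp _)‖ₑ ^ 2 := fun n => by
    rw [hΘ.enorm_sq, ← mul_assoc,
      ENNReal.inv_mul_cancel hν.jumpVar_ne_zero hν.jumpVar_ne_top, one_mul]
    intro ξ
    rw [map_mul, Hfun_neg hA hF t.coe_nonneg, conj_fourierS_ofR]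
  have h2 : Tendsto (fun n => ∫⁻ ξ, ‖w n ξ‖ₑ ^ 2 ∂(spectralMeasure h)) atTop
      (𝓝 ((jumpVar ν)⁻¹ * ‖(hV.memLp t 0).toLp (V t 0)‖ₑ ^ 2)) := by
    simp_rw [h1]
    exact ENNReal.Tendsto.const_mul ((ENNReal.continuous_pow 2).tendsto _ |>.comp hlim.enorm)
      (Or.inr (ENNReal.inv_ne_top.2 hν.jumpVar_ne_zero))
  have h3 : ∀ ξ, Tendsto (fun n => ‖w n ξ‖ₑ ^ 2) atTop (𝓝 (‖Hfun G t ξ‖ₑ ^ 2)) := fun ξ => by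
    have h4 := ((tendsto_fourierS_approxId 0 ξ).const_mul (starRingEnd ℂ (Hfun G t ξ))).enorm
    have h5 : ‖starRingEnd ℂ (Hfun G t ξ) * chr ξ (-0)‖ₑ = ‖Hfun G t ξ‖ₑ := by
      rw [← ofReal_norm, norm_mul, norm_chr, mul_one, RCLike.norm_conj, ofReal_norm]
    rw [h5] at h4
    exact (ENNReal.continuous_pow 2).tendsto _ |>.comp h4
  calc ∫⁻ ξ, ‖Hfun G t ξ‖ₑ ^ 2 ∂(spectralMeasure h)
      = ∫⁻ ξ, liminf (fun n => ‖w n ξ‖ₑ ^ 2) atTop ∂(spectralMeasure h) :=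
        lintegral_congr fun ξ => (h3 ξ).liminf_eq.symm
    _ ≤ liminf (fun n => ∫⁻ ξ, ‖w n ξ‖ₑ ^ 2 ∂(spectralMeasure h)) atTop :=
        lintegral_liminf_le fun n => by have := hwm n; fun_prop
    _ = (jumpVar ν)⁻¹ * ‖(hV.memLp t 0).toLp (V t 0)‖ₑ ^ 2 := h2.liminf_eq
    _ < ∞ := ENNReal.mul_lt_top (ENNReal.inv_lt_top.2 (pos_iff_ne_zero.2 hν.jumpVar_ne_zero))
        (by finiteness)

theorem IsFieldVersion.memLp_fieldSymbol [IsProbabilityMeasure P]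
    (hV : IsFieldVersion P v V) (hν : IsJumpMeasure ν) (hΘ : IsSpectralIntegral κ h ν N P Θ)
    (hκ : KernelAssumption κ h) (hA : HypA G) (hF : HypF G)
    (hv : IsDistributionSolution κ ν N P G v) (t : ℝ≥0) (x : Eu d) :
    MemLp (fieldSymbol G t x) 2 (spectralMeasure h) := by
  rcases eq_or_ne t 0 with rfl | ht
  · rw [fieldSymbol_zero]; exact MemLp.zero
  · exact LevySPDE.memLp_fieldSymbol hA hF
      (hV.lintegral_Hfun_lt_top hν hΘ hκ hA hF hv (pos_iff_ne_zero.2 ht)) x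

/-- With H_t in L²(μ), the symbols tested at x converge by domination to e^{-iξ·x} conj H_t, and Θ
of this limit must be the limit V(t,x) of the tested solutions. -/
theorem IsFieldVersion.toLp_eq_of_pos [IsProbabilityMeasure P]
    (hV : IsFieldVersion P v V) (hΘ : IsSpectralIntegral κ h ν N P Θ)
    (hκ : KernelAssumption κ h) (hA : HypA G) (hF : HypF G)
    (hv : IsDistributionSolution κ ν N P G v) {t : ℝ≥0} (ht : 0 < t) {x : Eu d}
    (hm : MemLp (fieldSymbol G t x) 2 (spectralMeasure h)) :
    (hV.memLp t x).toLp (V t x) = Θ (hm.toLp _) := by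
  refine tendsto_nhds_unique (hV.tendsto_approxId hΘ hκ hA hF hv ht x)
    ((Θ.continuous.tendsto _).comp ?_)
  have hHm := measurable_Hfun hA hF t.coe_nonneg
  refine tendsto_toLp (b := fun ξ => ‖Hfun G t ξ‖ₑ)
    (w := fun n ξ => starRingEnd ℂ (Hfun G t ξ) * fourierS (ofR (approxId x n)) ξ) (fun n =>
    (Complex.continuous_conj.measurable.comp hHm).mul
      (fourierS (ofR (approxId x n))).continuous.measurable)
    ((measurable_fieldSymbol hA hF t).comp (measurable_prodMk_left (x := x))) _ _ ?_
    (Eventually.of_forall fun n ξ => ?_) (fun ξ => (enorm_fieldSymbol t x ξ).le) fun ξ => ?_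
  · have := (memLp_two_iff_lintegral hm.1).1 hm
    simp only [enorm_fieldSymbol] at this
    exact this.ne
  · rw [← ofReal_norm, ← ofReal_norm, norm_mul, RCLike.norm_conj]
    exact ENNReal.ofReal_le_ofReal (mul_le_of_le_one_right (norm_nonneg _)
      (norm_fourierS_approxId_le x n ξ))
  · change Tendsto _ _ (𝓝 (chr ξ (-x) * starRingEnd ℂ (Hfun G t ξ)))
    rw [mul_comm]
    exact (tendsto_fourierS_approxId x ξ).const_mul _

theorem toLp_eq_zero {α F : Type*} [MeasurableSpace α] [NormedAddCommGroup F] {m : Measure α}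
    {f : α → F} (hf : MemLp f 2 m) (h0 : f = 0) : hf.toLp f = 0 := by
  subst h0
  exact MemLp.toLp_zero hf

/-- Nothing relates V(0,x) to the equation, so it is reached by continuity. Since H_{s_n} → 0
pointwise as s_n ↓ 0, Fatou gives ‖V(t,x)‖ ≤ ‖V(t,x) - V(0,x)‖ for t > 0; letting t → 0 forces
V(0,x) = 0. -/
theorem IsFieldVersion.toLp_zero [IsProbabilityMeasure P]
    (hV : IsFieldVersion P v V) (hν : IsJumpMeasure ν) (hΘ : IsSpectralIntegral κ h ν N P Θ)
    (hκ : KernelAssumption κ h) (hA : HypA G) (hF : HypF G)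
    (hv : IsDistributionSolution κ ν N P G v) (x : Eu d) :
    (hV.memLp 0 x).toLp (V 0 x) = 0 := by
  set f : ℝ≥0 → Lp ℝ 2 P := fun t => (hV.memLp t x).toLp (V t x) with hf
  have hm := fun t => hV.memLp_fieldSymbol hν hΘ hκ hA hF hv t x
  have hfc : Tendsto f (𝓝 0) (𝓝 (f 0)) := by
    rw [tendsto_iff_edist_tendsto_0]
    have h1 := (hV.ms_continuous 0 x).comp
      ((Continuous.prodMk_left (X := ℝ≥0) x).tendsto 0)
    refine tendsto_zero_of_sq (h1.congr fun t => ?_)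
    rw [edist_eq_enorm_sub, ← lintegral_enorm_sub_sq (hV.memLp t x).coeFn_toLp.symm
      (hV.memLp 0 x).coeFn_toLp.symm]
    rfl
  set s : ℕ → ℝ≥0 := fun n => ((n : ℝ≥0) + 1)⁻¹
  have hs0 : Tendsto s atTop (𝓝 0) := by
    refine NNReal.tendsto_coe.1 ?_
    simpa [s] using tendsto_one_div_add_atTop_nhds_zero_nat (𝕜 := ℝ)
  have hspos : ∀ n, 0 < s n := fun n => inv_pos.2 (by positivity)
  have hsR : Tendsto (fun n => (s n : ℝ)) atTop (𝓝[>] 0) :=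
    tendsto_nhdsWithin_iff.2 ⟨(NNReal.continuous_coe.tendsto 0).comp hs0,
      Eventually.of_forall fun n => NNReal.coe_pos.2 (hspos n)⟩
  have key : ∀ t, 0 < t → ‖f t‖ₑ ^ 2 ≤ ‖f t - f 0‖ₑ ^ 2 := by
    intro t ht
    have h2 : ∀ n, ‖f t - f (s n)‖ₑ ^ 2
        = jumpVar ν * ∫⁻ ξ, ‖Hfun G t ξ - Hfun G (s n) ξ‖ₑ ^ 2 ∂(spectralMeasure h) := fun n => by
      rw [hf]; beta_reduce
      rw [hV.toLp_eq_of_pos hΘ hκ hA hF hv ht (hm t),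
        hV.toLp_eq_of_pos hΘ hκ hA hF hv (hspos n) (hm (s n)), hΘ.enorm_sub_sq hA hF]
    have h3 : Tendsto (fun n => ‖f t - f (s n)‖ₑ ^ 2) atTop (𝓝 (‖f t - f 0‖ₑ ^ 2)) :=
      (ENNReal.continuous_pow 2).tendsto _ |>.comp ((hfc.comp hs0).const_sub (f t)).enorm
    have h4 : ∀ ξ, Tendsto (fun n => ‖Hfun G t ξ - Hfun G (s n) ξ‖ₑ ^ 2) atTop
        (𝓝 (‖Hfun G t ξ‖ₑ ^ 2)) := fun ξ => by
      have h5 := (((tendsto_Hfun_zero hF ξ).comp hsR).const_sub (Hfun G t ξ)).enorm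
      rw [sub_zero] at h5
      exact (ENNReal.continuous_pow 2).tendsto _ |>.comp h5
    calc ‖f t‖ₑ ^ 2 = jumpVar ν * ∫⁻ ξ, ‖Hfun G t ξ‖ₑ ^ 2 ∂(spectralMeasure h) := by
          rw [hf]; beta_reduce
          rw [hV.toLp_eq_of_pos hΘ hκ hA hF hv ht (hm t), hΘ.enorm_fieldSymbol_sq hA hF]
      _ = ∫⁻ ξ, liminf (fun n => jumpVar ν * ‖Hfun G t ξ - Hfun G (s n) ξ‖ₑ ^ 2) atTop
            ∂(spectralMeasure h) := by
          rw [← lintegral_const_mul' _ _ hν.jumpVar_ne_top]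
          refine lintegral_congr fun ξ => ?_
          exact (ENNReal.Tendsto.const_mul (h4 ξ) (Or.inr hν.jumpVar_ne_top)).liminf_eq.symm
      _ ≤ liminf (fun n => ∫⁻ ξ, jumpVar ν * ‖Hfun G t ξ - Hfun G (s n) ξ‖ₑ ^ 2
            ∂(spectralMeasure h)) atTop := by
          refine lintegral_liminf_le fun n => ?_
          have := measurable_Hfun hA hF t.coe_nonneg
          have := measurable_Hfun hA hF (s n).coe_nonneg
          fun_prop
      _ = liminf (fun n => ‖f t - f (s n)‖ₑ ^ 2) atTop := by
          simp_rw [h2]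
          refine congrArg (fun u => liminf u atTop) (funext fun n => ?_)
          exact lintegral_const_mul' _ _ hν.jumpVar_ne_top
      _ = ‖f t - f 0‖ₑ ^ 2 := h3.liminf_eq
  have h6 : Tendsto (fun n => ‖f (s n)‖ₑ ^ 2) atTop (𝓝 (‖f 0‖ₑ ^ 2)) :=
    (ENNReal.continuous_pow 2).tendsto _ |>.comp (hfc.comp hs0).enorm
  have h7 : Tendsto (fun n => ‖f (s n) - f 0‖ₑ ^ 2) atTop (𝓝 0) := by
    have := (ENNReal.continuous_pow 2).tendsto _ |>.comp ((hfc.comp hs0).sub_const (f 0)).enorm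
    simpa [Function.comp_def] using this
  have h8 := le_of_tendsto_of_tendsto' h6 h7 fun n => key _ (hspos n)
  simpa using h8

/-- A field version is the spectral integral of `exp(-i ξ·x) conj (H_t(ξ))`. -/
theorem IsFieldVersion.toLp_eq [IsProbabilityMeasure P]
    (hV : IsFieldVersion P v V) (hν : IsJumpMeasure ν) (hΘ : IsSpectralIntegral κ h ν N P Θ)
    (hκ : KernelAssumption κ h) (hA : HypA G) (hF : HypF G)
    (hv : IsDistributionSolution κ ν N P G v) (t : ℝ≥0) (x : Eu d) :
    (hV.memLp t x).toLp (V t x)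
      = Θ ((hV.memLp_fieldSymbol hν hΘ hκ hA hF hv t x).toLp (fieldSymbol G t x)) := by
  rcases eq_or_ne t 0 with rfl | ht
  · rw [hV.toLp_zero hν hΘ hκ hA hF hv x, toLp_eq_zero _ (fieldSymbol_zero x), map_zero]
  · exact hV.toLp_eq_of_pos hΘ hκ hA hF hv (pos_iff_ne_zero.2 ht) _

theorem IsFieldVersion.lintegral_Hfun_sub [IsProbabilityMeasure P]
    (hV : IsFieldVersion P v V) (hν : IsJumpMeasure ν) (hΘ : IsSpectralIntegral κ h ν N P Θ)
    (hκ : KernelAssumption κ h) (hA : HypA G) (hF : HypF G)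
    (hv : IsDistributionSolution κ ν N P G v) (t s : ℝ≥0) :
    ∫⁻ ξ, ‖Hfun G t ξ - Hfun G s ξ‖ₑ ^ 2 ∂(spectralMeasure h)
      = (jumpVar ν)⁻¹ * ∫⁻ ω, ‖V t 0 ω - V s 0 ω‖ₑ ^ 2 ∂P := by
  rw [lintegral_enorm_sub_sq (hV.memLp t 0).coeFn_toLp.symm (hV.memLp s 0).coeFn_toLp.symm,
    hV.toLp_eq hν hΘ hκ hA hF hv, hV.toLp_eq hν hΘ hκ hA hF hv, hΘ.enorm_sub_sq hA hF,
    ← mul_assoc, ENNReal.inv_mul_cancel hν.jumpVar_ne_zero hν.jumpVar_ne_top, one_mul]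

theorem IsFieldVersion.condBounded [IsProbabilityMeasure P]
    (hV : IsFieldVersion P v V) (hν : IsJumpMeasure ν) (hΘ : IsSpectralIntegral κ h ν N P Θ)
    (hκ : KernelAssumption κ h) (hA : HypA G) (hF : HypF G)
    (hv : IsDistributionSolution κ ν N P G v) : CondBounded G h := by
  intro T hT
  lift T to ℝ≥0 using hT.le
  have h1 := hV.locally_bounded T {0} isCompact_singleton
  refine lt_of_le_of_lt ?_ (ENNReal.mul_lt_top
    (ENNReal.inv_lt_top.2 (pos_iff_ne_zero.2 hν.jumpVar_ne_zero)) h1)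
  refine iSup₂_le fun t ht => ?_
  lift t to ℝ≥0 using ht.1
  have h2 : ∫⁻ ξ, ‖Hfun G t ξ‖ₑ ^ 2 ∂(spectralMeasure h)
      = (jumpVar ν)⁻¹ * ∫⁻ ω, ‖V t 0 ω‖ₑ ^ 2 ∂P := by
    rw [lintegral_enorm_sq (hV.memLp t 0).coeFn_toLp.symm, hV.toLp_eq hν hΘ hκ hA hF hv,
      hΘ.enorm_fieldSymbol_sq hA hF, ← mul_assoc,
      ENNReal.inv_mul_cancel hν.jumpVar_ne_zero hν.jumpVar_ne_top, one_mul]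
  rw [h2]
  refine mul_le_mul_right ?_ _
  exact le_iSup₂_of_le (f := fun t _ => ⨆ x' ∈ ({0} : Set (Eu d)), ∫⁻ ω, ‖V t x' ω‖ₑ ^ 2 ∂P) t
    (mem_Iic.2 (NNReal.coe_le_coe.1 ht.2))
    (le_iSup₂_of_le (f := fun x' _ => ∫⁻ ω, ‖V t x' ω‖ₑ ^ 2 ∂P) 0 rfl le_rfl)

theorem IsFieldVersion.condContinuous [IsProbabilityMeasure P]
    (hV : IsFieldVersion P v V) (hν : IsJumpMeasure ν) (hΘ : IsSpectralIntegral κ h ν N P Θ)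
    (hκ : KernelAssumption κ h) (hA : HypA G) (hF : HypF G)
    (hv : IsDistributionSolution κ ν N P G v) : CondContinuous G h := by
  intro s hs
  lift s to ℝ≥0 using hs
  have h1 : Tendsto (fun t : ℝ => ((t.toNNReal, 0) : ℝ≥0 × Eu d)) (𝓝[Ici 0] (s : ℝ))
      (𝓝 (s, 0)) := by
    have h2 : Continuous fun t : ℝ => ((t.toNNReal, 0) : ℝ≥0 × Eu d) := by fun_prop
    have h3 := h2.tendsto (s : ℝ)
    rw [Real.toNNReal_coe] at h3
    exact h3.mono_left nhdsWithin_le_nhds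
  have h4 := ENNReal.Tendsto.const_mul (a := (jumpVar ν)⁻¹) ((hV.ms_continuous s 0).comp h1)
    (Or.inr (ENNReal.inv_ne_top.2 hν.jumpVar_ne_zero))
  rw [mul_zero] at h4
  refine h4.congr' ?_
  filter_upwards [self_mem_nhdsWithin] with t ht
  have h5 := hV.lintegral_Hfun_sub hν hΘ hκ hA hF hv t.toNNReal s
  rw [Real.coe_toNNReal t ht] at h5
  exact h5.symm

end FieldVersionNecessary

/-! ### Solutions with a Fubini representation, and the equivalence. -/

section FubiniRepresentation

variable {d : ℕ} {Ω : Type*} [MeasurableSpace Ω] {P : Measure Ω} {ν : Measure ℝ}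
  {N : Ω → Measure (Eu d × ℝ)} {κ : Eu d → ℝ≥0∞} {h : Eu d → ℂ} {G : ℝ → RealDist d}
  {Θ : Lp ℂ 2 (spectralMeasure h) →L[ℝ] Lp ℝ 2 P}

theorem KernelAssumption.integrable_mul_schwartz (hκ : KernelAssumption κ h) (Φ : 𝓢(Eu d, ℂ)) :
    Integrable fun ξ => h ξ * Φ ξ := by
  obtain ⟨k, hk⟩ := hκ.tempered_fourier.exists_integrable
  obtain ⟨A, hA0, hA⟩ := exists_le_wt Φ k
  refine (hk.const_mul A).mono'
    (hκ.measurable_fourier.mul Φ.continuous.measurable).aestronglyMeasurable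
    (Eventually.of_forall fun ξ => ?_)
  rw [norm_mul, toReal_enorm]
  calc ‖h ξ‖ * ‖Φ ξ‖ ≤ ‖h ξ‖ * (A * wt (-(k : ℝ)) ξ) := by gcongr; exact hA ξ
    _ = _ := by ring

theorem convTilde_shifted (T : RealDist d) (x : Eu d) (φ : 𝓢(Eu d, ℝ)) (y : Eu d) :
    convTilde (shifted T x) φ y = convTilde T (reflect (translate x φ)) (-y) := by
  simp only [convTilde, shifted, ContinuousLinearMap.comp_apply]
  congr 1
  ext z
  simp only [translate_apply, reflect_apply]
  congr 1
  abel

/-- The Fourier side of the kernel `G_r(x - ·) * κ`. -/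
theorem IsConvKernel.integral_mul (hκ : KernelAssumption κ h) (hA : HypA G) (hF : HypF G)
    {r : ℝ} (hr : 0 < r) {x : Eu d} {g : Eu d → ℝ} (hg : IsConvKernel κ (shifted (G r) x) g)
    {φ : 𝓢(Eu d, ℝ)} (hφ : HasCompactSupport φ) :
    ((∫ y, g y * φ y : ℝ) : ℂ) = cst d *
      ∫ ξ, h ξ * (chr ξ (-x) * starRingEnd ℂ (propagator G r ξ)) * fourierS (ofR φ) (-ξ) := by
  obtain ⟨C, hC0, hC⟩ := hF.exists_bound
  obtain ⟨hc, hT⟩ := hA.continuous_hasFourier hr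
  have hφ' : HasCompactSupport (reflect (translate x φ)) := by
    have h1 := hφ.comp_homeomorph (Homeomorph.subLeft x)
    convert h1 using 1
    ext z
    simp [reflect_apply, translate_apply, sub_eq_neg_add]
  obtain ⟨ψ, hψ, hψF⟩ := (hA r hr).exists_convTilde hc hT
    (fun ξ => by rw [← propagator_of_pos hr]; exact hC r r le_rfl ξ) hφ'
  -- By `convTilde_shifted`, the function paired with κ is the reflection of ψ; writing it as a
  -- Fourier transform allows h to replace κ.
  have h2 := hκ.fourier_eq (invFourierS (ofR (reflect ψ)))
  rw [fourierS_invFourierS] at h2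
  have h3 : ∫ y, g y * φ y = ∫ y, (κ y).toReal * reflect ψ y := by
    rw [hg.2 φ hφ]
    refine integral_congr_ae (Eventually.of_forall fun y => ?_)
    simp only
    rw [convTilde_shifted, ← hψ]
    rfl
  rw [h3, ← integral_complex_ofReal, ← integral_const_mul]
  simp only [Complex.ofReal_mul]
  refine h2.symm.trans (integral_congr_ae (Eventually.of_forall fun ξ => ?_))
  simp only
  rw [invFourierS_apply, fourierS_ofR_reflect, neg_neg, hψF, fourierS_ofR_reflect,
    fourierS_ofR_translate, chr_neg_left, ← propagator_of_pos hr, propagator_neg hA hF]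
  ring

theorem integrable_mul_of_integrableOn_compact {g : ℝ → Eu d → ℝ} {t : ℝ}
    (hg : ∀ K : Set (Eu d), IsCompact K → IntegrableOn (Function.uncurry g) (Icc 0 t ×ˢ K)
      ((volume : Measure ℝ).prod (volume : Measure (Eu d))))
    {φ : 𝓢(Eu d, ℝ)} (hφ : HasCompactSupport φ) :
    Integrable (Function.uncurry fun s y => g s y * φ y)
      ((volume.restrict (Ioo 0 t)).prod volume) := by
  have h1 : IntegrableOn (Function.uncurry g) (univ ×ˢ tsupport φ)
      ((volume.restrict (Ioo 0 t)).prod volume) := by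
    rw [IntegrableOn, ← Measure.prod_restrict, Measure.restrict_univ, Measure.prod_restrict]
    exact (hg _ hφ).mono_set (prod_mono Ioo_subset_Icc_self Subset.rfl)
  obtain ⟨A, -, hA⟩ := exists_le_wt φ 0
  have h2 : IntegrableOn (Function.uncurry fun s y => g s y * φ y) (univ ×ˢ tsupport φ)
      ((volume.restrict (Ioo 0 t)).prod volume) := by
    refine Integrable.mul_bdd (c := A) h1
      (φ.continuous.comp continuous_snd).aestronglyMeasurable (Eventually.of_forall fun p => ?_)
    simpa [wt] using hA p.2
  refine (integrableOn_iff_integrable_of_support_subset fun p hp => ?_).1 h2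
  refine ⟨mem_univ _, subset_tsupport _ ?_⟩
  rw [Function.mem_support] at hp ⊢
  exact right_ne_zero_of_mul hp

/-- By `levyInt_eq` it is enough to pair the inner time integral with test functions. Time is
exchanged with y, where local integrability suffices because φ has compact support, and then with ξ,
where the bound in (F) does. -/
theorem HasFubiniRepresentation.ae_eq (hΘ : IsSpectralIntegral κ h ν N P Θ)
    (hκ : KernelAssumption κ h) (hA : HypA G) (hF : HypF G) {u : ℝ≥0 → Eu d → Ω → ℝ}
    (hu : HasFubiniRepresentation κ ν N P G u) (t : ℝ≥0) (x : Eu d)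
    (hm : MemLp (fieldSymbol G t x) 2 (spectralMeasure h)) :
    u t x =ᵐ[P] Θ (hm.toLp (fieldSymbol G t x)) := by
  obtain ⟨g, hgm, hgk, hgi, hg2, hug⟩ := hu t x
  obtain ⟨C, hC0, hC⟩ := hF.exists_bound
  rw [hΘ.levyInt_eq (fieldSymbol G t x) hm _ hg2 fun φ hφ => ?_] at hug
  · exact hug
  have ht := t.coe_nonneg
  have hi := integrable_mul_of_integrableOn_compact hgi hφ
  have hpm : Measurable fun p : ℝ × Eu d => propagator G (t - p.1) p.2 :=
    (measurable_propagator hA hF).comp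
      ((measurable_const.sub measurable_fst).prodMk measurable_snd)
  have hchr : Continuous fun p : ℝ × Eu d => chr p.2 (-x) := by fun_prop
  have hFφ : Continuous fun p : ℝ × Eu d => fourierS (ofR φ) (-p.2) :=
    (fourierS (ofR φ)).continuous.comp (by fun_prop)
  have hh := hκ.measurable_fourier
  have hi2 : Integrable (Function.uncurry fun s ξ => h ξ *
      (chr ξ (-x) * starRingEnd ℂ (propagator G (t - s) ξ)) * fourierS (ofR φ) (-ξ))
      ((volume.restrict (Ioo 0 (t : ℝ))).prod volume) := by
    have h1 := (hκ.integrable_mul_schwartz (fourierS (ofR (reflect φ)))).norm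
    have h2 : Integrable (fun _ : ℝ => C t) (volume.restrict (Ioo 0 (t : ℝ))) :=
      integrable_const _
    refine (h2.mul_prod h1).mono' ?_ ?_
    · exact (((hh.comp measurable_snd).mul (hchr.measurable.mul
        (Complex.continuous_conj.measurable.comp hpm))).mul hFφ.measurable).aestronglyMeasurable
    · have h3 : ∀ᵐ p : ℝ × Eu d ∂((volume.restrict (Ioo 0 (t : ℝ))).prod volume), 0 < p.1 :=
        Measure.quasiMeasurePreserving_fst.ae
          ((ae_restrict_mem measurableSet_Ioo).mono fun s hs => hs.1)
      filter_upwards [h3] with p hp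
      simp only [Function.uncurry]
      rw [norm_mul, norm_mul, norm_mul, norm_chr, one_mul, RCLike.norm_conj, norm_mul,
        fourierS_ofR_reflect]
      have := hC (t - p.1) t (by linarith) p.2
      calc _ ≤ ‖h p.2‖ * C t * ‖fourierS (ofR φ) (-p.2)‖ := by gcongr
        _ = _ := by ring
  have e1 : ∫ y, (∫ s in (0 : ℝ)..t, g s y) * φ y
      = ∫ s in Ioo 0 (t : ℝ), ∫ y, g s y * φ y := by
    rw [integral_integral_swap hi]
    refine integral_congr_ae (Eventually.of_forall fun y => ?_)
    simp only
    rw [integral_mul_const, intervalIntegral.integral_of_le ht, integral_Ioc_eq_integral_Ioo]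
  have e2 : ∀ᵐ s ∂(volume.restrict (Ioo 0 (t : ℝ))), ((∫ y, g s y * φ y : ℝ) : ℂ) = cst d *
      ∫ ξ, h ξ * (chr ξ (-x) * starRingEnd ℂ (propagator G (t - s) ξ)) *
        fourierS (ofR φ) (-ξ) := by
    filter_upwards [hgk, ae_restrict_mem measurableSet_Ioo] with s hs hs'
    exact hs.integral_mul hκ hA hF (sub_pos.2 hs'.2) hφ
  rw [e1, ← integral_complex_ofReal, integral_congr_ae e2, integral_const_mul,
    integral_integral_swap hi2]
  congr 1
  refine integral_congr_ae (Eventually.of_forall fun ξ => ?_)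
  simp only
  rw [integral_mul_const, integral_const_mul, integral_const_mul, integral_conj, fieldSymbol,
    Hfun_eq _ ξ ht, intervalIntegral.integral_of_le ht, integral_Ioc_eq_integral_Ioo]

/-- The equivalence between the existence of a field version and the conditions on `H_t`. -/
theorem exists_isFieldVersion_iff [IsProbabilityMeasure P] (hν : IsJumpMeasure ν)
    (hΘ : IsSpectralIntegral κ h ν N P Θ) (hκ : KernelAssumption κ h) (hA : HypA G) (hF : HypF G)
    {v : ℝ≥0 → 𝓢(Eu d, ℝ) → Ω → ℝ} (hv : IsDistributionSolution κ ν N P G v) :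
    (∃ V : ℝ≥0 → Eu d → Ω → ℝ, IsFieldVersion P v V) ↔ CondBounded G h ∧ CondContinuous G h :=
  ⟨fun ⟨_, hV⟩ => ⟨hV.condBounded hν hΘ hκ hA hF hv, hV.condContinuous hν hΘ hκ hA hF hv⟩,
    fun ⟨hb, hc⟩ => exists_isFieldVersion hν hΘ hκ hA hF hb hc hv⟩

end FubiniRepresentation

/-! ### Smooth symbols of temperate growth define elements of 𝓞_C'. -/

section SmoothSymbol

variable {d : ℕ}

open scoped LineDeriv

theorem integral_norm_iteratedFDeriv_ofR (φ : 𝓢(Eu d, ℝ)) (i : ℕ) :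
    ∫ x, ‖iteratedFDeriv ℝ i (ofR φ) x‖ = ∫ x, ‖iteratedFDeriv ℝ i φ x‖ := by
  refine integral_congr_ae (Eventually.of_forall fun x => ?_)
  exact Complex.ofRealLI.norm_iteratedFDeriv_comp_left ((φ.smooth ⊤).contDiffAt) (mod_cast le_top)

theorem norm_pow_mul_fourierS_le (φ : 𝓢(Eu d, ℝ)) {n K : ℕ} (hn : n ≤ K) (ξ : Eu d) :
    ‖ξ‖ ^ n * ‖fourierS (ofR φ) ξ‖ ≤
      (2 * Real.pi * 2) ^ n * ∑ i ∈ Finset.range (K + 1), ∫ x, ‖iteratedFDeriv ℝ i φ x‖ := by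
  have h1 := Real.pow_mul_norm_iteratedFDeriv_fourier_le (f := ofR φ) (K := ⊤) (N := ⊤)
    ((ofR φ).smooth ⊤) (fun k n _ _ => (ofR φ).integrable_pow_mul_iteratedFDeriv volume k n)
    (n := n) (k := 0) le_top le_top ((2 * Real.pi)⁻¹ • ξ)
  rw [norm_iteratedFDeriv_zero] at h1
  have h2 : fourierS (ofR φ) ξ = 𝓕 (ofR φ : Eu d → ℂ) ((2 * Real.pi)⁻¹ • ξ) := by
    rw [← SchwartzMap.fourier_coe]; rfl
  rw [← h2, norm_smul, Real.norm_of_nonneg (by positivity), mul_pow] at h1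
  have h3 : ∑ p ∈ Finset.range (0 + 1) ×ˢ Finset.range (n + 1),
      ∫ v, ‖v‖ ^ p.1 * ‖iteratedFDeriv ℝ p.2 (ofR φ) v‖ ≤
      ∑ i ∈ Finset.range (K + 1), ∫ x, ‖iteratedFDeriv ℝ i φ x‖ := by
    rw [Finset.sum_product]
    simp only [zero_add, Finset.range_one, Finset.sum_singleton, pow_zero, one_mul,
      integral_norm_iteratedFDeriv_ofR]
    exact Finset.sum_le_sum_of_subset_of_nonneg (Finset.range_mono (by omega))
      fun _ _ _ => integral_nonneg fun _ => norm_nonneg _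
  calc ‖ξ‖ ^ n * ‖fourierS (ofR φ) ξ‖
      = (2 * Real.pi) ^ n * ((2 * Real.pi)⁻¹ ^ n * ‖ξ‖ ^ n * ‖fourierS (ofR φ) ξ‖) := by
        rw [← mul_assoc, ← mul_assoc, ← mul_pow, mul_inv_cancel₀ (by positivity), one_pow, one_mul]
    _ ≤ (2 * Real.pi) ^ n * (2 ^ n *
        ∑ i ∈ Finset.range (K + 1), ∫ x, ‖iteratedFDeriv ℝ i φ x‖) := by
        refine mul_le_mul_of_nonneg_left (h1.trans ?_) (by positivity)
        simp only [CharP.cast_eq_zero, mul_zero, zero_add, pow_zero, one_mul] at h3 ⊢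
        exact mul_le_mul_of_nonneg_left h3 (by positivity)
    _ = _ := by rw [mul_pow (2 * Real.pi)]; ring

theorem one_add_norm_pow_mul_fourierS_le (d K : ℕ) : ∃ C, 0 ≤ C ∧ ∀ (φ : 𝓢(Eu d, ℝ)) (ξ : Eu d),
    (1 + ‖ξ‖) ^ K * ‖fourierS (ofR φ) ξ‖ ≤
      C * ∑ i ∈ Finset.range (K + 1), ∫ x, ‖iteratedFDeriv ℝ i φ x‖ := by
  refine ⟨∑ n ∈ Finset.range (K + 1), (2 * Real.pi * 2) ^ n * (K.choose n : ℝ),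
    Finset.sum_nonneg fun _ _ => by positivity, fun φ ξ => ?_⟩
  rw [add_comm, add_pow, Finset.sum_mul, Finset.sum_mul]
  refine Finset.sum_le_sum fun n hn => ?_
  have := norm_pow_mul_fourierS_le φ (Nat.lt_succ_iff.1 (Finset.mem_range.1 hn)) ξ
  calc _ = (‖ξ‖ ^ n * ‖fourierS (ofR φ) ξ‖) * (K.choose n : ℝ) := by rw [one_pow]; ring
    _ ≤ _ := mul_le_mul_of_nonneg_right this (by positivity)
    _ = _ := by ring

theorem HasFourier.pairing_fourierS_of_temperate {T : RealDist d} {g : Eu d → ℂ}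
    (hT : HasFourier T g) (hg : g.HasTemperateGrowth) (ψ : 𝓢(Eu d, ℂ)) :
    complexPairing T (fourierS ψ) = ∫ ξ, g ξ * ψ ξ := by
  obtain ⟨u, hu, hlim⟩ := exists_tendsto_compactSupport ψ
  have h1 := (((continuous_complexPairing T).comp continuous_fourierS).tendsto ψ).comp hlim
  have h2 := (((SchwartzMap.integralCLM ℂ (volume : Measure (Eu d))).comp
    (SchwartzMap.smulLeftCLM ℂ g)).continuous.tendsto ψ).comp hlim
  have h3 : ∀ ψ : 𝓢(Eu d, ℂ), ((SchwartzMap.integralCLM ℂ (volume : Measure (Eu d))).comp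
      (SchwartzMap.smulLeftCLM ℂ g)) ψ = ∫ ξ, g ξ * ψ ξ := fun ψ => by
    rw [ContinuousLinearMap.comp_apply, SchwartzMap.integralCLM_apply]
    simp only [SchwartzMap.smulLeftCLM_apply_apply hg, smul_eq_mul]
  rw [h3] at h2
  refine tendsto_nhds_unique h1 (h2.congr fun n => ?_)
  rw [Function.comp_apply, h3]
  exact (hT.2 (u n) (hu n)).symm

theorem HasFourier.exists_bound {T : RealDist d} {g : Eu d → ℂ}
    (hT : HasFourier T g) (hg : g.HasTemperateGrowth) : ∃ (m : ℕ) (C : ℝ), 0 ≤ C ∧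
    ∀ φ : 𝓢(Eu d, ℝ), |T φ| ≤ C * ∑ i ∈ Finset.range (m + 1), ∫ x, ‖iteratedFDeriv ℝ i φ x‖ := by
  obtain ⟨k, A, hA⟩ := hg.2 0
  simp only [norm_iteratedFDeriv_zero] at hA
  have hA0 : 0 ≤ A := by simpa using (norm_nonneg _).trans (hA 0)
  -- Of the k + d + 1 powers of decay of 𝓕φ, k compensate the growth of g and d + 1 make the rest
  -- integrable.
  obtain ⟨B, hB0, hB⟩ := one_add_norm_pow_mul_fourierS_le d (k + (d + 1))
  have hint : Integrable fun ξ : Eu d => ((1 + ‖ξ‖) ^ (d + 1))⁻¹ := by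
    have := integrable_one_add_norm (E := Eu d) (μ := volume) (r := (d : ℝ) + 1) (by simp)
    refine this.congr (Eventually.of_forall fun ξ => ?_)
    beta_reduce
    rw [Real.rpow_neg (by positivity), ← Nat.cast_add_one, Real.rpow_natCast]
  refine ⟨k + (d + 1), cst d * (A * B * ∫ ξ : Eu d, ((1 + ‖ξ‖) ^ (d + 1))⁻¹), ?_, fun φ => ?_⟩
  · have := (cst_pos d).le
    have : 0 ≤ ∫ ξ : Eu d, ((1 + ‖ξ‖) ^ (d + 1))⁻¹ := integral_nonneg fun _ => by positivity
    positivity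
  set S := ∑ i ∈ Finset.range (k + (d + 1) + 1), ∫ x, ‖iteratedFDeriv ℝ i φ x‖ with hS
  have h1 : (T φ : ℂ) = ∫ ξ, g ξ * (cst d * fourierS (ofR φ) (-ξ)) := by
    rw [← complexPairing_ofR, ← fourierS_invFourierS (ofR φ), hT.pairing_fourierS_of_temperate hg]
    simp only [invFourierS_apply, fourierS_invFourierS]
  rw [← Real.norm_eq_abs, ← Complex.norm_real, h1]
  calc _ ≤ ∫ ξ : Eu d, cst d * (A * B * S) * ((1 + ‖ξ‖) ^ (d + 1))⁻¹ := by
        refine norm_integral_le_of_norm_le (hint.const_mul _) (Eventually.of_forall fun ξ => ?_)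
        rw [norm_mul, norm_mul, Complex.norm_real, Real.norm_of_nonneg (cst_pos d).le,
          ← div_eq_mul_inv, le_div_iff₀ (by positivity)]
        have h2 := hB φ (-ξ)
        rw [norm_neg, pow_add] at h2
        have := (cst_pos d).le
        calc _ ≤ A * (1 + ‖ξ‖) ^ k * (cst d * ‖fourierS (ofR φ) (-ξ)‖) * (1 + ‖ξ‖) ^ (d + 1) := by
              gcongr; exact hA ξ
          _ = cst d * (A * ((1 + ‖ξ‖) ^ k * (1 + ‖ξ‖) ^ (d + 1) * ‖fourierS (ofR φ) (-ξ)‖)) := by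
              ring
          _ ≤ cst d * (A * (B * S)) := by gcongr
          _ = _ := by ring
    _ = _ := by rw [integral_const_mul]; ring

theorem hasTemperateGrowth_fderiv_apply {g : Eu d → ℂ} (hg : g.HasTemperateGrowth) (m : Eu d) :
    Function.HasTemperateGrowth fun ξ => fderiv ℝ g ξ m := by
  have h1 : Function.HasTemperateGrowth (fderiv ℝ g) := by
    refine ⟨hg.1.fderiv_right (by simp), fun n => ?_⟩
    simp only [norm_iteratedFDeriv_fderiv]
    exact hg.2 (n + 1)
  exact (ContinuousLinearMap.apply ℝ ℂ m).hasTemperateGrowth.comp h1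

/-- Multiplication by a coordinate becomes i times a derivative of g. The factor is first moved onto
ψ as the test function -i ∂_mψ, then integration by parts puts the derivative on g. -/
theorem HasFourier.smulLeft_inner {T : RealDist d} {g : Eu d → ℂ}
    (hT : HasFourier T g) (hg : g.HasTemperateGrowth) (m : Eu d) :
    HasFourier (T ∘L SchwartzMap.smulLeftCLM ℝ (inner ℝ · m : Eu d → ℝ))
      fun ξ => Complex.I * fderiv ℝ g ξ m := by
  have hgd : Differentiable ℝ g := hg.1.differentiable (by simp)
  have hgc : Continuous fun ξ => fderiv ℝ g ξ m := 
    (hasTemperateGrowth_fderiv_apply hg m).1.continuous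
  refine ⟨(continuous_const.mul hgc).locallyIntegrable, fun ψ hψ => ?_⟩
  set χ : 𝓢(Eu d, ℂ) := (-Complex.I) • ∂_{m} ψ with hχ
  have h1 : ∀ ξ, fourierS χ ξ = (inner ℝ ξ m : ℝ) * fourierS ψ ξ := fun ξ => by
    have : fourierS χ = (-Complex.I) • fourierS (∂_{m} ψ) := by
      ext ξ
      rw [_root_.smul_apply, fourierS_eq, fourierS_eq, smul_eq_mul, ← integral_const_mul]
      refine integral_congr_ae (Eventually.of_forall fun x => ?_)
      simp only [hχ, _root_.smul_apply, smul_eq_mul]; ring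
    rw [this, _root_.smul_apply, fourierS_lineDerivOp, smul_eq_mul]
    linear_combination (-(inner ℝ ξ m : ℝ) * fourierS ψ ξ) * Complex.I_mul_I
  have hi : Function.HasTemperateGrowth (inner ℝ · m : Eu d → ℝ) :=
    Function.hasTemperateGrowth_inner_left m
  have h2 : complexPairing (T ∘L SchwartzMap.smulLeftCLM ℝ (inner ℝ · m : Eu d → ℝ)) (fourierS ψ)
      = complexPairing T (fourierS χ) := by
    have e : ∀ L : ℂ →L[ℝ] ℝ, SchwartzMap.smulLeftCLM ℝ (inner ℝ · m : Eu d → ℝ)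
        (SchwartzMap.postcompCLM L (fourierS ψ)) = SchwartzMap.postcompCLM L (fourierS χ) := by
      intro L
      ext ξ
      rw [SchwartzMap.smulLeftCLM_apply_apply hi, SchwartzMap.postcompCLM_apply,
        SchwartzMap.postcompCLM_apply, h1, ← Complex.real_smul, map_smul]
    simp only [complexPairing, ContinuousLinearMap.comp_apply, e]
  have hψ' : HasCompactSupport fun ξ => fderiv ℝ ψ ξ m := hψ.fderiv_apply (𝕜 := ℝ) m
  have hψc : Continuous fun ξ => fderiv ℝ ψ ξ m :=
    ((ψ.smooth 1).continuous_fderiv one_ne_zero).clm_apply continuous_const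
  have hχe : ⇑χ = fun ξ => -Complex.I * fderiv ℝ ψ ξ m := by
    ext ξ
    rw [hχ, _root_.smul_apply, SchwartzMap.lineDerivOp_apply_eq_fderiv, smul_eq_mul]
  have hcχ : HasCompactSupport χ := by rw [hχe]; exact hψ'.mul_left
  rw [h2, hT.2 χ hcχ]
  have h3 := integral_mul_fderiv_eq_neg_fderiv_mul_of_integrable (μ := volume) (f := g) (g := ψ)
    (v := m) (hgc.mul ψ.continuous |>.integrable_of_hasCompactSupport hψ.mul_left)
    (hgd.continuous.mul hψc |>.integrable_of_hasCompactSupport hψ'.mul_left) (hgd.continuous.mul ψ.continuous |>.integrable_of_hasCompactSupport hψ.mul_left)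
    (fun x _ => hgd x) fun x _ => ψ.differentiable x
  have h4 : ∀ ξ, g ξ * χ ξ = -Complex.I * (g ξ * fderiv ℝ ψ ξ m) := fun ξ => by
    rw [hχe]; ring
  simp only [h4, mul_assoc]
  rw [integral_const_mul, integral_const_mul, h3]
  ring

theorem HasFourier.add {T S : RealDist d} {g f : Eu d → ℂ} (hT : HasFourier T g)
    (hS : HasFourier S f) : HasFourier (T + S) (g + f) := by
  refine ⟨hT.1.add hS.1, fun ψ hψ => ?_⟩
  have h1 : ∀ {u : Eu d → ℂ}, LocallyIntegrable u → Integrable fun ξ => u ξ * ψ ξ := fun hu => by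
    have := hu.integrable_smul_right_of_hasCompactSupport ψ.continuous hψ
    simpa using this
  simp only [Pi.add_apply, add_mul]
  rw [integral_add (h1 hT.1) (h1 hS.1), ← hT.2 ψ hψ, ← hS.2 ψ hψ]
  simp only [complexPairing, _root_.add_apply]
  push_cast; ring

theorem hasFourier_zero : HasFourier (0 : RealDist d) 0 :=
  ⟨locallyIntegrable_zero, fun ψ _ => by simp [complexPairing]⟩

theorem HasFourier.smulLeft_wt_one {T : RealDist d} {g : Eu d → ℂ}
    (hT : HasFourier T g) (hg : g.HasTemperateGrowth) :
    ∃ g' : Eu d → ℂ, g'.HasTemperateGrowth ∧ HasFourier (T ∘L SchwartzMap.smulLeftCLM ℝ (wt 1)) g' := by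
  let e := EuclideanSpace.basisFun (Fin d) ℝ
  let M : Fin d → 𝓢(Eu d, ℝ) →L[ℝ] 𝓢(Eu d, ℝ) := fun j =>
    SchwartzMap.smulLeftCLM ℝ (inner ℝ · (e j) : Eu d → ℝ)
  have hstep : ∀ {T : RealDist d}, (∃ g : Eu d → ℂ, g.HasTemperateGrowth ∧ HasFourier T g) →
      ∀ j, ∃ g : Eu d → ℂ, g.HasTemperateGrowth ∧ HasFourier (T ∘L M j) g :=
    fun ⟨g, hg, hT⟩ j => ⟨_, (Function.HasTemperateGrowth.const Complex.I).mul
      (hasTemperateGrowth_fderiv_apply hg (e j)), hT.smulLeft_inner hg (e j)⟩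
  have hsum : ∀ s : Finset (Fin d), ∃ g : Eu d → ℂ, g.HasTemperateGrowth ∧
      HasFourier (∑ j ∈ s, (T ∘L M j) ∘L M j) g := by
    intro s
    induction s using Finset.induction_on with
    | empty => exact ⟨0, .zero, by simpa using hasFourier_zero⟩
    | insert a s ha ih =>
      obtain ⟨g1, h1, h1'⟩ := ih
      obtain ⟨g2, h2, h2'⟩ := hstep (hstep ⟨g, hg, hT⟩ a) a
      rw [Finset.sum_insert ha]
      exact ⟨_, h2.add h1, h2'.add h1'⟩
  obtain ⟨g', hg', hT'⟩ := hsum Finset.univ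
  have e1 : T ∘L SchwartzMap.smulLeftCLM ℝ (wt 1) = T + ∑ j, (T ∘L M j) ∘L M j := by
    ext φ
    have e2 : SchwartzMap.smulLeftCLM ℝ (wt 1) φ = φ + ∑ j, M j (M j φ) := by
      ext x
      have hM : ∀ j φ, M j φ x = x j * φ x := fun j φ => by
        have hi : Function.HasTemperateGrowth (inner ℝ · (e j) : Eu d → ℝ) :=
          Function.hasTemperateGrowth_inner_left (e j)
        rw [SchwartzMap.smulLeftCLM_apply_apply hi, smul_eq_mul, real_inner_comm,
          ← OrthonormalBasis.repr_apply_apply, EuclideanSpace.basisFun_repr]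
      rw [smulLeft_wt_apply, _root_.add_apply, _root_.sum_apply]
      simp only [hM, wt, Real.rpow_one, EuclideanSpace.norm_sq_eq, Real.norm_eq_abs, sq_abs]
      rw [add_mul, one_mul, Finset.sum_mul]
      congr 1
      exact Finset.sum_congr rfl fun j _ => by ring
    simp [e2]
  rw [e1]
  exact ⟨_, hg.add hg', hT.add hT'⟩

theorem HasFourier.smulLeft_wt_natCast {T : RealDist d} {g : Eu d → ℂ}
    (hT : HasFourier T g) (hg : g.HasTemperateGrowth) (n : ℕ) :
    ∃ g' : Eu d → ℂ, g'.HasTemperateGrowth ∧ HasFourier (T ∘L SchwartzMap.smulLeftCLM ℝ (wt n)) g' := by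
  induction n with
  | zero =>
    have e : T ∘L SchwartzMap.smulLeftCLM ℝ (wt ((0 : ℕ) : ℝ)) = T := by
      ext φ
      rw [ContinuousLinearMap.comp_apply]
      refine congrArg T ?_
      ext x
      rw [smulLeft_wt_apply]
      simp [wt]
    exact ⟨g, hg, by rwa [e]⟩
  | succ n ih =>
    obtain ⟨g1, h1, h2⟩ := ih
    obtain ⟨g2, h3, h4⟩ := h2.smulLeft_wt_one h1
    refine ⟨g2, h3, ?_⟩
    convert h4 using 1
    ext φ
    simp only [ContinuousLinearMap.comp_apply]
    congr 1
    ext x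
    simp only [smulLeft_wt_apply]
    rw [Nat.cast_succ, wt_add, mul_assoc]

/-- For odd k the weight (1 + |x|²)^{k/2} is not a polynomial and has no differential operator on
the Fourier side. The polynomial (1 + |x|²)^k is used on T, and the excess (1 + |x|²)^{-k/2} is put
on the test function, where it is harmless. -/
theorem HasFourier.isRapidlyDecreasing {T : RealDist d} {g : Eu d → ℂ}
    (hT : HasFourier T g) (hg : g.HasTemperateGrowth) : IsRapidlyDecreasing T := by
  intro k
  obtain ⟨g', hg', hT'⟩ := hT.smulLeft_wt_natCast hg k
  obtain ⟨m, C, hC0, hC⟩ := hT'.exists_bound hg'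
  obtain ⟨B, hB0, hB⟩ := exists_bound_iteratedFDeriv_wt_mul (d := d) (-(k / 2 : ℝ)) m
  refine ⟨m, C * B, fun φ hφ => ?_⟩
  have e : (T ∘L SchwartzMap.smulLeftCLM ℝ (fun x : Eu d => (1 + ‖x‖ ^ 2) ^ ((k : ℝ) / 2))) φ =
      (T ∘L SchwartzMap.smulLeftCLM ℝ (wt k)) (SchwartzMap.smulLeftCLM ℝ (wt (-(k / 2 : ℝ))) φ) := by
    simp only [ContinuousLinearMap.comp_apply]
    refine congrArg T ?_
    ext x
    refine (smulLeft_wt_apply ((k : ℝ) / 2) φ x).trans ?_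
    rw [smulLeft_wt_apply, smulLeft_wt_apply, ← mul_assoc, ← wt_add]
    congr 2; ring
  rw [e, mul_assoc]
  refine (hC _).trans (mul_le_mul_of_nonneg_left ((hB φ hφ).trans ?_) hC0)
  refine mul_le_mul_of_nonneg_left (Finset.sum_le_sum fun i _ => ?_) hB0
  have h1 : Integrable fun x => ‖iteratedFDeriv ℝ i φ x‖ := by
    simpa using φ.integrable_pow_mul_iteratedFDeriv volume 0 i
  refine integral_mono_of_nonneg (Eventually.of_forall fun x =>
    mul_nonneg (wt_pos _ _).le (norm_nonneg _)) h1 (Eventually.of_forall fun x => ?_)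
  exact mul_le_of_le_one_left (norm_nonneg _) (wt_le_one (by simp; positivity) x)

end SmoothSymbol

/-! ### The heat and wave kernels. -/

section Kernels

variable {d : ℕ} {G : ℝ → RealDist d}

theorem hasTemperateGrowth_of_radial (f : ℕ → Eu d → ℝ) (c : ℕ → ℝ)
    (hf : ∀ j x, HasFDerivAt (f j) ((c j * f (j + 1) x) • innerSL ℝ x) x)
    (h0 : ∀ j, ∃ C, 0 ≤ C ∧ ∀ x, ‖f j x‖ ≤ C) (j : ℕ) : (f j).HasTemperateGrowth := by
  obtain ⟨h1, h2⟩ := iteratedFDeriv_bound_of_radial f c (fun _ n x => (1 + ‖x‖) ^ n) hf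
    (by simpa using h0) (fun _ _ _ => by positivity)
    (fun _ n x => by rw [pow_succ]; gcongr; linarith)
    (fun _ m n x hmn => pow_le_pow_right₀ (by linarith [norm_nonneg x]) (by omega))
  refine ⟨h1 j, fun n => ?_⟩
  obtain ⟨C, -, hC⟩ := h2 n j
  exact ⟨n, C, hC⟩

theorem hasFDerivAt_exp_neg_mul_sq (t : ℝ) (x : Eu d) :
    HasFDerivAt (fun ξ : Eu d => Real.exp (-(t / 2) * ‖ξ‖ ^ 2))
      ((-t * Real.exp (-(t / 2) * ‖x‖ ^ 2)) • innerSL ℝ x) x := by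
  have h1 := ((hasStrictFDerivAt_norm_sq x).hasFDerivAt.const_mul (-(t / 2))).exp
  refine h1.congr_fderiv ?_
  ext v
  simp
  ring

theorem hasTemperateGrowth_gaussian {t : ℝ} (ht : 0 ≤ t) :
    Function.HasTemperateGrowth fun ξ : Eu d => (Real.exp (-(t / 2) * ‖ξ‖ ^ 2) : ℂ) := by
  refine Function.HasTemperateGrowth.comp Function.Complex.hasTemperateGrowth_ofReal ?_
  refine hasTemperateGrowth_of_radial (fun _ ξ => Real.exp (-(t / 2) * ‖ξ‖ ^ 2)) (fun _ => -t)
    (fun _ x => hasFDerivAt_exp_neg_mul_sq t x) (fun _ => ⟨1, zero_le_one, fun x => ?_⟩) 0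
  rw [Real.norm_of_nonneg (Real.exp_pos _).le, Real.exp_le_one_iff]
  have : 0 ≤ t / 2 * ‖x‖ ^ 2 := by positivity
  linarith

theorem integral_heatKernel_mul_chr {t : ℝ} (ht : 0 < t) (ξ : Eu d) :
    ∫ x : Eu d, ((2 * Real.pi * t) ^ (-(d : ℝ) / 2) * Real.exp (-‖x‖ ^ 2 / (2 * t)) : ℝ) *
      chr x (-ξ) = (Real.exp (-(t / 2) * ‖ξ‖ ^ 2) : ℂ) := by
  have hb : 0 < ((1 / (2 * t) : ℝ) : ℂ).re := by rw [Complex.ofReal_re]; positivity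
  have h1 := GaussianFourier.integral_cexp_neg_mul_sq_norm_add (V := Eu d) hb (-Complex.I) ξ
  have h2 : ∀ x : Eu d, (((2 * Real.pi * t) ^ (-(d : ℝ) / 2) * Real.exp (-‖x‖ ^ 2 / (2 * t)) : ℝ) : ℂ)
      * chr x (-ξ) = ((2 * Real.pi * t) ^ (-(d : ℝ) / 2) : ℝ) * Complex.exp
        (-((1 / (2 * t) : ℝ) : ℂ) * ‖x‖ ^ 2 + -Complex.I * (inner ℝ ξ x : ℝ)) := fun x => by
    rw [chr, Complex.exp_add, Complex.ofReal_mul, Complex.ofReal_exp, mul_assoc, inner_neg_right,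
      real_inner_comm]
    congr 3
    · push_cast; ring
    · push_cast; ring
  simp only [h2]
  rw [integral_const_mul, h1, ← mul_assoc]
  have h3 : (((Real.pi : ℂ) / ((1 / (2 * t) : ℝ) : ℂ)) ^ ((Module.finrank ℝ (Eu d) : ℂ) / 2))
      = (((2 * Real.pi * t) ^ ((d : ℝ) / 2) : ℝ) : ℂ) := by
    rw [Complex.ofReal_cpow (by positivity), finrank_euclideanSpace_fin]
    congr 1
    · push_cast; field_simp
    · push_cast; rfl
  rw [h3, ← Complex.ofReal_mul, ← Real.rpow_add (by positivity)]
  rw [neg_div, neg_add_cancel, Real.rpow_zero, Complex.ofReal_one, one_mul, Complex.ofReal_exp]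
  congr 1
  push_cast
  rw [neg_sq, Complex.I_sq]
  field_simp
  ring

theorem integrable_heatKernel {t : ℝ} (ht : 0 < t) :
    Integrable fun x : Eu d => (2 * Real.pi * t) ^ (-(d : ℝ) / 2) *
      Real.exp (-‖x‖ ^ 2 / (2 * t)) := by
  have hb : 0 < ((1 / (2 * t) : ℝ) : ℂ).re := by rw [Complex.ofReal_re]; positivity
  have h1 := (GaussianFourier.integrable_cexp_neg_mul_sq_norm_add (V := Eu d) hb 0 0).norm
  refine (h1.congr (Eventually.of_forall fun x => ?_)).const_mul _
  beta_reduce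
  rw [Complex.norm_exp, zero_mul, add_zero]
  congr 1
  norm_cast
  ring

theorem IsHeatKernel.hasFourier (hG : IsHeatKernel G) {t : ℝ} (ht : 0 < t) :
    HasFourier (G t) fun ξ => (Real.exp (-(t / 2) * ‖ξ‖ ^ 2) : ℂ) := by
  refine ⟨(hasTemperateGrowth_gaussian ht.le).1.continuous.locallyIntegrable, fun ψ _ => ?_⟩
  set p : Eu d → ℝ := fun x => (2 * Real.pi * t) ^ (-(d : ℝ) / 2) * Real.exp (-‖x‖ ^ 2 / (2 * t))
  have hpi : Integrable p := integrable_heatKernel ht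
  have hGt : ∀ φ, G t φ = ∫ x, p x * φ x := hG t ht
  have hchr : ∀ ξ, ∫ x, (p x : ℂ) * chr x (-ξ) = (Real.exp (-(t / 2) * ‖ξ‖ ^ 2) : ℂ) :=
    integral_heatKernel_mul_chr ht
  clear_value p
  have hpc : Integrable fun x => (p x : ℂ) := hpi.ofReal
  have hi : Integrable fun x => (p x : ℂ) * fourierS ψ x := by
    obtain ⟨A, -, hA⟩ := exists_le_wt (fourierS ψ) 0
    exact hpc.mul_bdd (fourierS ψ).continuous.aestronglyMeasurable
      (Eventually.of_forall fun x => by simpa [wt] using hA x)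
  have h1 : complexPairing (G t) (fourierS ψ) = ∫ x, (p x : ℂ) * fourierS ψ x := by
    rw [complexPairing, hGt, hGt, ← integral_re_add_im hi, mul_comm Complex.I]
    congr 2 <;> simp
  have h2 : Integrable (Function.uncurry fun (x ξ : Eu d) => (p x : ℂ) * (chr x (-ξ) * ψ ξ))
      (volume.prod volume) := by
    have h3 : Integrable (fun q : Eu d × Eu d => chr q.1 (-q.2) * ((p q.1 : ℂ) * ψ q.2))
        (volume.prod volume) :=
      (hpc.mul_prod ψ.integrable).bdd_mul (c := 1)
        (Continuous.aestronglyMeasurable (by unfold chr; fun_prop))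
        (Eventually.of_forall fun q => (norm_chr _ _).le)
    refine h3.congr (Eventually.of_forall fun q => ?_)
    simp only [Function.uncurry]; ring
  rw [h1]
  simp only [fourierS_eq, ← integral_const_mul]
  rw [integral_integral_swap h2]
  refine integral_congr_ae (Eventually.of_forall fun ξ => ?_)
  beta_reduce
  rw [← hchr ξ, ← integral_mul_const]
  simp only [mul_assoc]

/-- The Poisson integral `∫_{-1}^1 (1 - u²)^j cos(ur) du`. -/
def besselIntegral (j : ℕ) (r : ℝ) : ℝ := ∫ u in (-1 : ℝ)..1, (1 - u ^ 2) ^ j * Real.cos (u * r)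

theorem abs_one_sub_sq_pow_le {u : ℝ} (hu : u ∈ uIoc (-1 : ℝ) 1) (j : ℕ) :
    |(1 - u ^ 2) ^ j| ≤ 1 := by
  rw [uIoc_of_le (by norm_num)] at hu
  rw [abs_pow]
  refine pow_le_one₀ (abs_nonneg _) (abs_le.2 ⟨?_, ?_⟩) <;> nlinarith [hu.1, hu.2]

theorem abs_besselIntegral_le (j : ℕ) (r : ℝ) : |besselIntegral j r| ≤ 2 := by
  have := intervalIntegral.norm_integral_le_of_norm_le_const (a := (-1 : ℝ)) (b := 1) (C := 1)
    (f := fun u => (1 - u ^ 2) ^ j * Real.cos (u * r)) fun u hu => by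
      rw [norm_mul]
      exact mul_le_one₀ (abs_one_sub_sq_pow_le hu j) (norm_nonneg _) (Real.abs_cos_le_one _)
  norm_num at this
  exact this

/-- After differentiation under the integral, u(1 - u²)^j is integrated to -(1 - u²)^{j+1}/(2(j+1)),
which vanishes at ±1. The explicit factor r is what makes the function of |ξ| smooth at the origin:
its gradient is a multiple of the next function times ξ. -/
theorem hasDerivAt_besselIntegral (j : ℕ) (r : ℝ) :
    HasDerivAt (besselIntegral j) (-(r / (2 * (j + 1))) * besselIntegral (j + 1) r) r := by
  have h1 := (intervalIntegral.hasDerivAt_integral_of_dominated_loc_of_deriv_le (μ := volume)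
    (a := (-1 : ℝ)) (b := 1) (x₀ := r) (s := univ) (bound := fun _ => 1)
    (F := fun r u => (1 - u ^ 2) ^ j * Real.cos (u * r))
    (F' := fun r u => (1 - u ^ 2) ^ j * (-Real.sin (u * r) * u)) univ_mem
    (Eventually.of_forall fun x => Continuous.aestronglyMeasurable (by fun_prop))
    (Continuous.intervalIntegrable (by fun_prop) _ _)
    (Continuous.aestronglyMeasurable (by fun_prop))
    (Eventually.of_forall fun u hu x _ => by
      have h2 : |u| ≤ 1 := by
        rw [uIoc_of_le (by norm_num)] at hu
        exact abs_le.2 ⟨hu.1.le, hu.2⟩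
      rw [norm_mul, norm_mul, norm_neg]
      exact mul_le_one₀ (abs_one_sub_sq_pow_le hu j) (by positivity)
        (mul_le_one₀ (Real.abs_sin_le_one _) (norm_nonneg _) h2))
    intervalIntegrable_const
    (Eventually.of_forall fun u _ x _ => by
      have h2 : HasDerivAt (fun x => u * x) u x := by simpa using (hasDerivAt_id x).const_mul u
      exact h2.cos.const_mul _)).2
  refine h1.congr_deriv ?_
  have hj : ((j : ℝ) + 1) ≠ 0 := by positivity
  have hA : ∀ u ∈ uIcc (-1 : ℝ) 1, HasDerivAt (fun u : ℝ => -(1 - u ^ 2) ^ (j + 1) / (2 * (j + 1)))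
      (u * (1 - u ^ 2) ^ j) u := fun u _ => by
    have h2 := (((hasDerivAt_pow 2 u).const_sub 1).pow (j + 1)).neg.div_const (2 * ((j : ℝ) + 1))
    refine h2.congr_deriv ?_
    rw [Nat.add_sub_cancel]
    push_cast
    field_simp
  have hB : ∀ u ∈ uIcc (-1 : ℝ) 1, HasDerivAt (fun u : ℝ => -Real.sin (u * r))
      (-(Real.cos (u * r) * r)) u := fun u _ => by
    have h2 : HasDerivAt (fun x => x * r) r u := by simpa using (hasDerivAt_id u).mul_const r
    exact h2.sin.neg
  have h3 := intervalIntegral.integral_deriv_mul_eq_sub hA hB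
    (Continuous.intervalIntegrable (by fun_prop) _ _)
    (Continuous.intervalIntegrable (by fun_prop) _ _)
  have h4 : (∫ u in (-1 : ℝ)..1, (1 - u ^ 2) ^ j * (-Real.sin (u * r) * u)) +
      r / (2 * (j + 1)) * besselIntegral (j + 1) r = 0 := by
    rw [besselIntegral, ← intervalIntegral.integral_const_mul, ← intervalIntegral.integral_add
      (Continuous.intervalIntegrable (by fun_prop) _ _)
      (Continuous.intervalIntegrable (by fun_prop) _ _)]
    refine Eq.trans (intervalIntegral.integral_congr fun u _ => ?_) (h3.trans (by norm_num))
    field_simp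
  linarith

theorem hasFDerivAt_besselIntegral_norm (t : ℝ) (j : ℕ) (x : Eu d) :
    HasFDerivAt (fun ξ : Eu d => besselIntegral j (t * ‖ξ‖))
      ((-(t ^ 2 / (2 * (j + 1))) * besselIntegral (j + 1) (t * ‖x‖)) • innerSL ℝ x) x := by
  rcases eq_or_ne x 0 with rfl | hx
  -- The norm is not differentiable at 0, but the radial derivative vanishes there, so the increment
  -- is o(|v|) directly.
  · have h1 := hasDerivAt_besselIntegral j 0
    rw [zero_div, neg_zero, zero_mul, hasDerivAt_iff_isLittleO_nhds_zero] at h1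
    rw [map_zero, smul_zero, hasFDerivAt_iff_isLittleO_nhds_zero]
    have h2 : Tendsto (fun v : Eu d => t * ‖v‖) (𝓝 0) (𝓝 0) := by
      have : Continuous fun v : Eu d => t * ‖v‖ := by fun_prop
      simpa using this.tendsto 0
    have h3 := (h1.comp_tendsto h2).trans_isBigO (Asymptotics.isBigO_of_le' (c := |t|) (𝓝 0)
      (g := fun v : Eu d => v) fun v => by simp)
    refine h3.congr_left fun v => ?_
    simp
  · have h1 : HasFDerivAt (fun ξ : Eu d => t * ‖ξ‖) (t • ((‖x‖⁻¹) • innerSL ℝ x)) x := by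
      have h2 : HasFDerivAt (fun ξ : Eu d => ‖ξ‖) (‖x‖⁻¹ • innerSL ℝ x) x := by
        have h3 := (hasStrictFDerivAt_norm_sq x).hasFDerivAt.sqrt (by positivity)
        simp only [Real.sqrt_sq (norm_nonneg _)] at h3
        refine h3.congr_fderiv ?_
        ext v
        simp
        field_simp
      exact h2.const_mul t
    refine ((hasDerivAt_besselIntegral j (t * ‖x‖)).comp_hasFDerivAt x h1).congr_fderiv ?_
    have := norm_ne_zero_iff.2 hx
    ext v
    simp
    field_simp

theorem besselIntegral_zero (r : ℝ) : besselIntegral 0 r = 2 * Real.sinc r := by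
  rw [besselIntegral]
  rcases eq_or_ne r 0 with rfl | hr
  · norm_num
  · simp only [pow_zero, one_mul]
    rw [intervalIntegral.integral_comp_mul_right _ hr, integral_cos, Real.sinc_of_ne_zero hr]
    simp
    field_simp
    ring

/-- The Fourier transform of the wave kernel. -/
def waveSymbol (t : ℝ) (ξ : Eu d) : ℂ := ((t * Real.sinc (t * ‖ξ‖) : ℝ) : ℂ)

theorem hasTemperateGrowth_waveSymbol (t : ℝ) :
    Function.HasTemperateGrowth (waveSymbol t : Eu d → ℂ) := by
  refine Function.HasTemperateGrowth.comp Function.Complex.hasTemperateGrowth_ofReal ?_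
  have h1 : (fun ξ : Eu d => t * Real.sinc (t * ‖ξ‖)) =
      fun ξ => t / 2 * besselIntegral 0 (t * ‖ξ‖) := by
    ext ξ; rw [besselIntegral_zero]; ring
  rw [h1]
  exact (Function.HasTemperateGrowth.const _).mul (hasTemperateGrowth_of_radial
    (fun j ξ => besselIntegral j (t * ‖ξ‖)) (fun j => -(t ^ 2 / (2 * (j + 1))))
    (hasFDerivAt_besselIntegral_norm t) (fun j => ⟨2, zero_le_two, fun x =>
      abs_besselIntegral_le j _⟩) 0)

/-- At ξ = 0 the quotient sin(t|ξ|)/|ξ| takes the default value 0, while the continuous symbol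
equals t. A point is null in positive dimension, hence `Nontrivial`. -/
theorem IsWaveKernel.hasFourier [Nontrivial (Eu d)] (hG : IsWaveKernel G) {t : ℝ} (ht : 0 < t) :
    HasFourier (G t) (waveSymbol t) := by
  refine ⟨(hasTemperateGrowth_waveSymbol t).1.continuous.locallyIntegrable, fun ψ hψ => ?_⟩
  rw [(hG t ht).2 ψ hψ]
  refine integral_congr_ae ?_
  have h0 : ∀ᵐ ξ : Eu d, ξ ≠ 0 := by simp [ae_iff]
  filter_upwards [h0] with ξ hξ
  have := norm_ne_zero_iff.2 hξ
  rw [waveSymbol, Real.sinc_of_ne_zero (by positivity)]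
  congr 2
  field_simp

theorem norm_waveSymbol_le {t : ℝ} (ht : 0 ≤ t) (ξ : Eu d) : ‖waveSymbol t ξ‖ ≤ t := by
  rw [waveSymbol, Complex.norm_real, norm_mul, Real.norm_of_nonneg ht]
  exact mul_le_of_le_one_right ht (Real.abs_sinc_le_one _)

theorem norm_waveSymbol_mul_le (t : ℝ) (ξ : Eu d) : ‖waveSymbol t ξ‖ * ‖ξ‖ ≤ 1 := by
  have h1 : ‖waveSymbol t ξ‖ * ‖ξ‖ = |t * Real.sinc (t * ‖ξ‖) * ‖ξ‖| := by
    rw [waveSymbol, Complex.norm_real, abs_mul, abs_norm, Real.norm_eq_abs]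
  have h2 : t * Real.sinc (t * ‖ξ‖) * ‖ξ‖ = Real.sin (t * ‖ξ‖) := by
    rcases eq_or_ne (t * ‖ξ‖) 0 with h | h
    · rw [mul_right_comm, h, zero_mul, Real.sin_zero]
    · rw [Real.sinc_of_ne_zero h, mul_right_comm, mul_div_cancel₀ _ h]
  rw [h1, h2]
  exact Real.abs_sin_le_one _

/-- A bound for `(1 + |ξ|²)^{1/2} 𝓕G_r(ξ)` that is integrable at `r = 0`. -/
def smoothingBound (r : ℝ) : ℝ := 1 + r + r ^ (-(1 / 2) : ℝ)

theorem smoothingBound_nonneg {r : ℝ} (hr : 0 ≤ r) : 0 ≤ smoothingBound r := by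
  have := Real.rpow_nonneg hr (-(1 / 2) : ℝ)
  unfold smoothingBound
  linarith

theorem intervalIntegrable_smoothingBound (a b : ℝ) :
    IntervalIntegrable smoothingBound volume a b :=
  (Continuous.intervalIntegrable (by fun_prop) _ _).add
    (intervalIntegral.intervalIntegrable_rpow' (by norm_num))

theorem le_mul_wt_of_mul_le {a B : ℝ} (ha : 0 ≤ a) {ξ : Eu d} (h : a + a * ‖ξ‖ ≤ B) :
    a ≤ B * wt (-(1 / 2)) ξ := by
  have h1 : wt (1 / 2) ξ ≤ 1 + ‖ξ‖ := by
    rw [wt, ← Real.sqrt_eq_rpow, Real.sqrt_le_left (by positivity)]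
    nlinarith [norm_nonneg ξ]
  calc a = a * (wt (1 / 2) ξ * wt (-(1 / 2)) ξ) := by rw [wt_neg_mul, mul_one]
    _ = a * wt (1 / 2) ξ * wt (-(1 / 2)) ξ := by ring
    _ ≤ a * (1 + ‖ξ‖) * wt (-(1 / 2)) ξ := by
        have := (wt_pos (-(1 / 2)) ξ).le
        gcongr
    _ ≤ _ := mul_le_mul_of_nonneg_right (by linarith) (wt_pos _ _).le

/-- The Fourier transform of the kernel gains one derivative, with an integrable constant. -/
def IsSmoothing (G : ℝ → RealDist d) : Prop :=
  ∀ (r : ℝ) (ξ : Eu d), 0 < r → ‖propagator G r ξ‖ ≤ smoothingBound r * wt (-(1 / 2)) ξ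

theorem IsHeatKernel.hypA (hG : IsHeatKernel G) : HypA G := fun _ ht =>
  (hG.hasFourier ht).isRapidlyDecreasing (hasTemperateGrowth_gaussian ht.le)

theorem IsHeatKernel.fourierFun_eq (hG : IsHeatKernel G) {t : ℝ} (ht : 0 < t) :
    fourierFun (G t) = fun ξ => (Real.exp (-(t / 2) * ‖ξ‖ ^ 2) : ℂ) :=
  LevySPDE.fourierFun_eq (hasTemperateGrowth_gaussian ht.le).1.continuous (hG.hasFourier ht)

theorem IsHeatKernel.hypF (hG : IsHeatKernel G) : HypF G := by
  refine ⟨fun ξ => ?_, fun _ => 1, monotoneOn_const, fun t ht ξ => ?_⟩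
  · have h1 : Continuous fun t : ℝ => (Real.exp (-(t / 2) * ‖ξ‖ ^ 2) : ℂ) := by fun_prop
    exact h1.continuousOn.congr fun t ht => by rw [hG.fourierFun_eq ht]
  · rw [hG.fourierFun_eq ht, Complex.norm_real, Real.norm_of_nonneg (Real.exp_pos _).le,
      Real.exp_le_one_iff]
    have : 0 ≤ t / 2 * ‖ξ‖ ^ 2 := by positivity
    linarith

theorem IsHeatKernel.isSmoothing (hG : IsHeatKernel G) : IsSmoothing G := by
  intro r ξ hr
  rw [propagator_of_pos hr, hG.fourierFun_eq hr, Complex.norm_real,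
    Real.norm_of_nonneg (Real.exp_pos _).le]
  refine le_mul_wt_of_mul_le (Real.exp_pos _).le ?_
  have h1 : Real.exp (-(r / 2) * ‖ξ‖ ^ 2) ≤ 1 := by
    rw [Real.exp_le_one_iff]
    have : 0 ≤ r / 2 * ‖ξ‖ ^ 2 := by positivity
    linarith
  -- With a = √r |ξ|, this is a ≤ 1 + a²/2 ≤ exp(a²/2).
  have h2 : Real.exp (-(r / 2) * ‖ξ‖ ^ 2) * ‖ξ‖ ≤ r ^ (-(1 / 2) : ℝ) := by
    rw [Real.rpow_neg hr.le, ← Real.sqrt_eq_rpow, neg_mul, Real.exp_neg, inv_mul_le_iff₀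
      (Real.exp_pos _), ← div_eq_mul_inv, le_div_iff₀ (Real.sqrt_pos.2 hr)]
    have h3 := Real.add_one_le_exp (r / 2 * ‖ξ‖ ^ 2)
    nlinarith [sq_nonneg (‖ξ‖ * Real.sqrt r - 1), Real.sq_sqrt hr.le]
  unfold smoothingBound
  linarith

theorem IsWaveKernel.hypA [Nontrivial (Eu d)] (hG : IsWaveKernel G) : HypA G := fun t ht =>
  (hG.hasFourier ht).isRapidlyDecreasing (hasTemperateGrowth_waveSymbol t)

theorem IsWaveKernel.fourierFun_eq [Nontrivial (Eu d)] (hG : IsWaveKernel G) {t : ℝ} (ht : 0 < t) :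
    fourierFun (G t) = waveSymbol t :=
  LevySPDE.fourierFun_eq (hasTemperateGrowth_waveSymbol t).1.continuous (hG.hasFourier ht)

theorem IsWaveKernel.hypF [Nontrivial (Eu d)] (hG : IsWaveKernel G) : HypF G := by
  refine ⟨fun ξ => ?_, fun t => t, monotoneOn_id, fun t ht ξ => ?_⟩
  · have h1 : Continuous fun t : ℝ => waveSymbol t ξ :=
      Complex.continuous_ofReal.comp
        (continuous_id.mul (Real.continuous_sinc.comp (continuous_id.mul continuous_const)))
    exact h1.continuousOn.congr fun t ht => by rw [hG.fourierFun_eq ht]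
  · rw [hG.fourierFun_eq ht]
    exact norm_waveSymbol_le ht.le ξ

/-- The symbol is at most r, and at most 1/|ξ| for ξ ≠ 0; the singular term of `smoothingBound` is
needed only for the heat kernel. -/
theorem IsWaveKernel.isSmoothing [Nontrivial (Eu d)] (hG : IsWaveKernel G) : IsSmoothing G := by
  intro r ξ hr
  rw [propagator_of_pos hr, hG.fourierFun_eq hr]
  refine le_mul_wt_of_mul_le (norm_nonneg _) ?_
  have h1 := norm_waveSymbol_le hr.le ξ
  have h2 := norm_waveSymbol_mul_le r ξ
  have h3 := Real.rpow_nonneg hr.le (-(1 / 2) : ℝ)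
  unfold smoothingBound
  linarith

end Kernels

/-! ### Consequences of Dalang's condition for smoothing kernels. -/

section Smoothing

variable {d : ℕ} {Ω : Type*} [MeasurableSpace Ω] {κ : Eu d → ℝ≥0∞} {h : Eu d → ℂ} {ν : Measure ℝ}
  {N : Ω → Measure (Eu d × ℝ)} {P : Measure Ω}
  {Θ : Lp ℂ 2 (spectralMeasure h) →L[ℝ] Lp ℝ 2 P} {G : ℝ → RealDist d}

/-- Dalang's condition says exactly that (1 + |ξ|²)^{-1/2} is in L²(μ); this is the dominating
function throughout. -/
theorem lintegral_wt_sq_ne_top (hD : DalangCondition h) (B : ℝ) :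
    ∫⁻ ξ, ENNReal.ofReal (B * wt (-(1 / 2)) ξ) ^ 2 ∂(spectralMeasure h) ≠ ∞ := by
  have h1 : ∀ ξ : Eu d, ENNReal.ofReal (B * wt (-(1 / 2)) ξ) ^ 2 =
      ENNReal.ofReal B ^ 2 * ENNReal.ofReal ((1 + ‖ξ‖ ^ 2)⁻¹) := fun ξ => by
    rw [ENNReal.ofReal_mul' (wt_pos _ _).le, mul_pow, ← ENNReal.ofReal_pow (wt_pos _ _).le, sq (wt _ _),
      ← wt_add]
    congr 2
    rw [wt, ← Real.rpow_neg_one]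
    norm_num
  simp only [h1]
  rw [lintegral_const_mul' _ _ (by finiteness)]
  exact ENNReal.mul_ne_top (by finiteness) hD.ne

theorem memLp_of_le_wt (hD : DalangCondition h) {w : Eu d → ℂ} (hw : Measurable w) {B : ℝ}
    (hB : ∀ ξ, ‖w ξ‖ ≤ B * wt (-(1 / 2)) ξ) : MemLp w 2 (spectralMeasure h) := by
  refine (memLp_two_iff_lintegral hw.aestronglyMeasurable).2 (lt_of_le_of_lt ?_
    (lintegral_wt_sq_ne_top hD B).lt_top)
  refine lintegral_mono fun ξ => ?_
  gcongr
  rw [← ofReal_norm]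
  exact ENNReal.ofReal_le_ofReal (hB ξ)

theorem intervalIntegrable_propagator (hA : HypA G) (hF : HypF G) (ξ : Eu d) (a b : ℝ) :
    IntervalIntegrable (fun r => propagator G r ξ) volume a b := by
  obtain ⟨C, hC0, hC⟩ := hF.exists_bound
  have hm : Measurable fun r => propagator G r ξ :=
    (measurable_propagator hA hF).comp (measurable_id.prodMk measurable_const)
  refine (intervalIntegrable_const (c := C (max a b))).mono_fun hm.aestronglyMeasurable ?_
  filter_upwards [ae_restrict_mem measurableSet_uIoc] with r hr
  exact (hC r _ hr.2 ξ).trans (Real.le_norm_self _)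

theorem Hfun_eq_integral_propagator {t : ℝ} (ht : 0 ≤ t) (ξ : Eu d) :
    Hfun G t ξ = ∫ r in (0 : ℝ)..t, propagator G r ξ := by
  rw [Hfun_eq t ξ ht, intervalIntegral.integral_comp_sub_left (fun r => propagator G r ξ)]
  simp

theorem continuousOn_Hfun (hA : HypA G) (hF : HypF G) (ξ : Eu d) :
    ContinuousOn (fun t => Hfun G t ξ) (Ici 0) :=
  (intervalIntegral.continuous_primitive (intervalIntegrable_propagator hA hF ξ) 0).continuousOn.congr
    fun _ ht => Hfun_eq_integral_propagator ht ξ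

theorem IsSmoothing.norm_Hfun_le (hG : IsSmoothing G) {s t : ℝ} (hs : 0 ≤ s) (hst : s ≤ t)
    (ξ : Eu d) : ‖Hfun G s ξ‖ ≤ (∫ r in (0 : ℝ)..t, smoothingBound r) * wt (-(1 / 2)) ξ := by
  rw [Hfun_eq_integral_propagator hs]
  have h1 := intervalIntegral.norm_integral_le_of_norm_le (μ := volume) hs
    (f := fun r => propagator G r ξ) (g := fun r => smoothingBound r * wt (-(1 / 2)) ξ)
    (Eventually.of_forall fun r hr => hG r ξ hr.1)
    ((intervalIntegrable_smoothingBound 0 s).mul_const _)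
  rw [intervalIntegral.integral_mul_const] at h1
  refine h1.trans (mul_le_mul_of_nonneg_right ?_ (wt_pos _ _).le)
  refine intervalIntegral.integral_mono_interval le_rfl hs hst ?_
    (intervalIntegrable_smoothingBound 0 t)
  filter_upwards [ae_restrict_mem measurableSet_Ioc] with r hr
  exact smoothingBound_nonneg hr.1.le

theorem IsSmoothing.condBounded (hG : IsSmoothing G) (hD : DalangCondition h) :
    CondBounded G h := by
  intro T hT
  refine lt_of_le_of_lt (iSup₂_le fun t ht => ?_)
    (lintegral_wt_sq_ne_top hD (∫ r in (0 : ℝ)..T, smoothingBound r)).lt_top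
  refine lintegral_mono fun ξ => ?_
  gcongr
  rw [← ofReal_norm]
  exact ENNReal.ofReal_le_ofReal (hG.norm_Hfun_le ht.1 ht.2 ξ)

theorem IsSmoothing.condContinuous (hG : IsSmoothing G) (hD : DalangCondition h) (hA : HypA G)
    (hF : HypF G) : CondContinuous G h := by
  intro s hs
  set B := ∫ r in (0 : ℝ)..(s + 1), smoothingBound r
  have hle : ∀ t : ℝ, 0 ≤ t → t ≤ s + 1 → ∀ ξ : Eu d,
      ‖Hfun G t ξ‖ₑ ≤ ENNReal.ofReal (B * wt (-(1 / 2)) ξ) := fun t ht hts ξ => by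
    rw [← ofReal_norm]
    exact ENNReal.ofReal_le_ofReal (hG.norm_Hfun_le ht hts ξ)
  have h2 := tendsto_lintegral_filter_of_dominated_convergence (μ := spectralMeasure h)
    (l := 𝓝[Ici 0] s) (F := fun t ξ => ‖Hfun G t ξ - Hfun G s ξ‖ₑ ^ 2) (f := fun _ => 0)
    (fun ξ => 4 * ENNReal.ofReal (B * wt (-(1 / 2)) ξ) ^ 2) ?_ ?_ ?_ ?_
  · simpa using h2
  · filter_upwards [self_mem_nhdsWithin] with t ht
    have := measurable_Hfun hA hF ht
    have := measurable_Hfun hA hF hs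
    fun_prop
  · filter_upwards [self_mem_nhdsWithin, nhdsWithin_le_nhds (Iic_mem_nhds (lt_add_one s))]
      with t ht hts
    refine Eventually.of_forall fun ξ => ?_
    calc ‖Hfun G t ξ - Hfun G s ξ‖ₑ ^ 2
        ≤ (ENNReal.ofReal (B * wt (-(1 / 2)) ξ) + ENNReal.ofReal (B * wt (-(1 / 2)) ξ)) ^ 2 := by
          gcongr
          exact enorm_sub_le.trans (add_le_add (hle t ht hts ξ) (hle s hs (by linarith) ξ))
      _ = 4 * ENNReal.ofReal (B * wt (-(1 / 2)) ξ) ^ 2 := by ring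
  · rw [lintegral_const_mul' _ _ (by norm_num)]
    exact ENNReal.mul_ne_top (by norm_num) (lintegral_wt_sq_ne_top hD B)
  · refine Eventually.of_forall fun ξ => ?_
    have h3 := (ENNReal.continuous_pow 2).tendsto _ |>.comp
      ((continuousOn_Hfun hA hF ξ s hs).sub_const (Hfun G s ξ)).enorm
    simpa [Function.comp_def] using h3

/-- The Fourier transform `exp(-i ξ·x) conj (𝓕G_r(ξ))` of `G_r(x - ·)`. -/
def kernelSymbol (G : ℝ → RealDist d) (x : Eu d) (r : ℝ) (ξ : Eu d) : ℂ :=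
  chr ξ (-x) * starRingEnd ℂ (propagator G r ξ)

theorem norm_kernelSymbol (x : Eu d) (r : ℝ) (ξ : Eu d) :
    ‖kernelSymbol G x r ξ‖ = ‖propagator G r ξ‖ := by
  rw [kernelSymbol, norm_mul, norm_chr, one_mul, RCLike.norm_conj]

theorem measurable_kernelSymbol (hA : HypA G) (hF : HypF G) (x : Eu d) :
    Measurable (Function.uncurry (kernelSymbol G x)) := by
  have h1 : Continuous fun p : ℝ × Eu d => chr p.2 (-x) := by fun_prop
  exact h1.measurable.mul (Complex.continuous_conj.measurable.comp (measurable_propagator hA hF))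

theorem IsSmoothing.norm_kernelSymbol_le (hG : IsSmoothing G) (x : Eu d) {r : ℝ} (hr : 0 < r)
    (ξ : Eu d) : ‖kernelSymbol G x r ξ‖ ≤ smoothingBound r * wt (-(1 / 2)) ξ :=
  (norm_kernelSymbol x r ξ).trans_le (hG r ξ hr)

theorem IsSmoothing.memLp_kernelSymbol (hG : IsSmoothing G) (hD : DalangCondition h) (hA : HypA G)
    (hF : HypF G) (x : Eu d) (r : ℝ) : MemLp (kernelSymbol G x r) 2 (spectralMeasure h) := by
  rcases lt_or_ge 0 r with hr | hr
  · have hm : Measurable (kernelSymbol G x r) :=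
      (measurable_kernelSymbol hA hF x).of_uncurry_left
    exact memLp_of_le_wt hD hm (hG.norm_kernelSymbol_le x hr)
  · have : kernelSymbol G x r = 0 := by ext ξ; simp [kernelSymbol, propagator_of_nonpos hr]
    rw [this]
    exact MemLp.zero

theorem hasFourier_kernelSymbol (hA : HypA G) (hF : HypF G) (x : Eu d) {r : ℝ} (hr : 0 < r) :
    HasFourier (shifted (G r) x) (kernelSymbol G x r) := by
  obtain ⟨C, -, hC⟩ := hF.exists_bound
  have h1 := (hA.continuous_hasFourier hr).2
  rw [← propagator_of_pos hr] at h1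
  have h2 := h1.shifted (hC r r le_rfl) x
  simp only [propagator_neg hA hF] at h2
  exact h2

/-- The approximation in the definition of X(S) is convergence in L²(μ), so continuity of Θ
determines the limit, whatever the approximating sequence and the version of 𝓕S. -/
theorem IsNoiseIntegral.eq (hΘ : IsSpectralIntegral κ h ν N P Θ) (hκ : KernelAssumption κ h)
    {S : RealDist d} {Z : Lp ℝ 2 P} (hZ : IsNoiseIntegral κ h ν N P S Z) {g : Eu d → ℂ}
    (hS : HasFourier S g) (hg : MemLp g 2 (spectralMeasure h)) : Z = Θ (hg.toLp g) := by
  obtain ⟨g', hg', -, φ, -, hφ, hZφ⟩ := hZ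
  have hgg : g' =ᵐ[spectralMeasure h] g :=
    (spectralMeasure_absolutelyContinuous h).ae_eq (hg'.unique hS)
  have h1 : Tendsto (fun n => (hκ.memLp_schwartz (fourierS (ofR (φ n)))).toLp _) atTop
      (𝓝 (hg.toLp g)) := by
    rw [tendsto_iff_edist_tendsto_0]
    refine tendsto_zero_of_sq (hφ.congr fun n => ?_)
    rw [edist_eq_enorm_sub, ← MemLp.toLp_sub, enorm_toLp_sq]
    refine lintegral_congr_ae ?_
    filter_upwards [hgg] with ξ hξ
    rw [hξ]
    rfl
  refine tendsto_nhds_unique hZφ (((Θ.continuous.tendsto _).comp h1).congr fun n => ?_)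
  rw [Function.comp_apply, hΘ.noise_eq]

theorem IsSmoothing.continuousOn_kernelSymbol (hG : IsSmoothing G) (hD : DalangCondition h)
    (hA : HypA G) (hF : HypF G) (x : Eu d) :
    ContinuousOn (fun r => (hG.memLp_kernelSymbol hD hA hF x r).toLp (kernelSymbol G x r))
      (Ioi 0) := by
  intro r hr
  have hm := measurable_kernelSymbol hA hF x
  have hr' : 0 < r := hr
  -- An upper bound of `smoothingBound` on (r/2, r + 1), where the singularity at 0 is avoided.
  set B := 2 + r + (r / 2) ^ (-(1 / 2) : ℝ) with hB
  have hle : ∀ s, r / 2 < s → s < r + 1 → ∀ ξ,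
      ‖kernelSymbol G x s ξ‖ₑ ≤ ENNReal.ofReal (B * wt (-(1 / 2)) ξ) := fun s h1 h2 ξ => by
    rw [← ofReal_norm]
    refine ENNReal.ofReal_le_ofReal ((hG.norm_kernelSymbol_le x (by linarith) ξ).trans ?_)
    refine mul_le_mul_of_nonneg_right ?_ (wt_pos _ _).le
    have := Real.rpow_le_rpow_of_nonpos (by linarith) h1.le (show (-(1 / 2) : ℝ) ≤ 0 by norm_num)
    unfold smoothingBound
    linarith
  refine tendsto_toLp (fun i => hm.comp measurable_prodMk_left)
    (hm.comp (measurable_prodMk_left (x := r))) _ _ (lintegral_wt_sq_ne_top hD B) ?_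
    (hle r (by linarith) (by linarith)) fun ξ => ?_
  · filter_upwards [nhdsWithin_le_nhds (Ioo_mem_nhds (show r / 2 < r by linarith)
      (lt_add_one r))] with s hs
    exact hle s hs.1 hs.2
  · have h1 := continuousOn_propagator hF ξ r hr
    exact (Complex.continuous_conj.continuousAt.tendsto.comp h1).const_mul _

theorem IsSmoothing.integrableOn_kernelSymbol (hG : IsSmoothing G) (hD : DalangCondition h)
    (hA : HypA G) (hF : HypF G) (x : Eu d) {t : ℝ} (ht : 0 ≤ t) :
    IntegrableOn (fun s => (hG.memLp_kernelSymbol hD hA hF x (t - s)).toLp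
      (kernelSymbol G x (t - s))) (Ioo 0 t) := by
  have hc : ContinuousOn (fun s => (hG.memLp_kernelSymbol hD hA hF x (t - s)).toLp
      (kernelSymbol G x (t - s))) (Ioo 0 t) :=
    (hG.continuousOn_kernelSymbol hD hA hF x).comp (by fun_prop) fun s hs => sub_pos.2 hs.2
  have hw : MemLp (fun ξ : Eu d => (wt (-(1 / 2)) ξ : ℂ)) 2 (spectralMeasure h) :=
    memLp_of_le_wt hD (Complex.continuous_ofReal.comp (continuous_wt _)).measurable (B := 1)
      fun ξ => by rw [Complex.norm_real, Real.norm_of_nonneg (wt_pos _ _).le, one_mul]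
  have hi : IntegrableOn (fun s => smoothingBound (t - s)) (Ioo 0 t) := by
    have := (intervalIntegrable_smoothingBound t 0).comp_sub_left t
    rw [sub_self, sub_zero, intervalIntegrable_iff_integrableOn_Ioo_of_le ht] at this
    exact this
  refine (hi.mul_const ‖hw.toLp _‖).mono' (hc.aestronglyMeasurable measurableSet_Ioo) ?_
  filter_upwards [ae_restrict_mem measurableSet_Ioo] with s hs
  refine Lp.norm_le_mul_norm_of_ae_le_mul ?_
  filter_upwards [(hG.memLp_kernelSymbol hD hA hF x (t - s)).coeFn_toLp, hw.coeFn_toLp]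
    with ξ h1 h2
  rw [h1, h2, Complex.norm_real, Real.norm_of_nonneg (wt_pos _ _).le]
  exact hG.norm_kernelSymbol_le x (sub_pos.2 hs.2) ξ

theorem integral_kernelSymbol (t : ℝ≥0) (x ξ : Eu d) :
    ∫ s in Ioo 0 (t : ℝ), kernelSymbol G x (t - s) ξ = fieldSymbol G t x ξ := by
  simp only [kernelSymbol]
  rw [integral_const_mul, integral_conj, fieldSymbol, Hfun_eq _ ξ t.coe_nonneg,
    intervalIntegral.integral_of_le t.coe_nonneg, integral_Ioc_eq_integral_Ioo]

/-- The smoothing bound makes s ↦ 𝓕(G_{t-s}(x - ·)) Bochner integrable in L²(μ), so the stochastic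
Fubini theorem identifies the solution with no assumed representation. -/
theorem IsRandomFieldSolution.ae_eq [SigmaFinite P] (hΘ : IsSpectralIntegral κ h ν N P Θ)
    (hκ : KernelAssumption κ h) (hG : IsSmoothing G) (hD : DalangCondition h) (hA : HypA G)
    (hF : HypF G) {u : ℝ≥0 → Eu d → Ω → ℝ} (hu : IsRandomFieldSolution κ h ν N P G u)
    (t : ℝ≥0) (x : Eu d) (hm : MemLp (fieldSymbol G t x) 2 (spectralMeasure h)) :
    u t x =ᵐ[P] Θ (hm.toLp (fieldSymbol G t x)) := by
  obtain ⟨Y, hY, hYZ, -, huY⟩ := hu t x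
  have hYw : ∀ᵐ s ∂(volume.restrict (Ioo 0 (t : ℝ))), Y s =ᵐ[P]
      Θ ((hG.memLp_kernelSymbol hD hA hF x (t - s)).toLp (kernelSymbol G x (t - s))) := by
    filter_upwards [ae_restrict_mem measurableSet_Ioo] with s hs
    obtain ⟨Z, hZ, hYZ'⟩ := hYZ s ⟨hs.1.le, hs.2⟩
    rwa [hZ.eq hΘ hκ (hasFourier_kernelSymbol hA hF x (sub_pos.2 hs.2))
      (hG.memLp_kernelSymbol hD hA hF x (t - s))] at hYZ'
  obtain ⟨hw', -, h2⟩ := integral_spectralIntegral (l := volume.restrict (Ioo 0 (t : ℝ))) Θ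
    (w := fun s => kernelSymbol G x (t - s))
    ((measurable_kernelSymbol hA hF x).comp
      ((measurable_const.sub measurable_fst).prodMk measurable_snd))
    (fun s => hG.memLp_kernelSymbol hD hA hF x (t - s))
    (hG.integrableOn_kernelSymbol hD hA hF x t.coe_nonneg) hY hYw
  refine huY.trans ((EventuallyEq.of_eq (funext fun ω => ?_)).trans
    (h2.trans (EventuallyEq.of_eq ?_)))
  · rw [intervalIntegral.integral_of_le t.coe_nonneg, integral_Ioc_eq_integral_Ioo]
  · rw [MemLp.toLp_congr hw' hm (Eventually.of_forall fun ξ => integral_kernelSymbol t x ξ)]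

end Smoothing

end LevySPDE

end

/-! ### Assembly of the theorem. -/

open LevySPDE in
theorem mainTheorem7 {d : ℕ} (hd : 1 ≤ d) {Ω : Type*} [MeasurableSpace Ω]
    (P : Measure Ω) [IsProbabilityMeasure P]
    (ν : Measure ℝ) (hν : IsJumpMeasure ν)
    (N : Ω → Measure (Eu d × ℝ))
    (hN : IsPoissonRandomMeasure N ((volume : Measure (Eu d)).prod ν) P)
    (κ : Eu d → ℝ≥0∞) (h : Eu d → ℂ) (hκ : KernelAssumption κ h) :
    (∀ G : ℝ → RealDist d, HypA G → HypF G →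
      (∃ v : ℝ≥0 → 𝓢(Eu d, ℝ) → Ω → ℝ, IsDistributionSolution κ ν N P G v) ∧
      ∀ v : ℝ≥0 → 𝓢(Eu d, ℝ) → Ω → ℝ, IsDistributionSolution κ ν N P G v →
        ((∃ V : ℝ≥0 → Eu d → Ω → ℝ, IsFieldVersion P v V) ↔
          CondBounded G h ∧ CondContinuous G h) ∧
        ∀ V : ℝ≥0 → Eu d → Ω → ℝ, IsFieldVersion P v V →
          ∀ u : ℝ≥0 → Eu d → Ω → ℝ, IsRandomFieldSolution κ h ν N P G u →
            HasFubiniRepresentation κ ν N P G u → ∀ t x, V t x =ᵐ[P] u t x) ∧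
    (DalangCondition h → ∀ G : ℝ → RealDist d, IsHeatKernel G ∨ IsWaveKernel G →
      HypA G ∧ HypF G ∧ CondBounded G h ∧ CondContinuous G h ∧
      ∀ v : ℝ≥0 → 𝓢(Eu d, ℝ) → Ω → ℝ, IsDistributionSolution κ ν N P G v →
        (∃ V : ℝ≥0 → Eu d → Ω → ℝ, IsFieldVersion P v V) ∧
        ∀ V : ℝ≥0 → Eu d → Ω → ℝ, IsFieldVersion P v V →
          ∀ u : ℝ≥0 → Eu d → Ω → ℝ, IsRandomFieldSolution κ h ν N P G u →
            ∀ t x, V t x =ᵐ[P] u t x) := by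
  obtain ⟨Θ, hΘ⟩ := exists_isSpectralIntegral hν hN hκ
  -- Every field version is Θ of the same symbol, so both modification statements reduce to
  -- computing u(t,x).
  have hmod : ∀ (G : ℝ → RealDist d) (hA : HypA G) (hF : HypF G)
      (v : ℝ≥0 → 𝓢(Eu d, ℝ) → Ω → ℝ), IsDistributionSolution κ ν N P G v →
      ∀ V : ℝ≥0 → Eu d → Ω → ℝ, IsFieldVersion P v V → ∀ t x,
      ∃ hm : MemLp (fieldSymbol G t x) 2 (spectralMeasure h),
        V t x =ᵐ[P] Θ (hm.toLp (fieldSymbol G t x)) := fun G hA hF v hv V hV t x =>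
    ⟨hV.memLp_fieldSymbol hν hΘ hκ hA hF hv t x, by
      rw [← hV.toLp_eq hν hΘ hκ hA hF hv t x]
      exact (hV.memLp t x).coeFn_toLp.symm⟩
  refine ⟨fun G hA hF => ⟨exists_isDistributionSolution hΘ hκ hA hF, fun v hv =>
    ⟨exists_isFieldVersion_iff hν hΘ hκ hA hF hv, fun V hV u _ hu t x => ?_⟩⟩, fun hD G hG => ?_⟩
  · obtain ⟨hm, hVm⟩ := hmod G hA hF v hv V hV t x
    exact hVm.trans (hu.ae_eq hΘ hκ hA hF t x hm).symm
  -- The condition d ≥ 1 enters only here, through the nontriviality of ℝ^d used for the wave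
  -- kernel.
  · have : Nonempty (Fin d) := ⟨⟨0, hd⟩⟩
    obtain ⟨hA, hF, hS⟩ : HypA G ∧ HypF G ∧ IsSmoothing G := by
      rcases hG with hG | hG
      · exact ⟨hG.hypA, hG.hypF, hG.isSmoothing⟩
      · exact ⟨hG.hypA, hG.hypF, hG.isSmoothing⟩
    have hb := hS.condBounded hD
    have hc := hS.condContinuous hD hA hF
    refine ⟨hA, hF, hb, hc, fun v hv => ⟨(exists_isFieldVersion_iff hν hΘ hκ hA hF hv).2 ⟨hb, hc⟩,
      fun V hV u hu t x => ?_⟩⟩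
    obtain ⟨hm, hVm⟩ := hmod G hA hF v hv V hV t x
    exact hVm.trans (hu.ae_eq hΘ hκ hS hD hA hF t x hm).symm
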